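/- **Conventions.** Let $\mathsf{Top}$ be the category of topological spaces and $\mathsf{Diff}$ the category of smooth manifolds (finite-dimensional, Hausdorff, second countable) and smooth maps; Lie groups are second countable. For a topological (resp. Lie) group $G$ acting continuously (resp. smoothly) on a space (resp. manifold) $X$, the quotient stack $[X/G]$ over $\mathsf{Top}$ (resp. $\mathsf{Diff}$) is the category whose objects are diagrams $(B\leftarrow E\to X)$ with $E\to B$ a (locally trivial) principal $G$-bundle and $E\to X$ a $G$-equivariant map, and whose morphisms are pairs $(E\to E',B\to B')$, with $E\to E'$ equivariant, that form a Cartesian square and commute with the maps to $X$; it is a stack via $(B\leftarrow E\to X)\mapsto B$. Two stacks are equivalent if there is a functor between them that commutes with the projections to the base category and is an equivalence of categories. A stack over $\mathsf{Diff}$ is Deligne–Mumford if it has an étale presentation $p:\underline V\to\mathcal X$ (that is, $p$ is representable and all its representatives are surjective local diffeomorphisms) and a proper diagonal (that is, $\underline V\times_{\mathcal X}\underline V\to \underline V\times \underline V$ is proper). A Deligne–Mumford stack is a *discrete* (resp. *global*) *quotient* if it is equivalent to $[Y/\Gamma]$ for a discrete (resp. finite) group $\Gamma$ acting smoothly on a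 smooth manifold $Y$. **Lemma.** Let $1\to H\to G\to\Gamma\to 1$ be an exact sequence of groups, and let $G$ act on $X$. (a) *Over $\mathsf{Top}$.* Suppose that $H,G,\Gamma$ are topological groups, that $H\to G$ is an embedding and $G\to\Gamma$ a topological quotient map, that $X$ is a topological space on which $G$ acts continuously, and that $H$ acts on $X$ freely in the sense that the action is free and the orbit projection $X\to X/H$ is a (locally trivial) principal $H$-bundle. Then $[X/G]$ and $[(X/H)/\Gamma]$ are equivalent as stacks over $\mathsf{Top}$. (b) *Over $\mathsf{Diff}$.* Suppose that $H,G,\Gamma$ are Lie groups, that the maps of the sequence are smooth, that $X$ is a smooth manifold on which $G$ acts smoothly, and that the restriction of the action to $H$ is free and proper. Then the orbit space $X/H$ is a smooth manifold for which $X\to X/H$ is a submersion, $\Gamma$ acts smoothly on it, and $[X/G]$ and $[(X/H)/\Gamma]$ are equivalent as stacks over $\mathsf{Diff}$. **Corollary.** Let a Lie group $G$ act smoothly and properly on a connected smooth manifold $X$, let $G_0$ be the identity component of $G$, and suppose that $G_0$ acts freely on $X$. Then the group $\Gamma=G/G_0$ is discrete, $X/G_0$ is a smooth manifold for which $X\to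 X/G_0$ is a submersion and on which $\Gamma$ acts smoothly, and $[X/G]$ and $[(X/G_0)/\Gamma]$ are equivalent as stacks over $\mathsf{Diff}$; hence $[X/G]$ is a discrete quotient (in particular, it is a Deligne–Mumford stack). If in addition $G$ is compact, then $[X/G]$ is a global quotient. -/

import Mathlib

open CategoryTheory CategoryTheory.Limits Topology
open scoped Manifold ContDiff

universe v₁ w₁ v₂ w₂ v₃ w₃ u

noncomputable section

namespace QuotientStacks

/-! ### Morphisms and fibre products of categories over a base -/

section Based

variable {𝒮 : Type w₁} [Category.{v₁} 𝒮]

/-- Two categories over `𝒮` are equivalent if there is a functor between them that commutes with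
the projections to `𝒮` and is an equivalence of categories. -/
def AreEquivalent (𝒳 : BasedCategory.{v₂, w₂} 𝒮) (𝒴 : BasedCategory.{v₃, w₃} 𝒮) : Prop :=
  ∃ F : BasedFunctor 𝒳 𝒴, F.toFunctor.IsEquivalence

/-- The stack `M̲` of a space `M`: objects are the maps `E ⟶ M`, morphisms are the maps over `M`,
and the projection sends `E ⟶ M` to `E`. -/
def underline (M : 𝒮) : BasedCategory 𝒮 := BasedCategory.ofFunctor (Over.forget M)

/-- The morphism of stacks `M̲ ⟶ N̲` induced by a map `f : M ⟶ N`. -/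
def underlineMap {M N : 𝒮} (f : M ⟶ N) : BasedFunctor (underline M) (underline N) where
  toFunctor := Over.map f
  w := rfl

variable {𝒳 : BasedCategory.{v₂, w₂} 𝒮} {𝒴 : BasedCategory.{v₃, w₃} 𝒮}
  {𝒵 : BasedCategory.{v₃, w₃} 𝒮}

/-- Objects of the fibre product `𝒴 ×_𝒳 𝒵`: an object of `𝒴`, an object of `𝒵` and an
isomorphism over an identity of `𝒮` between their images in `𝒳`. -/
structure FibObj (F : BasedFunctor 𝒴 𝒳) (K : BasedFunctor 𝒵 𝒳) where
  left : 𝒴.obj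
  right : 𝒵.obj
  iso : F.obj left ≅ K.obj right
  isHomLift : 𝒳.p.IsHomLift (𝟙 (𝒴.p.obj left)) iso.hom

/-- Morphisms of the fibre product: a morphism of `𝒴` and a morphism of `𝒵` over the same
morphism of `𝒮`, compatible with the given isomorphisms. -/
@[ext]
structure FibHom {F : BasedFunctor 𝒴 𝒳} {K : BasedFunctor 𝒵 𝒳} (P Q : FibObj F K) where
  left : P.left ⟶ Q.left
  right : P.right ⟶ Q.right
  isHomLift : 𝒵.p.IsHomLift (𝒴.p.map left) right
  comm : F.map left ≫ Q.iso.hom = P.iso.hom ≫ K.map right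

theorem FibObj.base_eq {F : BasedFunctor 𝒴 𝒳} {K : BasedFunctor 𝒵 𝒳} (P : FibObj F K) :
    𝒵.p.obj P.right = 𝒴.p.obj P.left := by
  have := P.isHomLift
  rw [← K.w_obj]
  exact IsHomLift.codomain_eq 𝒳.p (𝟙 (𝒴.p.obj P.left)) P.iso.hom

instance (F : BasedFunctor 𝒴 𝒳) (K : BasedFunctor 𝒵 𝒳) : Category (FibObj F K) where
  Hom := FibHom
  id P :=
    { left := 𝟙 _
      right := 𝟙 _
      isHomLift := by
        rw [CategoryTheory.Functor.map_id]
        exact IsHomLift.id P.base_eq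
      comm := by simp }
  comp {P Q R} f g :=
    { left := f.left ≫ g.left
      right := f.right ≫ g.right
      isHomLift := by
        have := f.isHomLift
        have := g.isHomLift
        rw [Functor.map_comp]
        infer_instance
      comm := by
        rw [Functor.map_comp, Functor.map_comp, Category.assoc, g.comm, ← Category.assoc, f.comm,
          Category.assoc] }
  id_comp f := by apply FibHom.ext <;> simp
  comp_id f := by apply FibHom.ext <;> simp
  assoc f g h := by apply FibHom.ext <;> simp

/-- The fibre product `𝒴 ×_𝒳 𝒵` of categories over `𝒮`. -/
def fiberProduct (F : BasedFunctor 𝒴 𝒳) (K : BasedFunctor 𝒵 𝒳) : BasedCategory 𝒮 :=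
  BasedCategory.ofFunctor (𝒳 := FibObj F K)
    { obj := fun P => 𝒴.p.obj P.left
      map := fun f => 𝒴.p.map (FibHom.left f)
      map_id := fun _ => CategoryTheory.Functor.map_id _ _
      map_comp := fun _ _ => Functor.map_comp _ _ _ }

/-- The first projection of the fibre product. -/
def fiberProduct.fst (F : BasedFunctor 𝒴 𝒳) (K : BasedFunctor 𝒵 𝒳) :
    BasedFunctor (fiberProduct F K) 𝒴 where
  obj := fun P => FibObj.left P
  map := fun f => FibHom.left f
  map_id := fun _ => rfl
  map_comp := fun _ _ => rfl
  w := rfl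

/-- The second projection of the fibre product. -/
def fiberProduct.snd (F : BasedFunctor 𝒴 𝒳) (K : BasedFunctor 𝒵 𝒳) :
    BasedFunctor (fiberProduct F K) 𝒵 where
  obj := fun P => FibObj.right P
  map := fun f => FibHom.right f
  map_id := fun _ => rfl
  map_comp := fun _ _ => rfl
  w := CategoryTheory.Functor.ext (fun P => FibObj.base_eq (F := F) (K := K) P) (fun P Q f => by
    have := FibHom.isHomLift f
    exact IsHomLift.fac' 𝒵.p (𝒴.p.map (FibHom.left f)) (FibHom.right f))

/-- The space `Z` with the maps `a : Z ⟶ V` and `b : Z ⟶ W` represents the fibre product of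
`p : V̲ ⟶ 𝒳` and `q : W̲ ⟶ 𝒳`: there is an equivalence from `Z̲` to the fibre product whose
composites with the two projections are 2-isomorphic to the morphisms induced by `a` and `b`. -/
def Represents {V W Z : 𝒮} (p : BasedFunctor (underline V) 𝒳)
    (q : BasedFunctor (underline W) 𝒳) (a : Z ⟶ V) (b : Z ⟶ W) : Prop :=
  ∃ Φ : BasedFunctor (underline Z) (fiberProduct p q), Φ.toFunctor.IsEquivalence ∧
    Nonempty (Φ.comp (fiberProduct.fst p q) ≅ underlineMap a) ∧
    Nonempty (Φ.comp (fiberProduct.snd p q) ≅ underlineMap b)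

end Based

/-! ### The orbit space of the normal subgroup of a group extension -/

section Orbits

variable {H G Γ : Type u} [Group H] [Group G] [Group Γ]

/-- The orbit space `X/H`, for `1 → H → G → Γ → 1` exact and `G` acting on `X`. -/
def OrbitSpace (S : GroupExtension H G Γ) (X : Type u) [MulAction G X] : Type u :=
  MulAction.orbitRel.Quotient S.inl.range X

variable (S : GroupExtension H G Γ) {X : Type u} [MulAction G X]

/-- The orbit projection `X → X/H`. -/
def orbitMk (x : X) : OrbitSpace S X := Quotient.mk (MulAction.orbitRel S.inl.range X) x

/-- `X/H` carries the quotient topology. -/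
instance [TopologicalSpace X] : TopologicalSpace (OrbitSpace S X) :=
  inferInstanceAs (TopologicalSpace (MulAction.orbitRel.Quotient S.inl.range X))

variable {S} in
theorem orbitMk_eq_iff {x y : X} : orbitMk S x = orbitMk S y ↔ ∃ h : H, S.inl h • y = x := by
  refine Quotient.eq.trans (MulAction.orbitRel_apply.trans ?_)
  constructor
  · rintro ⟨⟨_, h, rfl⟩, hg⟩
    exact ⟨h, hg⟩
  · rintro ⟨h, hg⟩
    exact ⟨⟨_, h, rfl⟩, hg⟩

variable {S} in
theorem orbitMk_smul_eq {g g' : G} (hg : S.rightHom g = S.rightHom g') {x x' : X}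
    (hx : orbitMk S x = orbitMk S x') : orbitMk S (g • x) = orbitMk S (g' • x') := by
  obtain ⟨h, rfl⟩ := orbitMk_eq_iff.1 hx
  have hk : g * S.inl h * g'⁻¹ ∈ S.inl.range := by
    rw [S.range_inl_eq_ker_rightHom, MonoidHom.mem_ker]
    simp [hg]
  obtain ⟨k, hk⟩ := hk
  exact orbitMk_eq_iff.2 ⟨k, by rw [hk, smul_smul, smul_smul]; simp⟩

/-- The residual action of `Γ` on `X/H`: an element `γ` sends the orbit of `x` to the orbit of
`g • x`, for any `g` in `G` over `γ`. -/
instance : SMul Γ (OrbitSpace S X) where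
  smul γ q := Quotient.liftOn q
    (fun x => orbitMk S (Function.surjInv S.rightHom_surjective γ • x))
    (fun _ _ h => orbitMk_smul_eq rfl (Quotient.sound h))

theorem rightHom_smul_orbitMk (g : G) (x : X) :
    S.rightHom g • orbitMk S x = orbitMk S (g • x) :=
  orbitMk_smul_eq (Function.surjInv_eq S.rightHom_surjective _) rfl

instance : MulAction Γ (OrbitSpace S X) where
  one_smul q := by
    obtain ⟨x, rfl⟩ := Quotient.exists_rep q
    have := rightHom_smul_orbitMk S 1 x
    rwa [map_one, one_smul] at this
  mul_smul a b q := by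
    obtain ⟨x, rfl⟩ := Quotient.exists_rep q
    obtain ⟨g, rfl⟩ := S.rightHom_surjective a
    obtain ⟨g', rfl⟩ := S.rightHom_surjective b
    change _ • orbitMk S x = _ • _ • orbitMk S x
    rw [← map_mul, rightHom_smul_orbitMk, rightHom_smul_orbitMk, rightHom_smul_orbitMk, mul_smul]

/-- The extension `1 → N → G → G/N → 1` of a normal subgroup `N`. -/
def extensionOfNormal (N : Subgroup G) [N.Normal] : GroupExtension N G (G ⧸ N) where
  inl := N.subtype
  rightHom := QuotientGroup.mk' N
  inl_injective := N.subtype_injective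
  range_inl_eq_ker_rightHom := by simp
  rightHom_surjective := QuotientGroup.mk'_surjective N

/-- The connected component `G₀` of the identity is normal. -/
instance (G : Type u) [Group G] [TopologicalSpace G] [IsTopologicalGroup G] :
    (Subgroup.connectedComponentOfOne G).Normal where
  conj_mem n hn g := by
    have hc : Continuous fun x : G => g * x * g⁻¹ := by fun_prop
    have := hc.image_connectedComponent_subset 1 (Set.mem_image_of_mem _ hn)
    rw [mul_one, mul_inv_cancel] at this
    exact this

end Orbits

/-! ### Quotient stacks over topological spaces -/

section Top

/-- A principal `G`-bundle of topological spaces: a continuous action of `G` on `E` and an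
invariant map `π : E → B` that is locally, over `B`, equivariantly isomorphic to a product with
`G`, on which `G` acts by translation. -/
structure IsTopPrincipalBundle (G : Type u) [Group G] [TopologicalSpace G] {E B : Type u}
    [TopologicalSpace E] [TopologicalSpace B] [MulAction G E] (π : E → B) : Prop where
  continuousSMul : ContinuousSMul G E
  proj_smul : ∀ (g : G) (e : E), π (g • e) = π e
  locally_trivial : ∀ b : B, ∃ t : Bundle.Trivialization G π, b ∈ t.baseSet ∧
    ∀ (g : G) (e : E), π e ∈ t.baseSet → (t (g • e)).2 = g * (t e).2

variable (G : Type u) [Group G] [TopologicalSpace G] (X : Type u) [TopologicalSpace X]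
  [MulAction G X]

/-- Objects of `[X/G]` over `Top`: diagrams `B ← E → X` of a principal `G`-bundle `E → B` and a
`G`-equivariant map `E → X`. -/
structure TopQuotObj where
  base : TopCat.{u}
  total : TopCat.{u}
  [action : MulAction G total]
  proj : total ⟶ base
  isPrincipal : IsTopPrincipalBundle G proj
  anchor : C(total, X)
  anchor_smul : ∀ (g : G) (e : total), anchor (g • e) = g • anchor e

attribute [instance] TopQuotObj.action

variable {G X}

/-- Morphisms of `[X/G]` over `Top`: pairs `(E → E', B → B')`, with `E → E'` equivariant, forming a
Cartesian square and commuting with the maps to `X`. -/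
@[ext]
structure TopQuotHom (P Q : TopQuotObj G X) where
  base : P.base ⟶ Q.base
  total : P.total ⟶ Q.total
  map_smul : ∀ (g : G) (e : P.total), total (g • e) = g • total e
  isPullback : IsPullback total P.proj Q.proj base
  anchor_map : ∀ e : P.total, Q.anchor (total e) = P.anchor e

instance : Category (TopQuotObj G X) where
  Hom := TopQuotHom
  id P :=
    { base := 𝟙 _
      total := 𝟙 _
      map_smul := fun _ _ => rfl
      isPullback := IsPullback.of_horiz_isIso ⟨by simp⟩
      anchor_map := fun _ => rfl }
  comp f g :=
    { base := f.base ≫ g.base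
      total := f.total ≫ g.total
      map_smul := fun a e => by simp [f.map_smul, g.map_smul]
      isPullback := f.isPullback.paste_horiz g.isPullback
      anchor_map := fun e => by simp [f.anchor_map, g.anchor_map] }
  id_comp f := by apply TopQuotHom.ext <;> simp
  comp_id f := by apply TopQuotHom.ext <;> simp
  assoc f g h := by apply TopQuotHom.ext <;> simp

variable (G X)

/-- The quotient stack `[X/G]` over `Top`. -/
def topQuotientStack : BasedCategory.{u, u + 1} TopCat.{u} :=
  BasedCategory.ofFunctor (𝒳 := TopQuotObj G X)
    { obj := fun P => P.base
      map := fun f => TopQuotHom.base f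
      map_id := fun _ => rfl
      map_comp := fun _ _ => rfl }

end Top

/-! ### The category of smooth manifolds -/

section Diff

/-- A smooth manifold: finite-dimensional, without boundary, Hausdorff and second countable. -/
structure SmoothManifold : Type (u + 1) where
  carrier : Type u
  dim : ℕ
  [topologicalSpace : TopologicalSpace carrier]
  [chartedSpace : ChartedSpace (EuclideanSpace ℝ (Fin dim)) carrier]
  [isManifold : IsManifold (𝓡 dim) ∞ carrier]
  [t2Space : T2Space carrier]
  [secondCountable : SecondCountableTopology carrier]

attribute [instance] SmoothManifold.topologicalSpace SmoothManifold.chartedSpace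
  SmoothManifold.isManifold SmoothManifold.t2Space SmoothManifold.secondCountable

instance : CoeSort SmoothManifold.{u} (Type u) := ⟨SmoothManifold.carrier⟩

/-- A smooth map of manifolds. -/
@[ext]
structure SmoothMap (M N : SmoothManifold.{u}) where
  toFun : M → N
  contMDiff : ContMDiff (𝓡 M.dim) (𝓡 N.dim) ∞ toFun

/-- The category `Diff` of smooth manifolds and smooth maps. -/
instance : Category SmoothManifold.{u} where
  Hom := SmoothMap
  id _ := ⟨id, contMDiff_id⟩
  comp f g := ⟨g.toFun ∘ f.toFun, g.contMDiff.comp f.contMDiff⟩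

/-- The underlying function of a morphism of `Diff`. -/
abbrev fn {M N : SmoothManifold.{u}} (f : M ⟶ N) : M → N := SmoothMap.toFun f

/-! ### Quotient stacks over smooth manifolds -/

/-- A smooth principal `G`-bundle: a smooth action of `G` on `E` and an invariant map `π : E → B`
that is locally, over `B`, equivariantly diffeomorphic to a product with `G`, on which `G` acts by
translation. Here `k`, `d`, `m` are the dimensions of `G`, `E`, `B`. -/
structure IsSmoothPrincipalBundle (k d m : ℕ) (G : Type u) [Group G] [TopologicalSpace G]
    [ChartedSpace (EuclideanSpace ℝ (Fin k)) G] {E B : Type u}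
    [TopologicalSpace E] [ChartedSpace (EuclideanSpace ℝ (Fin d)) E]
    [TopologicalSpace B] [ChartedSpace (EuclideanSpace ℝ (Fin m)) B]
    [MulAction G E] (π : E → B) : Prop where
  contMDiffSMul : ContMDiffSMul (𝓡 k) (𝓡 d) ∞ G E
  proj_smul : ∀ (g : G) (e : E), π (g • e) = π e
  locally_trivial : ∀ b : B, ∃ t : Bundle.Trivialization G π, b ∈ t.baseSet ∧
    ContMDiffOn (𝓡 d) ((𝓡 m).prod (𝓡 k)) ∞ t t.source ∧
    ContMDiffOn ((𝓡 m).prod (𝓡 k)) (𝓡 d) ∞ t.toOpenPartialHomeomorph.symm t.target ∧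
    ∀ (g : G) (e : E), π e ∈ t.baseSet → (t (g • e)).2 = g * (t e).2

variable (k n : ℕ) (G : Type u) [Group G] [TopologicalSpace G]
  [ChartedSpace (EuclideanSpace ℝ (Fin k)) G] (X : Type u) [TopologicalSpace X]
  [ChartedSpace (EuclideanSpace ℝ (Fin n)) X] [MulAction G X]

/-- Objects of `[X/G]` over `Diff`: diagrams `B ← E → X` of a smooth principal `G`-bundle `E → B`
and a smooth `G`-equivariant map `E → X`. -/
structure SmoothQuotObj where
  base : SmoothManifold.{u}
  total : SmoothManifold.{u}
  [action : MulAction G total]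
  proj : total ⟶ base
  isPrincipal : IsSmoothPrincipalBundle k total.dim base.dim G (fn proj)
  anchor : total → X
  contMDiff_anchor : ContMDiff (𝓡 total.dim) (𝓡 n) ∞ anchor
  anchor_smul : ∀ (g : G) (e : total), anchor (g • e) = g • anchor e

attribute [instance] SmoothQuotObj.action

variable {k n G X}

/-- Morphisms of `[X/G]` over `Diff`: pairs `(E → E', B → B')`, with `E → E'` equivariant, forming
a Cartesian square and commuting with the maps to `X`. -/
@[ext]
structure SmoothQuotHom (P Q : SmoothQuotObj k n G X) where
  base : P.base ⟶ Q.base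
  total : P.total ⟶ Q.total
  map_smul : ∀ (g : G) (e : P.total), fn total (g • e) = g • fn total e
  isPullback : IsPullback total P.proj Q.proj base
  anchor_map : ∀ e : P.total, Q.anchor (fn total e) = P.anchor e

instance : Category (SmoothQuotObj k n G X) where
  Hom := SmoothQuotHom
  id P :=
    { base := 𝟙 _
      total := 𝟙 _
      map_smul := fun _ _ => rfl
      isPullback := IsPullback.of_horiz_isIso ⟨by simp⟩
      anchor_map := fun _ => rfl }
  comp f g :=
    { base := f.base ≫ g.base
      total := f.total ≫ g.total
      map_smul := fun a e => (congrArg (fn g.total) (f.map_smul a e)).trans (g.map_smul a _)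
      isPullback := f.isPullback.paste_horiz g.isPullback
      anchor_map := fun e => (g.anchor_map _).trans (f.anchor_map e) }
  id_comp f := by apply SmoothQuotHom.ext <;> simp
  comp_id f := by apply SmoothQuotHom.ext <;> simp
  assoc f g h := by apply SmoothQuotHom.ext <;> simp

variable (k n G X)

/-- The quotient stack `[X/G]` over `Diff`, for a Lie group `G` of dimension `k` acting on a
manifold `X` of dimension `n`. -/
def smoothQuotientStack : BasedCategory.{u, u + 1} SmoothManifold.{u} :=
  BasedCategory.ofFunctor (𝒳 := SmoothQuotObj k n G X)
    { obj := fun P => P.base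
      map := fun f => SmoothQuotHom.base f
      map_id := fun _ => rfl
      map_comp := fun _ _ => rfl }

variable {G} in
/-- The given atlas, of dimension `m`, makes the orbit space `X/H` (with its quotient topology) the
quotient manifold of `X`: a Hausdorff, second countable smooth manifold for which the orbit
projection is a submersion. There is at most one such smooth structure. -/
structure IsQuotientManifold (m : ℕ) {H Γ : Type u} [Group H] [Group Γ]
    (S : GroupExtension H G Γ) [ChartedSpace (EuclideanSpace ℝ (Fin m)) (OrbitSpace S X)] :
    Prop where
  isManifold : IsManifold (𝓡 m) ∞ (OrbitSpace S X)
  t2Space : T2Space (OrbitSpace S X)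
  secondCountable : SecondCountableTopology (OrbitSpace S X)
  isSubmersion : Manifold.IsSubmersion (𝓡 n) (𝓡 m) ∞ (orbitMk S : X → OrbitSpace S X)

/-! ### Deligne-Mumford stacks, discrete and global quotients -/

/-- A morphism `p : V̲ ⟶ 𝒳` is an étale presentation if it is representable and all its
representatives `V̲ ×_𝒳 W̲ ⟶ W̲` are surjective local diffeomorphisms (so that `p` is an
epimorphism). -/
def IsEtalePresentation {𝒳 : BasedCategory.{v₂, w₂} SmoothManifold.{u}} {V : SmoothManifold.{u}}
    (p : BasedFunctor (underline V) 𝒳) : Prop :=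
  ∀ (W : SmoothManifold.{u}) (q : BasedFunctor (underline W) 𝒳),
    ∃ (Z : SmoothManifold.{u}) (a : Z ⟶ V) (b : Z ⟶ W), Represents p q a b ∧
      Function.Surjective (fn b) ∧ IsLocalDiffeomorph (𝓡 Z.dim) (𝓡 W.dim) ∞ (fn b)

/-- A stack over `Diff` is Deligne-Mumford if it has an étale presentation `p : V̲ ⟶ 𝒳` and a proper
diagonal, the latter meaning that the representative `V̲ ×_𝒳 V̲ ⟶ V̲ × V̲` of the diagonal is
proper. -/
def IsDeligneMumford (𝒳 : BasedCategory.{v₂, w₂} SmoothManifold.{u}) : Prop :=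
  ∃ (V : SmoothManifold.{u}) (p : BasedFunctor (underline V) 𝒳), IsEtalePresentation p ∧
    ∃ (Z : SmoothManifold.{u}) (a b : Z ⟶ V), Represents p p a b ∧
      IsProperMap fun z : Z => (fn a z, fn b z)

/-- A stack over `Diff` is a discrete quotient if it is a Deligne-Mumford stack equivalent to
`[Y/Γ]` for a discrete group `Γ`, that is, a Lie group of dimension `0`, acting smoothly on a
smooth manifold `Y`. -/
def IsDiscreteQuotient (𝒳 : BasedCategory.{v₂, w₂} SmoothManifold.{u}) : Prop :=
  IsDeligneMumford 𝒳 ∧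
    ∃ (Γ : Type u) (_ : Group Γ) (_ : TopologicalSpace Γ)
      (_ : ChartedSpace (EuclideanSpace ℝ (Fin 0)) Γ) (Y : SmoothManifold.{u})
      (_ : MulAction Γ Y),
      LieGroup (𝓡 0) ∞ Γ ∧ DiscreteTopology Γ ∧ Countable Γ ∧
      ContMDiffSMul (𝓡 0) (𝓡 Y.dim) ∞ Γ Y ∧
      AreEquivalent 𝒳 (smoothQuotientStack 0 Y.dim Γ Y)

/-- A stack over `Diff` is a global quotient if it is a Deligne-Mumford stack equivalent to `[Y/Γ]`
for a finite group `Γ` acting smoothly on a smooth manifold `Y`. -/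
def IsGlobalQuotient (𝒳 : BasedCategory.{v₂, w₂} SmoothManifold.{u}) : Prop :=
  IsDeligneMumford 𝒳 ∧
    ∃ (Γ : Type u) (_ : Group Γ) (_ : TopologicalSpace Γ)
      (_ : ChartedSpace (EuclideanSpace ℝ (Fin 0)) Γ) (Y : SmoothManifold.{u})
      (_ : MulAction Γ Y),
      LieGroup (𝓡 0) ∞ Γ ∧ DiscreteTopology Γ ∧ Finite Γ ∧
      ContMDiffSMul (𝓡 0) (𝓡 Y.dim) ∞ Γ Y ∧
      AreEquivalent 𝒳 (smoothQuotientStack 0 Y.dim Γ Y)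

end Diff

end QuotientStacks

end

/-! The functor from `[X/G]` to `[(X/H)/Γ]` sends `B ← E → X` to `B ← E/H → X/H`. Nothing is lost:
since `H` acts freely on `X`, a point of `E` is determined by its `H`-orbit together with its image
in `X` (`eq_of_orbitMk_eq`), so that `E` is the fibre product of `E/H` and `X` over `X/H`.

Full faithfulness follows. A morphism `E/H → E'/H` compatible with the maps to `X/H` has exactly one
lift `E → E'` compatible with the maps to `X`. The lift is constructed pointwise, and its regularity
is read off from `divAct`, the group element that carries one point of an orbit to another; this
element varies continuously or smoothly because `X → X/H` is a principal bundle. For essential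
surjectivity, a principal `Γ`-bundle `F` with its map to `X/H` is pulled back along `X → X/H`. The
result carries an action of `G`, and it is locally trivial because `G → Γ` has local sections. Over
`Diff` these come from the constant rank theorem (`exists_local_section_lieHom`). Over `Top` they
are extracted from an orbit projection `X → X/H` itself (`TopStages.exists_section`).

Over `Diff` it must also be shown that `X/H` and all the `E/H` are manifolds. An orbit map of a free
action is injective and of constant rank, hence an immersion; adding a transversal and using
properness gives a slice (`exists_slice`), and slices are the charts of the quotient
(`exists_quotient_manifold`). The theorem applies to `E` because freeness and properness are
inherited along equivariant maps (`isProperMap_of_equivariant`). Over `Top` local triviality of `E →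
E/H` is inherited directly (`TopStages.principal_of_equivariant`).

For the corollary, the identity component is open, hence closed, so it acts properly and `Γ` is
discrete; the result on stages applies. The Deligne–Mumford property is seen on `[Y/Γ]` with `Y =
X/G₀`. The fibre product of `Y̲ → [Y/Γ]` with a morphism from `W̲` is the total space of the
`Γ`-bundle on `W` that the morphism classifies (`presentation_hasUniversalIso`), and its projection
is a surjective local diffeomorphism. For `W = Y` and the presentation itself this is `Γ × Y` with
the map `(γ, y) ↦ (γ y, y)`, which is proper because properness descends from `G` and `X`
(`isProperMap_orbitSpace`). To carry this back to `[X/G]`, the equivalence is inverted strictly over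
the base (`strictInverse`), and fibre products are described by universal isomorphisms
(`HasUniversalIso`), which transport well. -/

set_option linter.unusedSectionVars false

noncomputable section

namespace QuotientStacks

/-! ### The inverse function theorem and maps of constant rank -/

section Calculus

variable {E F : Type*} [NormedAddCommGroup E] [NormedSpace ℝ E] [NormedAddCommGroup F]
  [NormedSpace ℝ F]

/-- The inverse function theorem, with a smooth inverse on a whole neighbourhood. -/
theorem exists_smooth_local_inverse [CompleteSpace E] {f : E → F} {U : Set E} (hU : IsOpen U)
    (hf : ContDiffOn ℝ ∞ f U) {x : E} (hx : x ∈ U) (f' : E ≃L[ℝ] F)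
    (h : HasFDerivAt f (f' : E →L[ℝ] F) x) :
    ∃ e : OpenPartialHomeomorph E F, x ∈ e.source ∧ e.source ⊆ U ∧ (e : E → F) = f ∧
      ContDiffOn ℝ ∞ e.symm e.target ∧
      ∀ y ∈ e.source, ∃ g' : E ≃L[ℝ] F, HasFDerivAt f (g' : E →L[ℝ] F) y := by
  have hfx : ContDiffAt ℝ ∞ f x := hf.contDiffAt (hU.mem_nhds hx)
  have hn : (∞ : WithTop ℕ∞) ≠ 0 := by simp
  set e₀ := hfx.toOpenPartialHomeomorph f h hn with he₀
  have hcont : ContinuousOn (fderiv ℝ f) U := hf.continuousOn_fderiv_of_isOpen hU (by simp)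
  -- Smoothness of the inverse at a point needs an invertible derivative there. Invertibility is an
  -- open condition, so shrinking the source to `W` provides it at every point.
  set W : Set E := U ∩ fderiv ℝ f ⁻¹' Set.range ((↑) : (E ≃L[ℝ] F) → E →L[ℝ] F) with hW
  have hWo : IsOpen W := hcont.isOpen_inter_preimage hU ContinuousLinearEquiv.isOpen
  have hd : ∀ y ∈ W, ∃ g' : E ≃L[ℝ] F, HasFDerivAt f (g' : E →L[ℝ] F) y := by
    rintro y ⟨hyU, g', hg'⟩
    refine ⟨g', ?_⟩
    rw [hg']
    exact ((hf.contDiffAt (hU.mem_nhds hyU)).differentiableAt hn).hasFDerivAt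
  refine ⟨e₀.restrOpen W hWo, ?_, ?_, rfl, ?_, ?_⟩
  · rw [OpenPartialHomeomorph.restrOpen_source]
    exact ⟨hfx.mem_toOpenPartialHomeomorph_source h hn, hx, f', h.fderiv.symm⟩
  · rw [OpenPartialHomeomorph.restrOpen_source]
    exact fun y hy => hy.2.1
  · intro z hz
    have hs := (e₀.restrOpen W hWo).map_target hz
    rw [OpenPartialHomeomorph.restrOpen_source] at hs
    obtain ⟨g', hg'⟩ := hd _ hs.2
    exact ((e₀.restrOpen W hWo).contDiffAt_symm hz hg'
      (hf.contDiffAt (hU.mem_nhds hs.2.1))).contDiffWithinAt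
  · intro y hy
    rw [OpenPartialHomeomorph.restrOpen_source] at hy
    exact hd y hy.2

variable [FiniteDimensional ℝ E] [FiniteDimensional ℝ F]

/-- The constant rank theorem: in suitable coordinates on the source, a map of constant rank depends
only on the coordinates complementary to the kernel of its derivative. -/
theorem exists_constant_rank_coordinates {f : E → F} {U : Set E} (hU : IsOpen U)
    (hf : ContDiffOn ℝ ∞ f U) {x : E} (hx : x ∈ U)
    (hrank : ∀ y ∈ U, Module.finrank ℝ (fderiv ℝ f y).ker =
      Module.finrank ℝ (fderiv ℝ f x).ker) :
    ∃ (e : OpenPartialHomeomorph E ((fderiv ℝ f x).range × (fderiv ℝ f x).ker)) (ε : ℝ),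
      x ∈ e.source ∧ e.source ⊆ U ∧ ContDiffOn ℝ ∞ e.symm e.target ∧ 0 < ε ∧
      Metric.ball (e x) ε ⊆ e.target ∧
      ∀ y z z', (y, z) ∈ Metric.ball (e x) ε → (y, z') ∈ Metric.ball (e x) ε →
        f (e.symm (y, z)) = f (e.symm (y, z')) := by
  have hn : (∞ : WithTop ℕ∞) ≠ 0 := by simp
  set D := fderiv ℝ f x with hD
  obtain ⟨p, hp⟩ := D.range.exists_isCompl.imp fun _ h => h
  obtain ⟨c, hc⟩ := D.ker.exists_isCompl
  let P : F →L[ℝ] D.range := (D.range.projectionOnto p hp).toContinuousLinearMap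
  let K : E →L[ℝ] D.ker := (D.ker.projectionOnto c hc).toContinuousLinearMap
  have hP : ∀ y : D.range, P y = y := fun y => Submodule.projectionOnto_apply_left hp y
  have hK : ∀ y : D.ker, K y = y := fun y => Submodule.projectionOnto_apply_left hc y
  have hfd : ∀ y ∈ U, HasFDerivAt f (fderiv ℝ f y) y := fun y hy =>
    ((hf.contDiffAt (hU.mem_nhds hy)).differentiableAt hn).hasFDerivAt
  -- The coordinates are the component of `f` along the range of its derivative `D` at `x`,
  -- completed by a projection onto the kernel of `D`; the derivative of this map at `x` is
  -- injective, hence bijective by rank–nullity.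
  let ψ : E → D.range × D.ker := fun y => (P (f y), K y)
  have hψ : ContDiffOn ℝ ∞ ψ U :=
    (P.contDiff.comp_contDiffOn hf).prodMk K.contDiff.contDiffOn
  have hψd : ∀ y ∈ U, HasFDerivAt ψ ((P.comp (fderiv ℝ f y)).prod K) y := fun y hy =>
    (P.hasFDerivAt.comp y (hfd y hy)).prodMk K.hasFDerivAt
  have hinj : Function.Injective ((P.comp D).prod K) := by
    rw [injective_iff_map_eq_zero]
    intro v hv
    rw [ContinuousLinearMap.prod_apply, Prod.mk_eq_zero] at hv
    have h1 : D v = 0 := by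
      have := hP ⟨D v, v, rfl⟩
      rw [ContinuousLinearMap.comp_apply] at hv
      exact (congrArg Subtype.val this).symm.trans (congrArg Subtype.val hv.1)
    have := hK ⟨v, h1⟩
    exact (congrArg Subtype.val this).symm.trans (congrArg Subtype.val hv.2)
  have hfin : Module.finrank ℝ E = Module.finrank ℝ (D.range × D.ker) := by
    rw [Module.finrank_prod]
    exact (LinearMap.finrank_range_add_finrank_ker (D : E →ₗ[ℝ] F)).symm
  let A : E ≃L[ℝ] D.range × D.ker :=
    (LinearEquiv.ofInjectiveOfFinrankEq ((P.comp D).prod K : E →ₗ[ℝ] _) hinj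
      hfin).toContinuousLinearEquiv
  have hA : (A : E →L[ℝ] D.range × D.ker) = (P.comp D).prod K := by
    ext v <;> rfl
  obtain ⟨e, hxe, heU, hecoe, hesm, hed⟩ := exists_smooth_local_inverse hU hψ hx A
    (by rw [hA]; exact hψd x hx)
  obtain ⟨ε, hε, hball⟩ := Metric.isOpen_iff.1 e.open_target (e x) (e.map_source hxe)
  refine ⟨e, ε, hxe, heU, hesm, hε, hball, ?_⟩
  -- Here constancy of the rank enters. Near `x` the composite of `P` with the derivative stays onto
  -- the range of `D`, so its kernel has the dimension of `D.ker`, which is also that of the kernel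
  -- of the derivative; one kernel contains the other, so they agree.
  have hker : ∀ y ∈ e.source, ∀ v, P (fderiv ℝ f y v) = 0 → fderiv ℝ f y v = 0 := by
    intro y hy v hv
    obtain ⟨g', hg'⟩ := hed y hy
    have hg := hg'.unique (hψd y (heU hy))
    have hsurj : Function.Surjective (P.comp (fderiv ℝ f y)) := by
      intro w
      obtain ⟨v, hv⟩ := g'.surjective (w, 0)
      refine ⟨v, ?_⟩
      have := DFunLike.congr_fun hg v
      exact (congrArg Prod.fst (this.symm.trans hv))
    have h1 := LinearMap.finrank_range_add_finrank_ker (P.comp (fderiv ℝ f y) : E →ₗ[ℝ] D.range)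
    rw [LinearMap.range_eq_top.2 hsurj, finrank_top] at h1
    have h2 := LinearMap.finrank_range_add_finrank_ker (D : E →ₗ[ℝ] F)
    have hle : (fderiv ℝ f y).ker ≤ (P.comp (fderiv ℝ f y)).ker := by
      intro w hw
      have hw' : fderiv ℝ f y w = 0 := hw
      change P (fderiv ℝ f y w) = 0
      rw [hw', map_zero]
    have h3 := hrank y (heU hy)
    have heq := Submodule.eq_of_le_of_finrank_eq hle (by
      change Module.finrank ℝ D.range + _ = _ at h1
      change Module.finrank ℝ D.range + Module.finrank ℝ D.ker = _ at h2
      change _ = Module.finrank ℝ (LinearMap.ker ((P.comp (fderiv ℝ f y) : E →ₗ[ℝ] D.range)))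
      omega)
    have hv' : v ∈ (P.comp (fderiv ℝ f y)).ker := hv
    rw [← heq] at hv'
    exact hv'
  intro y z z' hz hz'
  set s : Set D.ker := Metric.ball (e x).2 ε with hs
  have hmem : ∀ w, (y, w) ∈ Metric.ball (e x) ε ↔ y ∈ Metric.ball (e x).1 ε ∧ w ∈ s := by
    intro w
    rw [← Prod.mk.eta (p := e x), ← ball_prod_same, Set.mem_prod]
  have hy := ((hmem z).1 hz).1
  have htar : ∀ w ∈ s, (y, w) ∈ e.target := fun w hw => hball ((hmem w).2 ⟨hy, hw⟩)
  -- Along a slice the `P`-component of `f` is the fixed first coordinate, so `P` kills the partial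
  -- derivative, and by `hker` the partial derivative itself vanishes.
  have hder : ∀ w ∈ s, HasFDerivAt (fun w => f (e.symm (y, w))) (0 : D.ker →L[ℝ] F) w := by
    intro w hw
    have hsrc := e.map_target (htar w hw)
    have h1 : HasFDerivAt e.symm (fderiv ℝ e.symm (y, w)) (y, w) :=
      ((hesm.contDiffAt (e.open_target.mem_nhds (htar w hw))).differentiableAt hn).hasFDerivAt
    have h2 : HasFDerivAt (fun w : D.ker => (y, w)) (ContinuousLinearMap.inr ℝ D.range D.ker) w :=
      hasFDerivAt_prodMk_right y w
    have h3 := (hfd _ (heU hsrc)).comp w (h1.comp w h2)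
    refine h3.congr_fderiv (ContinuousLinearMap.ext fun v => ?_)
    refine hker _ hsrc _ ?_
    have h4 := P.hasFDerivAt.comp w h3
    have h5 : (fun w => P (f (e.symm (y, w)))) =ᶠ[𝓝 w] fun _ => y := by
      filter_upwards [Metric.isOpen_ball.mem_nhds hw] with w' hw'
      have := e.right_inv (htar w' hw')
      rw [hecoe] at this
      exact congrArg Prod.fst this
    have h6 := (h4.congr_of_eventuallyEq h5.symm).unique (hasFDerivAt_const y w)
    exact DFunLike.congr_fun h6 v
  refine (convex_ball (e x).2 ε).is_const_of_fderivWithin_eq_zero (𝕜 := ℝ)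
    (f := fun w => f (e.symm (y, w))) (fun w hw =>
    (hder w hw).differentiableAt.differentiableWithinAt) (fun w hw => ?_) ((hmem z).1 hz).2
    ((hmem z').1 hz').2
  exact (hder w hw).hasFDerivWithinAt.fderivWithin (Metric.isOpen_ball.uniqueDiffWithinAt hw)

/-- An injective map of constant rank is an immersion. -/
theorem ker_fderiv_eq_bot_of_injOn {f : E → F} {U : Set E} (hU : IsOpen U)
    (hf : ContDiffOn ℝ ∞ f U) {x : E} (hx : x ∈ U)
    (hrank : ∀ y ∈ U, Module.finrank ℝ (fderiv ℝ f y).ker =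
      Module.finrank ℝ (fderiv ℝ f x).ker) (hinj : Set.InjOn f U) :
    (fderiv ℝ f x).ker = ⊥ := by
  obtain ⟨e, ε, hxe, heU, hsm, hε, hball, hconst⟩ := exists_constant_rank_coordinates hU hf hx hrank
  rw [Submodule.eq_bot_iff]
  intro v hv
  by_contra hv0
  let w : (fderiv ℝ f x).ker := ⟨v, hv⟩
  have hw : w ≠ 0 := fun h => hv0 (congrArg Subtype.val h)
  have hnw : 0 < ‖w‖ := norm_pos_iff.2 hw
  -- A kernel vector rescaled to length `ε / 2` stays in the ball and moves only the coordinate on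
  -- which `f` does not depend, which contradicts injectivity.
  let z' := (e x).2 + (ε / 2 / ‖w‖) • w
  have hz' : ((e x).1, z') ∈ Metric.ball (e x) ε := by
    rw [← Prod.mk.eta (p := e x), ← ball_prod_same, Set.mem_prod]
    refine ⟨Metric.mem_ball_self hε, ?_⟩
    rw [mem_ball_iff_norm]
    rw [add_sub_cancel_left, norm_smul, Real.norm_of_nonneg (by positivity),
      div_mul_cancel₀ _ hnw.ne']
    linarith
  have h1 := hconst (e x).1 (e x).2 z' (Metric.mem_ball_self hε) hz'
  have h2 := hinj (heU (e.map_target (hball (Metric.mem_ball_self hε))))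
    (heU (e.map_target (hball hz'))) h1
  have h3 := e.symm.injOn (hball (Metric.mem_ball_self hε)) (hball hz') h2
  have h4 : (ε / 2 / ‖w‖) • w = 0 := by
    have := congrArg Prod.snd h3
    simpa [z'] using this
  rw [smul_eq_zero] at h4
  rcases h4 with h4 | h4
  · have : 0 < ε / 2 / ‖w‖ := by positivity
    exact this.ne' h4
  · exact hw h4

/-- An open map of constant rank is a submersion. -/
theorem range_fderiv_eq_top_of_open {f : E → F} {U : Set E} (hU : IsOpen U)
    (hf : ContDiffOn ℝ ∞ f U) {x : E} (hx : x ∈ U)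
    (hrank : ∀ y ∈ U, Module.finrank ℝ (fderiv ℝ f y).ker =
      Module.finrank ℝ (fderiv ℝ f x).ker) (hopen : ∀ V ∈ 𝓝 x, f '' V ∈ 𝓝 (f x)) :
    (fderiv ℝ f x).range = ⊤ := by
  obtain ⟨e, ε, hxe, heU, hsm, hε, hball, hconst⟩ := exists_constant_rank_coordinates hU hf hx hrank
  by_contra hne
  have hlt : Module.finrank ℝ (fderiv ℝ f x).range < Module.finrank ℝ F :=
    Submodule.finrank_lt hne
  have hmem : ∀ y, y ∈ Metric.ball (e x).1 ε → (y, (e x).2) ∈ Metric.ball (e x) ε := by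
    intro y hy
    rw [← Prod.mk.eta (p := e x), ← ball_prod_same, Set.mem_prod]
    exact ⟨hy, Metric.mem_ball_self hε⟩
  -- Near `x` all values of `f` are already values of `g`, a map from a space of dimension smaller
  -- than that of `F`. The image of such a map has dense complement, so it contains no neighbourhood
  -- of `f x`.
  let g : (fderiv ℝ f x).range → F := fun y => f (e.symm (y, (e x).2))
  have hg : ContDiffOn ℝ 1 g (Metric.ball (e x).1 ε) := by
    have h1 : ContDiffOn ℝ ∞ (fun y : (fderiv ℝ f x).range => e.symm (y, (e x).2))
        (Metric.ball (e x).1 ε) :=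
      hsm.comp (contDiff_prodMk_left _).contDiffOn fun y hy => hball (hmem y hy)
    exact (hf.comp h1 fun y hy => heU (e.map_target (hball (hmem y hy)))).of_le (by simp)
  have hdense := hg.dense_compl_image_of_dimH_lt_finrank (convex_ball _ _) Set.Subset.rfl
    (lt_of_le_of_lt (dimH_mono (Set.subset_univ _))
      (by rw [Real.dimH_univ_eq_finrank]; exact_mod_cast hlt))
  let V := e.source ∩ e ⁻¹' Metric.ball (e x) ε
  have hV : V ∈ 𝓝 x :=
    (e.isOpen_inter_preimage Metric.isOpen_ball).mem_nhds ⟨hxe, Metric.mem_ball_self hε⟩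
  obtain ⟨z, hz, hz'⟩ := hdense.inter_nhds_nonempty (hopen V hV)
  obtain ⟨v, ⟨hv1, hv2⟩, rfl⟩ := hz'
  refine hz ⟨(e v).1, ?_, ?_⟩
  · have hv2' : e v ∈ Metric.ball (e x) ε := hv2
    rw [← Prod.mk.eta (p := e x), ← ball_prod_same, Set.mem_prod] at hv2'
    exact hv2'.1
  · have hv2' : e v ∈ Metric.ball (e x) ε := hv2
    have := hmem (e v).1 (by
      rw [← Prod.mk.eta (p := e x), ← ball_prod_same, Set.mem_prod] at hv2'
      exact hv2'.1)
    change f (e.symm _) = f v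
    rw [hconst (e v).1 (e x).2 (e v).2 this hv2', Prod.mk.eta, e.left_inv hv1]

end Calculus

/-! ### Homogeneous maps of manifolds -/

section Homogeneous

variable {a b : ℕ} {M N : Type*} [TopologicalSpace M] [ChartedSpace (EuclideanSpace ℝ (Fin a)) M]
  [TopologicalSpace N] [ChartedSpace (EuclideanSpace ℝ (Fin b)) N]

theorem finrank_ker_comp_left {E F F' : Type*} [NormedAddCommGroup E] [NormedSpace ℝ E]
    [NormedAddCommGroup F] [NormedSpace ℝ F] [NormedAddCommGroup F'] [NormedSpace ℝ F']
    (T : E →L[ℝ] F) (B : F →L[ℝ] F') (hB : B.IsInvertible) :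
    Module.finrank ℝ (B.comp T).ker = Module.finrank ℝ T.ker := by
  obtain ⟨B, rfl⟩ := hB
  have : ((B : F →L[ℝ] F').comp T).ker = T.ker := by
    ext v
    exact ⟨fun hv => B.injective (Eq.trans hv (map_zero B).symm),
      fun hv => (congrArg B hv).trans (map_zero B)⟩
  rw [this]

theorem finrank_ker_comp_right {E F E' : Type*} [NormedAddCommGroup E] [NormedSpace ℝ E]
    [NormedAddCommGroup F] [NormedSpace ℝ F] [NormedAddCommGroup E'] [NormedSpace ℝ E']
    (A : E' →L[ℝ] E) (T : E →L[ℝ] F) (hA : A.IsInvertible) :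
    Module.finrank ℝ (T.comp A).ker = Module.finrank ℝ T.ker := by
  obtain ⟨A, rfl⟩ := hA
  refine (LinearEquiv.ofSubmodules A.toLinearEquiv _ _ ?_).finrank_eq
  ext v
  constructor
  · rintro ⟨w, hw, rfl⟩
    exact hw
  · intro hv
    refine ⟨A.symm v, ?_, A.apply_symm_apply v⟩
    change T (A (A.symm v)) = 0
    rw [A.apply_symm_apply]
    exact hv

variable (a b) in
/-- A map of manifolds read in charts. -/
def chartRep (f : M → N) (x : M) (y : N) :
    EuclideanSpace ℝ (Fin a) → EuclideanSpace ℝ (Fin b) :=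
  fun u => extChartAt (𝓡 b) y (f ((extChartAt (𝓡 a) x).symm u))

variable (a b) in
/-- The domain of a map of manifolds read in charts. -/
def chartDom (f : M → N) (x : M) (y : N) : Set (EuclideanSpace ℝ (Fin a)) :=
  (extChartAt (𝓡 a) x).target ∩
    (extChartAt (𝓡 a) x).symm ⁻¹' (f ⁻¹' (extChartAt (𝓡 b) y).source)

theorem isOpen_chartDom {f : M → N} (hf : Continuous f) (x : M) (y : N) :
    IsOpen (chartDom a b f x y) :=
  (continuousOn_extChartAt_symm x).isOpen_inter_preimage (isOpen_extChartAt_target x)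
    ((isOpen_extChartAt_source y).preimage hf)

theorem mem_chartDom {f : M → N} {x : M} {y : N} (h : f x ∈ (extChartAt (𝓡 b) y).source) :
    extChartAt (𝓡 a) x x ∈ chartDom a b f x y := by
  refine ⟨mem_extChartAt_target x, ?_⟩
  rw [Set.mem_preimage, extChartAt_to_inv]
  exact h

variable [IsManifold (𝓡 a) ∞ M] [IsManifold (𝓡 b) ∞ N]

theorem contDiffOn_chartRep {f : M → N} (hf : ContMDiff (𝓡 a) (𝓡 b) ∞ f) (x : M) (y : N) :
    ContDiffOn ℝ ∞ (chartRep a b f x y) (chartDom a b f x y) := by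
  rw [← contMDiffOn_iff_contDiffOn]
  have h1 := (contMDiffOn_extChartAt_symm (I := 𝓡 a) (n := ∞) x).mono
    (Set.inter_subset_left : chartDom a b f x y ⊆ _)
  have h2 := hf.comp_contMDiffOn h1
  exact (contMDiffOn_extChartAt (I := 𝓡 b) (n := ∞) (x := y)).comp h2 fun u hu => by
    have := hu.2
    rwa [Set.mem_preimage, Set.mem_preimage, extChartAt_source] at this

omit [IsManifold (𝓡 a) ∞ M] [IsManifold (𝓡 b) ∞ N] in
theorem chartRep_mem_chartDom {c : ℕ} {P : Type*} [TopologicalSpace P]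
    [ChartedSpace (EuclideanSpace ℝ (Fin c)) P] {f : M → N} {g : N → P} {x : M} {y : N} {z : P}
    {u : EuclideanSpace ℝ (Fin a)} (hu : u ∈ chartDom a b f x y)
    (hu' : u ∈ chartDom a c (g ∘ f) x z) : chartRep a b f x y u ∈ chartDom b c g y z := by
  refine ⟨(extChartAt (𝓡 b) y).map_source hu.2, ?_⟩
  rw [Set.mem_preimage, chartRep, (extChartAt (𝓡 b) y).left_inv hu.2]
  exact hu'.2

theorem fderiv_chartRep_comp {c : ℕ} {P : Type*} [TopologicalSpace P]
    [ChartedSpace (EuclideanSpace ℝ (Fin c)) P] [IsManifold (𝓡 c) ∞ P] {f : M → N} {g : N → P}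
    (hf : ContMDiff (𝓡 a) (𝓡 b) ∞ f) (hg : ContMDiff (𝓡 b) (𝓡 c) ∞ g) {x : M} {y : N} {z : P}
    {u : EuclideanSpace ℝ (Fin a)} (hu : u ∈ chartDom a b f x y)
    (hu' : u ∈ chartDom a c (g ∘ f) x z) :
    fderiv ℝ (chartRep a c (g ∘ f) x z) u =
      (fderiv ℝ (chartRep b c g y z) (chartRep a b f x y u)).comp
        (fderiv ℝ (chartRep a b f x y) u) := by
  have hn : (∞ : WithTop ℕ∞) ≠ 0 := by simp
  have h1 : chartRep a c (g ∘ f) x z =ᶠ[𝓝 u] chartRep b c g y z ∘ chartRep a b f x y := by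
    filter_upwards [(isOpen_chartDom hf.continuous x y).mem_nhds hu] with v hv
    simp only [chartRep, Function.comp_apply]
    rw [(extChartAt (𝓡 b) y).left_inv hv.2]
  rw [h1.fderiv_eq]
  refine fderiv_comp u ?_ ?_
  · exact ((contDiffOn_chartRep hg y z).contDiffAt ((isOpen_chartDom hg.continuous y z).mem_nhds
      (chartRep_mem_chartDom hu hu'))).differentiableAt hn
  · exact ((contDiffOn_chartRep hf x y).contDiffAt ((isOpen_chartDom hf.continuous x y).mem_nhds
      hu)).differentiableAt hn

/-- The chain rule applied to the diffeomorphism followed by its inverse, and to the two in the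
other order, gives mutually inverse derivatives. -/
theorem isInvertible_fderiv_chartRep (A : M ≃ₘ^∞⟮𝓡 a, 𝓡 a⟯ M) {x y : M}
    {u : EuclideanSpace ℝ (Fin a)} (hu : u ∈ chartDom a a A x y) :
    (fderiv ℝ (chartRep a a A x y) u).IsInvertible := by
  have key : ∀ (A : M ≃ₘ^∞⟮𝓡 a, 𝓡 a⟯ M) {x y : M} {u : EuclideanSpace ℝ (Fin a)},
      u ∈ chartDom a a A x y → (fderiv ℝ (chartRep a a A.symm y x) (chartRep a a A x y u)).comp
        (fderiv ℝ (chartRep a a A x y) u) = ContinuousLinearMap.id ℝ _ := by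
    intro A x y u hu
    have hid : ((A.symm : M → M) ∘ A) = id := funext fun z => A.symm_apply_apply z
    have hu' : u ∈ chartDom a a ((A.symm : M → M) ∘ A) x x := by
      rw [hid]
      exact ⟨hu.1, (extChartAt (𝓡 a) x).map_target hu.1⟩
    rw [← fderiv_chartRep_comp A.contMDiff A.symm.contMDiff hu hu', hid, ← fderiv_id]
    refine Filter.EventuallyEq.fderiv_eq ?_
    filter_upwards [(isOpen_extChartAt_target x).mem_nhds hu.1] with v hv
    exact (extChartAt (𝓡 a) x).right_inv hv
  have hu'' : chartRep a a A x y u ∈ chartDom a a A.symm y x := by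
    refine ⟨(extChartAt (𝓡 a) y).map_source hu.2, ?_⟩
    rw [Set.mem_preimage, chartRep, (extChartAt (𝓡 a) y).left_inv hu.2]
    change A.symm (A _) ∈ (extChartAt (𝓡 a) x).source
    rw [A.symm_apply_apply]
    exact (extChartAt (𝓡 a) x).map_target hu.1
  have h1 := key A hu
  have h2 := key A.symm hu''
  have h3 : chartRep a a A.symm y x (chartRep a a A x y u) = u := by
    rw [chartRep, chartRep, (extChartAt (𝓡 a) y).left_inv hu.2, A.symm_apply_apply,
      (extChartAt (𝓡 a) x).right_inv hu.1]
  rw [h3] at h2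
  exact ⟨ContinuousLinearEquiv.equivOfInverse _ _ (DFunLike.congr_fun h1) (DFunLike.congr_fun h2),
    rfl⟩

/-- If the diffeomorphisms compatible with a smooth map act transitively on its source, then the
map has constant rank. -/
theorem finrank_ker_chartRep_eq {f : M → N} (hf : ContMDiff (𝓡 a) (𝓡 b) ∞ f)
    (hom : ∀ x y : M, ∃ (A : M ≃ₘ^∞⟮𝓡 a, 𝓡 a⟯ M) (B : N ≃ₘ^∞⟮𝓡 b, 𝓡 b⟯ N),
      A x = y ∧ ∀ z, f (A z) = B (f z)) (x : M) (y : N)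
    {u u' : EuclideanSpace ℝ (Fin a)} (hu : u ∈ chartDom a b f x y)
    (hu' : u' ∈ chartDom a b f x y) :
    Module.finrank ℝ (fderiv ℝ (chartRep a b f x y) u).ker =
      Module.finrank ℝ (fderiv ℝ (chartRep a b f x y) u').ker := by
  obtain ⟨A, B, hA, hAB⟩ := hom ((extChartAt (𝓡 a) x).symm u) ((extChartAt (𝓡 a) x).symm u')
  have huA : u ∈ chartDom a a A x x := by
    refine ⟨hu.1, ?_⟩
    rw [Set.mem_preimage, Set.mem_preimage, hA]
    exact (extChartAt (𝓡 a) x).map_target hu'.1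
  have hAu : chartRep a a A x x u = u' := by
    rw [chartRep, hA, (extChartAt (𝓡 a) x).right_inv hu'.1]
  have h1 : f ∘ A = B ∘ f := funext hAB
  have huf : u ∈ chartDom a b (f ∘ A) x y := by
    refine ⟨hu.1, ?_⟩
    rw [Set.mem_preimage, Set.mem_preimage, Function.comp_apply, hA]
    exact hu'.2
  -- The derivative of `f ∘ A = B ∘ f` at `u` is computed in two ways: one contains the derivative
  -- of `f` at `u'`, the other its derivative at `u`, and the remaining factors are invertible.
  have h2 := fderiv_chartRep_comp A.contMDiff hf huA huf
  have huf' := huf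
  rw [h1] at huf'
  rw [h1, fderiv_chartRep_comp hf B.contMDiff hu huf', hAu] at h2
  rw [← finrank_ker_comp_right _ (fderiv ℝ (chartRep a b f x y) u')
      (isInvertible_fderiv_chartRep A huA), ← h2,
    finrank_ker_comp_left _ _ (isInvertible_fderiv_chartRep B (chartRep_mem_chartDom hu huf'))]

/-- Homogeneity makes the rank constant on the whole domain of the chart representative, and charts
preserve injectivity, so the constant rank theorem applies. This is used for orbit maps. -/
theorem ker_fderiv_chartRep_eq_bot {f : M → N} (hf : ContMDiff (𝓡 a) (𝓡 b) ∞ f)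
    (hom : ∀ x y : M, ∃ (A : M ≃ₘ^∞⟮𝓡 a, 𝓡 a⟯ M) (B : N ≃ₘ^∞⟮𝓡 b, 𝓡 b⟯ N),
      A x = y ∧ ∀ z, f (A z) = B (f z)) (hinj : Function.Injective f) {x : M} {y : N}
    (h : f x ∈ (extChartAt (𝓡 b) y).source) :
    (fderiv ℝ (chartRep a b f x y) (extChartAt (𝓡 a) x x)).ker = ⊥ := by
  refine ker_fderiv_eq_bot_of_injOn (isOpen_chartDom hf.continuous x y)
    (contDiffOn_chartRep hf x y) (mem_chartDom h)
    (fun v hv => finrank_ker_chartRep_eq hf hom x y hv (mem_chartDom h)) ?_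
  intro u hu v hv huv
  exact (extChartAt (𝓡 a) x).symm.injOn hu.1 hv.1
    (hinj ((extChartAt (𝓡 b) y).injOn hu.2 hv.2 huv))

/-- The companion for open maps, used for surjective homomorphisms: the rank is again constant by
homogeneity, and openness is carried through the charts at the given point. -/
theorem range_fderiv_chartRep_eq_top {f : M → N} (hf : ContMDiff (𝓡 a) (𝓡 b) ∞ f)
    (hom : ∀ x y : M, ∃ (A : M ≃ₘ^∞⟮𝓡 a, 𝓡 a⟯ M) (B : N ≃ₘ^∞⟮𝓡 b, 𝓡 b⟯ N),
      A x = y ∧ ∀ z, f (A z) = B (f z)) (hopen : IsOpenMap f) {x : M} {y : N}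
    (h : f x ∈ (extChartAt (𝓡 b) y).source) :
    (fderiv ℝ (chartRep a b f x y) (extChartAt (𝓡 a) x x)).range = ⊤ := by
  refine range_fderiv_eq_top_of_open (isOpen_chartDom hf.continuous x y)
    (contDiffOn_chartRep hf x y) (mem_chartDom h)
    (fun v hv => finrank_ker_chartRep_eq hf hom x y hv (mem_chartDom h)) ?_
  intro V hV
  set W := V ∩ chartDom a b f x y
  have hW : W ∈ 𝓝 (extChartAt (𝓡 a) x x) :=
    Filter.inter_mem hV ((isOpen_chartDom hf.continuous x y).mem_nhds (mem_chartDom h))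
  have h1 : extChartAt (𝓡 a) x ⁻¹' W ∩ (extChartAt (𝓡 a) x).source ∈ 𝓝 x :=
    Filter.inter_mem ((continuousAt_extChartAt x) hW) (extChartAt_source_mem_nhds x)
  have h2 := hopen.image_mem_nhds h1
  have h3 : (extChartAt (𝓡 b) y).symm ⁻¹'
      (f '' (extChartAt (𝓡 a) x ⁻¹' W ∩ (extChartAt (𝓡 a) x).source)) ∩
        (extChartAt (𝓡 b) y).target ∈ 𝓝 (extChartAt (𝓡 b) y (f x)) := by
    refine Filter.inter_mem ?_
      ((isOpen_extChartAt_target y).mem_nhds ((extChartAt (𝓡 b) y).map_source h))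
    refine (continuousAt_extChartAt_symm' h) ?_
    rw [(extChartAt (𝓡 b) y).left_inv h]
    exact h2
  have h4 : chartRep a b f x y (extChartAt (𝓡 a) x x) = extChartAt (𝓡 b) y (f x) := by
    rw [chartRep, extChartAt_to_inv]
  rw [h4]
  refine Filter.mem_of_superset h3 ?_
  rintro w ⟨⟨z, ⟨hzW, hzs⟩, hz⟩, hw⟩
  refine ⟨extChartAt (𝓡 a) x z, hzW.1, ?_⟩
  rw [chartRep, (extChartAt (𝓡 a) x).left_inv hzs, hz, (extChartAt (𝓡 b) y).right_inv hw]

end Homogeneous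

/-! ### Local sections of surjective homomorphisms of Lie groups -/

section LieHom

variable {k r : ℕ} {G Γ : Type*} [Group G] [TopologicalSpace G]
  [ChartedSpace (EuclideanSpace ℝ (Fin k)) G] [LieGroup (𝓡 k) ∞ G] [SecondCountableTopology G]
  [Group Γ] [TopologicalSpace Γ] [ChartedSpace (EuclideanSpace ℝ (Fin r)) Γ]
  [LieGroup (𝓡 r) ∞ Γ] [T2Space Γ]

/-- This is the open mapping theorem for groups, a Baire category argument: the source is locally
compact and second countable, hence σ-compact, and the target is locally compact Hausdorff, hence
Baire. -/
theorem isOpenMap_of_surjective_lieHom {φ : G →* Γ} (hφ : ContMDiff (𝓡 k) (𝓡 r) ∞ φ)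
    (hs : Function.Surjective φ) : IsOpenMap φ := by
  have : IsTopologicalGroup G := topologicalGroup_of_lieGroup (𝓡 k) ∞
  have : IsTopologicalGroup Γ := topologicalGroup_of_lieGroup (𝓡 r) ∞
  have : LocallyCompactSpace G := Manifold.locallyCompact_of_finiteDimensional (𝓡 k)
  have : LocallyCompactSpace Γ := Manifold.locallyCompact_of_finiteDimensional (𝓡 r)
  exact φ.isOpenMap_of_sigmaCompact hs hφ.continuous

/-- A surjective smooth homomorphism of Lie groups, with second countable source, has smooth local
sections. -/
theorem exists_local_section_lieHom {φ : G →* Γ} (hφ : ContMDiff (𝓡 k) (𝓡 r) ∞ φ)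
    (hs : Function.Surjective φ) (γ₀ : Γ) :
    ∃ (U : Set Γ) (s : Γ → G), IsOpen U ∧ γ₀ ∈ U ∧ ContMDiffOn (𝓡 r) (𝓡 k) ∞ s U ∧
      ∀ γ ∈ U, φ (s γ) = γ := by
  obtain ⟨g₀, rfl⟩ := hs γ₀
  have hn : (∞ : WithTop ℕ∞) ≠ 0 := by simp
  have hsrc : φ g₀ ∈ (extChartAt (𝓡 r) (φ g₀)).source := mem_extChartAt_source _
  -- Left translations act transitively on `G` and are intertwined by `φ` with left translations of
  -- `Γ`, which is the homogeneity required.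
  have htop := range_fderiv_chartRep_eq_top hφ (fun x y =>
    ⟨Diffeomorph.smul (𝓡 k) (𝓡 k) ∞ (y * x⁻¹), Diffeomorph.smul (𝓡 r) (𝓡 r) ∞ (φ (y * x⁻¹)),
      by simp [Diffeomorph.smul_apply], fun z => by simp [Diffeomorph.smul_apply]⟩)
    (isOpenMap_of_surjective_lieHom hφ hs) hsrc
  set u₀ := extChartAt (𝓡 k) g₀ g₀ with hu₀
  set D := fderiv ℝ (chartRep k r φ g₀ (φ g₀)) u₀ with hD
  have hDsurj : Function.Surjective D := LinearMap.range_eq_top.1 htop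
  obtain ⟨L, hL⟩ := (D : EuclideanSpace ℝ (Fin k) →ₗ[ℝ] EuclideanSpace ℝ (Fin r)).exists_rightInverse_of_surjective
    htop
  let L' : EuclideanSpace ℝ (Fin r) →L[ℝ] EuclideanSpace ℝ (Fin k) := L.toContinuousLinearMap
  -- The section is sought in the affine subspace through `u₀` directed by a linear right inverse of
  -- the derivative: restricted to it, `φ` in charts has derivative the identity and can be
  -- inverted.
  let a : EuclideanSpace ℝ (Fin r) → EuclideanSpace ℝ (Fin k) := fun v => u₀ + L' v
  have ha : ContDiff ℝ ∞ a := contDiff_const.add L'.contDiff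
  have ha0 : a 0 = u₀ := by simp [a]
  have hopen : IsOpen (chartDom k r φ g₀ (φ g₀)) := isOpen_chartDom hφ.continuous g₀ (φ g₀)
  have hmem : u₀ ∈ chartDom k r φ g₀ (φ g₀) := mem_chartDom hsrc
  have hsm := (contDiffOn_chartRep hφ g₀ (φ g₀))
  have hd : HasFDerivAt (chartRep k r φ g₀ (φ g₀) ∘ a)
      ((ContinuousLinearEquiv.refl ℝ (EuclideanSpace ℝ (Fin r)) :
        EuclideanSpace ℝ (Fin r) →L[ℝ] EuclideanSpace ℝ (Fin r))) 0 := by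
    have h1 : HasFDerivAt (chartRep k r φ g₀ (φ g₀)) D (a 0) := by
      rw [ha0]
      exact ((hsm.contDiffAt (hopen.mem_nhds hmem)).differentiableAt hn).hasFDerivAt
    have h2 : HasFDerivAt a L' 0 := L'.hasFDerivAt.const_add u₀
    refine (h1.comp 0 h2).congr_fderiv ?_
    ext1 v
    exact LinearMap.congr_fun hL v
  obtain ⟨e, he0, heU, hecoe, hesm, -⟩ := exists_smooth_local_inverse
    (hopen.preimage ha.continuous) (hsm.comp ha.contDiffOn fun _ h => h)
    (show (0 : EuclideanSpace ℝ (Fin r)) ∈ a ⁻¹' chartDom k r φ g₀ (φ g₀) by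
      rw [Set.mem_preimage, ha0]; exact hmem) _ hd
  refine ⟨(extChartAt (𝓡 r) (φ g₀)).source ∩ extChartAt (𝓡 r) (φ g₀) ⁻¹' e.target,
    fun γ => (extChartAt (𝓡 k) g₀).symm (a (e.symm (extChartAt (𝓡 r) (φ g₀) γ))),
    (continuousOn_extChartAt _).isOpen_inter_preimage (isOpen_extChartAt_source _) e.open_target,
    ⟨hsrc, ?_⟩, ?_, ?_⟩
  · have := e.map_source he0
    rw [hecoe, Function.comp_apply, ha0, chartRep, hu₀, extChartAt_to_inv] at this
    exact this
  · have h1 : ContMDiffOn (𝓡 r) (𝓡 r) ∞ (extChartAt (𝓡 r) (φ g₀))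
        ((extChartAt (𝓡 r) (φ g₀)).source ∩ extChartAt (𝓡 r) (φ g₀) ⁻¹' e.target) :=
      (contMDiffOn_extChartAt (I := 𝓡 r) (n := ∞) (x := φ g₀)).mono fun z hz => by
        rw [← extChartAt_source (𝓡 r)]; exact hz.1
    have h2 := hesm.contMDiffOn.comp h1 fun z hz => hz.2
    have h3 := ha.contMDiff.comp_contMDiffOn h2
    exact (contMDiffOn_extChartAt_symm (I := 𝓡 k) (n := ∞) g₀).comp h3 fun z hz =>
      (heU (e.map_target hz.2)).1
  · rintro γ ⟨hγ, hγt⟩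
    have hm := e.map_target hγt
    have h1 := e.right_inv hγt
    rw [hecoe] at h1
    exact (extChartAt (𝓡 r) (φ g₀)).injOn (heU hm).2 hγ h1

end LieHom

/-! ### Slices of free and proper actions -/

section Slice

variable {l n m : ℕ} {H X : Type*} [Group H] [TopologicalSpace H]
  [ChartedSpace (EuclideanSpace ℝ (Fin l)) H] [LieGroup (𝓡 l) ∞ H]
  [TopologicalSpace X] [ChartedSpace (EuclideanSpace ℝ (Fin n)) X] [IsManifold (𝓡 n) ∞ X]
  [MulAction H X] [ContMDiffSMul (𝓡 l) (𝓡 n) ∞ H X]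

omit [LieGroup (𝓡 l) ∞ H] [IsManifold (𝓡 n) ∞ X] in
theorem contMDiff_orbit (x : X) : ContMDiff (𝓡 l) (𝓡 n) ∞ fun h : H => h • x :=
  (contMDiff_smul (I := 𝓡 l) (I' := 𝓡 n)).comp (contMDiff_id.prodMk contMDiff_const)

/-- Freeness makes the orbit map injective. It intertwines left translations of `H` with the action
on `X`, so it has constant rank and is therefore an immersion. -/
theorem ker_fderiv_orbit_eq_bot (hfree : ∀ (h : H) (x : X), h • x = x → h = 1) (x : X) :
    (fderiv ℝ (chartRep l n (fun h : H => h • x) 1 x) (extChartAt (𝓡 l) (1 : H) 1)).ker = ⊥ := by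
  refine ker_fderiv_chartRep_eq_bot (contMDiff_orbit x) (fun g g' =>
    ⟨Diffeomorph.smul (𝓡 l) (𝓡 l) ∞ (g' * g⁻¹), Diffeomorph.smul (𝓡 l) (𝓡 n) ∞ (g' * g⁻¹),
      by simp [Diffeomorph.smul_apply], fun z => by
        simp only [Diffeomorph.smul_apply, smul_eq_mul, mul_smul]⟩) ?_ ?_
  · intro g g' h
    have h' : g • x = g' • x := h
    have : (g'⁻¹ * g) • x = x := by rw [mul_smul, h', inv_smul_smul]
    have h2 := hfree _ _ this
    rwa [inv_mul_eq_one, eq_comm] at h2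
  · simp

theorem dim_le_of_free (hfree : ∀ (h : H) (x : X), h • x = x → h = 1) (x : X) : l ≤ n := by
  have := LinearMap.finrank_le_finrank_of_injective
    (LinearMap.ker_eq_bot.1 (ker_fderiv_orbit_eq_bot (l := l) (n := n) hfree x))
  simpa using this

/-- A map from a product near a point has the derivative assembled from its partial derivatives. -/
theorem hasFDerivAt_coprod {E E' F : Type*} [NormedAddCommGroup E] [NormedSpace ℝ E]
    [NormedAddCommGroup E'] [NormedSpace ℝ E'] [NormedAddCommGroup F] [NormedSpace ℝ F]
    {f : E × E' → F} {u : E} {v : E'} (hf : DifferentiableAt ℝ f (u, v)) {A : E →L[ℝ] F}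
    {B : E' →L[ℝ] F} (hA : HasFDerivAt (fun z => f (z, v)) A u)
    (hB : HasFDerivAt (fun z => f (u, z)) B v) : HasFDerivAt f (A.coprod B) (u, v) := by
  have h := hf.hasFDerivAt
  have h1 := (h.comp u (hasFDerivAt_prodMk_left u v)).unique hA
  have h2 := (h.comp v (hasFDerivAt_prodMk_right u v)).unique hB
  refine h.congr_fderiv (ContinuousLinearMap.ext fun w => ?_)
  rw [ContinuousLinearMap.coprod_apply, ← h1, ← h2]
  simp only [ContinuousLinearMap.comp_apply, ContinuousLinearMap.inl_apply,
    ContinuousLinearMap.inr_apply]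
  rw [← map_add]
  simp

/-- The local form of a free smooth action: near a point, the action is a local diffeomorphism from
the product of the group and a transversal. -/
theorem exists_local_transversal (hfree : ∀ (h : H) (x : X), h • x = x → h = 1)
    (hm : l + m = n) (x₀ : X) :
    ∃ (V : Set (EuclideanSpace ℝ (Fin m))) (σ : EuclideanSpace ℝ (Fin m) → X)
      (e : OpenPartialHomeomorph (EuclideanSpace ℝ (Fin l) × EuclideanSpace ℝ (Fin m))
        (EuclideanSpace ℝ (Fin n))),
      IsOpen V ∧ 0 ∈ V ∧ ContMDiffOn (𝓡 m) (𝓡 n) ∞ σ V ∧ σ 0 = x₀ ∧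
      (extChartAt (𝓡 l) (1 : H) 1, 0) ∈ e.source ∧ ContDiffOn ℝ ∞ e.symm e.target ∧
      ∀ p ∈ e.source, p.1 ∈ (extChartAt (𝓡 l) (1 : H)).target ∧ p.2 ∈ V ∧
        (extChartAt (𝓡 l) (1 : H)).symm p.1 • σ p.2 ∈ (extChartAt (𝓡 n) x₀).source ∧
        e p = extChartAt (𝓡 n) x₀ ((extChartAt (𝓡 l) (1 : H)).symm p.1 • σ p.2) := by
  have hn : (∞ : WithTop ℕ∞) ≠ 0 := by simp
  set u₀ := extChartAt (𝓡 l) (1 : H) 1 with hu₀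
  set y₀ := extChartAt (𝓡 n) x₀ x₀ with hy₀
  set D := fderiv ℝ (chartRep l n (fun h : H => h • x₀) 1 x₀) u₀ with hD
  have hDker : D.ker = ⊥ := ker_fderiv_orbit_eq_bot hfree x₀
  obtain ⟨C, hC⟩ := D.range.exists_isCompl
  have hDfin : Module.finrank ℝ D.range = l := by
    have := LinearMap.finrank_range_add_finrank_ker
      (D : EuclideanSpace ℝ (Fin l) →ₗ[ℝ] EuclideanSpace ℝ (Fin n))
    rw [hDker] at this
    simpa using this
  have hCfin : Module.finrank ℝ C = m := by
    have := Submodule.finrank_add_eq_of_isCompl hC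
    rw [hDfin] at this
    have h2 : Module.finrank ℝ (EuclideanSpace ℝ (Fin n)) = n := by simp
    omega
  -- The transversal is modelled on a complement `C` of the tangent space of the orbit, whose
  -- dimension is `m` because the orbit map is an immersion.
  let ι : EuclideanSpace ℝ (Fin m) ≃L[ℝ] C := ContinuousLinearEquiv.ofFinrankEq (by simp [hCfin])
  let L : EuclideanSpace ℝ (Fin m) →L[ℝ] EuclideanSpace ℝ (Fin n) :=
    C.subtypeL.comp (ι : EuclideanSpace ℝ (Fin m) →L[ℝ] C)
  have hinj : Function.Injective (D.coprod L) := by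
    rw [injective_iff_map_eq_zero]
    rintro ⟨v, w⟩ hvw
    rw [ContinuousLinearMap.coprod_apply] at hvw
    have h1 : L w ∈ C := (ι w).2
    have h2 : D v ∈ D.range := ⟨v, rfl⟩
    have h3 : D v = -L w := eq_neg_of_add_eq_zero_left hvw
    have h4 : D v ∈ C := by rw [h3]; exact C.neg_mem h1
    have h5 : D v = 0 := Submodule.disjoint_def.1 hC.disjoint _ h2 h4
    have h6 : v = 0 := LinearMap.ker_eq_bot'.1 hDker v h5
    have h7 : L w = 0 := by rw [h5] at h3; exact neg_eq_zero.1 h3.symm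
    have h8 : ι w = 0 := Subtype.ext h7
    rw [h6, ι.map_eq_zero_iff.1 h8]
    rfl
  let A : (EuclideanSpace ℝ (Fin l) × EuclideanSpace ℝ (Fin m)) ≃L[ℝ] EuclideanSpace ℝ (Fin n) :=
    (LinearEquiv.ofInjectiveOfFinrankEq (D.coprod L : _ →ₗ[ℝ] EuclideanSpace ℝ (Fin n)) hinj
      (by simp [hm])).toContinuousLinearEquiv
  have hA : (A : _ →L[ℝ] EuclideanSpace ℝ (Fin n)) = D.coprod L :=
    ContinuousLinearMap.ext fun v => rfl
  let a : EuclideanSpace ℝ (Fin m) → EuclideanSpace ℝ (Fin n) := fun v => y₀ + L v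
  have ha : ContDiff ℝ ∞ a := contDiff_const.add L.contDiff
  have ha0 : a 0 = y₀ := by simp [a]
  let V : Set (EuclideanSpace ℝ (Fin m)) := a ⁻¹' (extChartAt (𝓡 n) x₀).target
  have hV : IsOpen V := (isOpen_extChartAt_target x₀).preimage ha.continuous
  have hV0 : (0 : EuclideanSpace ℝ (Fin m)) ∈ V := by
    rw [Set.mem_preimage, ha0]; exact mem_extChartAt_target x₀
  let σ : EuclideanSpace ℝ (Fin m) → X := fun v => (extChartAt (𝓡 n) x₀).symm (a v)
  have hσ : ContMDiffOn (𝓡 m) (𝓡 n) ∞ σ V :=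
    (contMDiffOn_extChartAt_symm (I := 𝓡 n) (n := ∞) x₀).comp ha.contMDiff.contMDiffOn
      fun v hv => hv
  have hσ0 : σ 0 = x₀ := by
    change (extChartAt (𝓡 n) x₀).symm (a 0) = x₀
    rw [ha0, hy₀, extChartAt_to_inv]
  let W : Set (EuclideanSpace ℝ (Fin l) × EuclideanSpace ℝ (Fin m)) :=
    (extChartAt (𝓡 l) (1 : H)).target ×ˢ V
  have hW : IsOpen W := (isOpen_extChartAt_target 1).prod hV
  let θ : EuclideanSpace ℝ (Fin l) × EuclideanSpace ℝ (Fin m) → X := fun p =>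
    (extChartAt (𝓡 l) (1 : H)).symm p.1 • σ p.2
  have hθ : ContMDiffOn 𝓘(ℝ, EuclideanSpace ℝ (Fin l) × EuclideanSpace ℝ (Fin m)) (𝓡 n) ∞ θ W := by
    have h1 := (contMDiffOn_extChartAt_symm (I := 𝓡 l) (n := ∞) (1 : H)).comp
      (contDiff_fst (𝕜 := ℝ) (E := EuclideanSpace ℝ (Fin l))
        (F := EuclideanSpace ℝ (Fin m))).contMDiff.contMDiffOn (s := W) fun p hp => hp.1
    have h2 := hσ.comp (contDiff_snd (𝕜 := ℝ) (E := EuclideanSpace ℝ (Fin l))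
        (F := EuclideanSpace ℝ (Fin m))).contMDiff.contMDiffOn (s := W) fun p hp => hp.2
    exact h1.smul h2
  let U := W ∩ θ ⁻¹' (extChartAt (𝓡 n) x₀).source
  have hU : IsOpen U := hθ.continuousOn.isOpen_inter_preimage hW (isOpen_extChartAt_source x₀)
  let Ψ : EuclideanSpace ℝ (Fin l) × EuclideanSpace ℝ (Fin m) → EuclideanSpace ℝ (Fin n) :=
    fun p => extChartAt (𝓡 n) x₀ (θ p)
  have hΨ : ContDiffOn ℝ ∞ Ψ U := by
    rw [← contMDiffOn_iff_contDiffOn]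
    exact (contMDiffOn_extChartAt (I := 𝓡 n) (n := ∞) (x := x₀)).comp
      (hθ.mono Set.inter_subset_left) fun p hp => by
        rw [← extChartAt_source (𝓡 n)]; exact hp.2
  have hmem : (u₀, (0 : EuclideanSpace ℝ (Fin m))) ∈ U := by
    refine ⟨⟨mem_extChartAt_target 1, hV0⟩, ?_⟩
    change (extChartAt (𝓡 l) (1 : H)).symm u₀ • σ 0 ∈ (extChartAt (𝓡 n) x₀).source
    rw [hu₀, extChartAt_to_inv, hσ0, one_smul]
    exact mem_extChartAt_source x₀
  -- The partial derivative in the group direction is that of the orbit map of `σ 0 = x₀`; in the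
  -- other direction the unit acts trivially and the map is the affine map `a`. Together they give
  -- the isomorphism `A`.
  have hd : HasFDerivAt Ψ (A : _ →L[ℝ] EuclideanSpace ℝ (Fin n)) (u₀, 0) := by
    rw [hA]
    refine hasFDerivAt_coprod ((hΨ.contDiffAt (hU.mem_nhds hmem)).differentiableAt hn) ?_ ?_
    · have h1 : (fun z => Ψ (z, 0)) = chartRep l n (fun h : H => h • x₀) 1 x₀ := by
        funext z
        simp only [Ψ, θ, chartRep, hσ0]
      rw [h1]
      have h2 : u₀ ∈ chartDom l n (fun h : H => h • x₀) 1 x₀ := mem_chartDom (by simp)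
      exact (((contDiffOn_chartRep (contMDiff_orbit x₀) 1 x₀).contDiffAt
        ((isOpen_chartDom (contMDiff_orbit (l := l) (n := n) x₀).continuous 1 x₀).mem_nhds
          h2)).differentiableAt hn).hasFDerivAt
    · have h1 : (fun z => Ψ (u₀, z)) =ᶠ[𝓝 0] a := by
        filter_upwards [hV.mem_nhds hV0] with v hv
        simp only [Ψ, θ, hu₀, extChartAt_to_inv, one_smul, σ]
        exact (extChartAt (𝓡 n) x₀).right_inv hv
      exact (L.hasFDerivAt.const_add y₀).congr_of_eventuallyEq h1
  obtain ⟨e, he0, heU, hecoe, hesm, -⟩ := exists_smooth_local_inverse hU hΨ hmem A hd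
  exact ⟨V, σ, e, hV, hV0, hσ, hσ0, he0, hesm, fun p hp =>
    ⟨(heU hp).1.1, (heU hp).1.2, (heU hp).2, by rw [hecoe]⟩⟩

/-- A slice of an action: an open invariant set that is equivariantly diffeomorphic to the product
of the group and an open set `V` of a Euclidean space. -/
structure Slice (l n m : ℕ) (H X : Type*) [Group H] [TopologicalSpace H]
    [ChartedSpace (EuclideanSpace ℝ (Fin l)) H] [TopologicalSpace X]
    [ChartedSpace (EuclideanSpace ℝ (Fin n)) X] [MulAction H X] where
  domain : Set X
  isOpen_domain : IsOpen domain
  target : Set (EuclideanSpace ℝ (Fin m))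
  isOpen_target : IsOpen target
  sec : EuclideanSpace ℝ (Fin m) → X
  contMDiffOn_sec : ContMDiffOn (𝓡 m) (𝓡 n) ∞ sec target
  coord : X → EuclideanSpace ℝ (Fin m)
  contMDiffOn_coord : ContMDiffOn (𝓡 n) (𝓡 m) ∞ coord domain
  trans : X → H
  contMDiffOn_trans : ContMDiffOn (𝓡 n) (𝓡 l) ∞ trans domain
  smul_sec_mem : ∀ (h : H), ∀ v ∈ target, h • sec v ∈ domain
  trans_smul_sec : ∀ (h : H), ∀ v ∈ target, trans (h • sec v) = h
  coord_smul_sec : ∀ (h : H), ∀ v ∈ target, coord (h • sec v) = v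
  coord_mem : ∀ x ∈ domain, coord x ∈ target
  smul_sec_coord : ∀ x ∈ domain, trans x • sec (coord x) = x

/-- The slice theorem for free and proper smooth actions. -/
theorem exists_slice (hfree : ∀ (h : H) (x : X), h • x = x → h = 1)
    (hprop : IsProperMap fun q : H × X => (q.1 • q.2, q.2)) (hm : l + m = n) (x₀ : X) :
    ∃ S : Slice l n m H X, x₀ ∈ S.domain := by
  obtain ⟨V₀, σ, e, hV₀, h0V₀, hσ, hσ0, he0, hesm, he⟩ :=
    exists_local_transversal (m := m) hfree hm x₀
  have : ContinuousSMul H X := ContMDiffSMul.continuousSMul (I := 𝓡 l) (I' := 𝓡 n) ∞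
  have hσc : ContinuousAt σ 0 := hσ.continuousOn.continuousAt (hV₀.mem_nhds h0V₀)
  obtain ⟨A, B, hA, h1A, hB, h0B, hAB⟩ : ∃ (A : Set H) (B : Set (EuclideanSpace ℝ (Fin m))),
      IsOpen A ∧ 1 ∈ A ∧ IsOpen B ∧ 0 ∈ B ∧ ∀ h ∈ A, ∀ v ∈ B,
        h ∈ (extChartAt (𝓡 l) (1 : H)).source ∧ (extChartAt (𝓡 l) (1 : H) h, v) ∈ e.source := by
    obtain ⟨A', B, hA', h1A', hB, h0B, hAB⟩ := mem_nhds_prod_iff'.1 (e.open_source.mem_nhds he0)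
    refine ⟨(extChartAt (𝓡 l) (1 : H)).source ∩ extChartAt (𝓡 l) (1 : H) ⁻¹' A', B,
      (continuousOn_extChartAt _).isOpen_inter_preimage (isOpen_extChartAt_source _) hA',
      ⟨mem_extChartAt_source _, h1A'⟩, hB, h0B, fun h hh v hv => ⟨hh.1, hAB ⟨hh.2, hv⟩⟩⟩
  -- This is where properness is used. By freeness the fibre of the action map over `(x₀, x₀)` is
  -- the single point `(1, x₀)`; since the map is closed, pairs close to `(x₀, x₀)` can be related
  -- only by group elements in the neighbourhood `A` of `1`.
  obtain ⟨V, hV, h0V, hVB, hVA⟩ : ∃ V : Set (EuclideanSpace ℝ (Fin m)), IsOpen V ∧ 0 ∈ V ∧ V ⊆ B ∧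
      ∀ h : H, ∀ v ∈ V, ∀ v' ∈ V, h • σ v = σ v' → h ∈ A := by
    have h1 := hprop.isClosedMap.comap_nhds_le (y := (x₀, x₀))
    have h2 : {q : H × X | q.1 ∈ A} ∈ 𝓝ˢ ((fun q : H × X => (q.1 • q.2, q.2)) ⁻¹' {(x₀, x₀)}) := by
      refine (hA.preimage continuous_fst).mem_nhdsSet.2 ?_
      rintro ⟨h, x⟩ hx
      obtain ⟨hx1, hx2⟩ := Prod.mk.inj hx
      simp only at hx1 hx2
      subst hx2
      change h ∈ A
      rw [hfree h x hx1]
      exact h1A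
    obtain ⟨N, hN, hN'⟩ := Filter.mem_comap.1 (h1 h2)
    have h3 : (fun p : EuclideanSpace ℝ (Fin m) × EuclideanSpace ℝ (Fin m) => (σ p.1, σ p.2)) ⁻¹' N
        ∈ 𝓝 ((0 : EuclideanSpace ℝ (Fin m)), (0 : EuclideanSpace ℝ (Fin m))) := by
      have hc : ContinuousAt (fun p : EuclideanSpace ℝ (Fin m) × EuclideanSpace ℝ (Fin m) =>
          (σ p.1, σ p.2)) (0, 0) :=
        (hσc.comp (f := Prod.fst) continuousAt_fst).prodMk
          (hσc.comp (f := Prod.snd) continuousAt_snd)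
      refine hc.preimage_mem_nhds ?_
      rw [hσ0]
      exact hN
    obtain ⟨V₁, hV₁, h0V₁, hVV⟩ := exists_nhds_square h3
    refine ⟨V₁ ∩ B, hV₁.inter hB, ⟨h0V₁, h0B⟩, Set.inter_subset_right, ?_⟩
    intro h v hv v' hv' hvv
    have h4 : (h • σ v, σ v) ∈ N := by rw [hvv]; exact hVV (Set.mk_mem_prod hv'.1 hv.1)
    exact hN' (show (h, σ v) ∈ _ from h4)
  have hVV₀ : V ⊆ V₀ := fun v hv => (he _ (hAB 1 h1A v (hVB hv)).2).2.1
  -- Once `h` is known to lie in `A`, both points are seen by the local diffeomorphism `e`, whose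
  -- injectivity finishes the comparison.
  have hinj1 : ∀ h : H, ∀ v ∈ V, ∀ v' ∈ V, h • σ v = σ v' → h = 1 ∧ v = v' := by
    intro h v hv v' hv' hvv
    have hh := hVA h v hv v' hv' hvv
    obtain ⟨h1, h2⟩ := hAB h hh v (hVB hv)
    obtain ⟨h3, h4⟩ := hAB 1 h1A v' (hVB hv')
    have h5 : e (extChartAt (𝓡 l) (1 : H) h, v) = e (extChartAt (𝓡 l) (1 : H) 1, v') := by
      rw [(he _ h2).2.2.2, (he _ h4).2.2.2]
      simp only [(extChartAt (𝓡 l) (1 : H)).left_inv h1, (extChartAt (𝓡 l) (1 : H)).left_inv h3,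
        one_smul, hvv]
    obtain ⟨h6, h7⟩ := Prod.mk.inj (e.injOn h2 h4 h5)
    exact ⟨(extChartAt (𝓡 l) (1 : H)).injOn h1 h3 h6, h7⟩
  have hinj : ∀ h h' : H, ∀ v ∈ V, ∀ v' ∈ V, h • σ v = h' • σ v' → h = h' ∧ v = v' := by
    intro h h' v hv v' hv' hvv
    have h1 : (h'⁻¹ * h) • σ v = σ v' := by rw [mul_smul, hvv, inv_smul_smul]
    obtain ⟨h2, h3⟩ := hinj1 _ v hv v' hv' h1
    exact ⟨(inv_mul_eq_one.1 h2).symm, h3⟩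
  let O : Set X := {x | ∃ p : H × EuclideanSpace ℝ (Fin m), p.2 ∈ V ∧ p.1 • σ p.2 = x}
  classical
  -- The value off `O` is irrelevant, since the decomposition is only used on `O`, where `hinj`
  -- makes it unique.
  let dec : X → H × EuclideanSpace ℝ (Fin m) := fun x => if hx : x ∈ O then hx.choose else (1, 0)
  have hdec : ∀ x ∈ O, (dec x).2 ∈ V ∧ (dec x).1 • σ (dec x).2 = x := by
    intro x hx
    simp only [dec, dif_pos hx]
    exact hx.choose_spec
  have hdec' : ∀ (h : H), ∀ v ∈ V, dec (h • σ v) = (h, v) := by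
    intro h v hv
    obtain ⟨h1, h2⟩ := hdec (h • σ v) ⟨(h, v), hv, rfl⟩
    obtain ⟨h3, h4⟩ := hinj _ _ _ h1 v hv h2
    exact Prod.ext h3 h4
  -- Translation by `h₁⁻¹` brings the point back to the transversal, where `e.symm` gives a smooth
  -- decomposition. This shows that `O` is open and, by uniqueness, that `dec` is smooth.
  have hloc : ∀ x ∈ O, ∃ f : X → H × EuclideanSpace ℝ (Fin m),
      ContMDiffAt (𝓡 n) ((𝓡 l).prod (𝓡 m)) ∞ f x ∧
      ∀ᶠ z in 𝓝 x, (f z).2 ∈ V ∧ (f z).1 • σ (f z).2 = z := by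
    rintro x ⟨⟨h₁, v₁⟩, hv₁, rfl⟩
    obtain ⟨h1, h2⟩ := hAB 1 h1A v₁ (hVB hv₁)
    obtain ⟨h3, h4, h5, h6⟩ := he _ h2
    simp only [(extChartAt (𝓡 l) (1 : H)).left_inv h1, one_smul] at h3 h4 h5 h6
    simp only
    have hx1 : h₁⁻¹ • h₁ • σ v₁ = σ v₁ := inv_smul_smul _ _
    have hsm1 : ContMDiffAt (𝓡 n) (𝓡 n) ∞ (fun z : X => h₁⁻¹ • z) (h₁ • σ v₁) :=
      (Diffeomorph.smul (𝓡 l) (𝓡 n) ∞ h₁⁻¹ : X ≃ₘ^∞⟮𝓡 n, 𝓡 n⟯ X).contMDiff.contMDiffAt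
    have hsm2 : ContMDiffAt (𝓡 n) (𝓡 n) ∞ (fun z : X => extChartAt (𝓡 n) x₀ (h₁⁻¹ • z))
        (h₁ • σ v₁) := by
      refine ContMDiffAt.comp _ ?_ hsm1
      rw [hx1]
      refine contMDiffAt_extChartAt' ?_
      rwa [← extChartAt_source (𝓡 n)]
    have htar : extChartAt (𝓡 n) x₀ (h₁⁻¹ • h₁ • σ v₁) ∈ e.target := by
      rw [hx1, ← h6]
      exact e.map_source h2
    have hsm3 : ContMDiffAt (𝓡 n) 𝓘(ℝ, EuclideanSpace ℝ (Fin l) × EuclideanSpace ℝ (Fin m)) ∞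
        (fun z : X => e.symm (extChartAt (𝓡 n) x₀ (h₁⁻¹ • z))) (h₁ • σ v₁) :=
      ContMDiffAt.comp _ (hesm.contDiffAt (e.open_target.mem_nhds htar)).contMDiffAt hsm2
    have hval : e.symm (extChartAt (𝓡 n) x₀ (h₁⁻¹ • h₁ • σ v₁)) =
        (extChartAt (𝓡 l) (1 : H) 1, v₁) := by
      rw [hx1, ← h6]
      exact e.left_inv h2
    have hsm4 : ContMDiffAt (𝓡 n) (𝓡 l) ∞
        (fun z : X => (e.symm (extChartAt (𝓡 n) x₀ (h₁⁻¹ • z))).1) (h₁ • σ v₁) :=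
      ContMDiffAt.comp _ contDiff_fst.contMDiff.contMDiffAt hsm3
    have hsm5 : ContMDiffAt (𝓡 n) (𝓡 m) ∞
        (fun z : X => (e.symm (extChartAt (𝓡 n) x₀ (h₁⁻¹ • z))).2) (h₁ • σ v₁) :=
      ContMDiffAt.comp _ contDiff_snd.contMDiff.contMDiffAt hsm3
    have hsm6 : ContMDiffAt (𝓡 n) (𝓡 l) ∞
        (fun z : X => (extChartAt (𝓡 l) (1 : H)).symm
          (e.symm (extChartAt (𝓡 n) x₀ (h₁⁻¹ • z))).1) (h₁ • σ v₁) := by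
      refine ContMDiffAt.comp _ ((contMDiffOn_extChartAt_symm (I := 𝓡 l) (n := ∞)
        (1 : H)).contMDiffAt ((isOpen_extChartAt_target 1).mem_nhds ?_)) hsm4
      rw [hval]
      exact h3
    refine ⟨fun z => (h₁ * (extChartAt (𝓡 l) (1 : H)).symm
      (e.symm (extChartAt (𝓡 n) x₀ (h₁⁻¹ • z))).1, (e.symm (extChartAt (𝓡 n) x₀ (h₁⁻¹ • z))).2),
      (contMDiffAt_const.mul hsm6).prodMk hsm5, ?_⟩
    have e1 : ∀ᶠ z in 𝓝 (h₁ • σ v₁), (e.symm (extChartAt (𝓡 n) x₀ (h₁⁻¹ • z))).2 ∈ V :=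
      hsm5.continuousAt.preimage_mem_nhds (hV.mem_nhds (by rw [hval]; exact hv₁))
    have e2 : ∀ᶠ z in 𝓝 (h₁ • σ v₁), extChartAt (𝓡 n) x₀ (h₁⁻¹ • z) ∈ e.target :=
      hsm2.continuousAt.preimage_mem_nhds (e.open_target.mem_nhds htar)
    have e3 : ∀ᶠ z in 𝓝 (h₁ • σ v₁), h₁⁻¹ • z ∈ (extChartAt (𝓡 n) x₀).source :=
      hsm1.continuousAt.preimage_mem_nhds ((isOpen_extChartAt_source x₀).mem_nhds
        (by simp only [hx1]; exact h5))
    filter_upwards [e1, e2, e3] with z hz1 hz2 hz3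
    refine ⟨hz1, ?_⟩
    have hs := e.map_target hz2
    obtain ⟨k1, k2, k3, k4⟩ := he _ hs
    rw [e.right_inv hz2] at k4
    have := (extChartAt (𝓡 n) x₀).injOn hz3 k3 k4
    rw [mul_smul, ← this, smul_inv_smul]
  have hopen : IsOpen O := by
    rw [isOpen_iff_mem_nhds]
    intro x hx
    obtain ⟨f, -, hf⟩ := hloc x hx
    filter_upwards [hf] with z hz
    exact ⟨f z, hz⟩
  have hdecsm : ContMDiffOn (𝓡 n) ((𝓡 l).prod (𝓡 m)) ∞ dec O := by
    intro x hx
    obtain ⟨f, hfs, hf⟩ := hloc x hx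
    refine ContMDiffAt.contMDiffWithinAt (hfs.congr_of_eventuallyEq ?_)
    filter_upwards [hf] with z hz
    conv_lhs => rw [← hz.2]
    exact hdec' _ _ hz.1
  exact ⟨{
    domain := O
    isOpen_domain := hopen
    target := V
    isOpen_target := hV
    sec := σ
    contMDiffOn_sec := hσ.mono hVV₀
    coord := fun x => (dec x).2
    contMDiffOn_coord := contMDiff_snd.comp_contMDiffOn hdecsm
    trans := fun x => (dec x).1
    contMDiffOn_trans := contMDiff_fst.comp_contMDiffOn hdecsm
    smul_sec_mem := fun h v hv => ⟨(h, v), hv, rfl⟩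
    trans_smul_sec := fun h v hv => by rw [hdec' h v hv]
    coord_smul_sec := fun h v hv => by rw [hdec' h v hv]
    coord_mem := fun x hx => (hdec x hx).1
    smul_sec_coord := fun x hx => (hdec x hx).2 }, ⟨(1, 0), h0V, by simp [hσ0]⟩⟩

end Slice

/-! ### Manifold structures given by families of charts -/

section Charts

variable {d : ℕ} {Y : Type*} [TopologicalSpace Y]

/-- The charted space structure whose atlas is a given set of charts covering the space. -/
abbrev chartedSpaceOfCharts (P : Set (OpenPartialHomeomorph Y (EuclideanSpace ℝ (Fin d))))
    (cover : ∀ y, ∃ c ∈ P, y ∈ c.source) : ChartedSpace (EuclideanSpace ℝ (Fin d)) Y where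
  atlas := P
  chartAt y := (cover y).choose
  mem_chart_source y := (cover y).choose_spec.2
  chart_mem_atlas y := (cover y).choose_spec.1

theorem isManifold_chartedSpaceOfCharts
    {P : Set (OpenPartialHomeomorph Y (EuclideanSpace ℝ (Fin d)))}
    (cover : ∀ y, ∃ c ∈ P, y ∈ c.source)
    (compat : ∀ c ∈ P, ∀ c' ∈ P, ContDiffOn ℝ ∞ (c' ∘ c.symm) (c.target ∩ c.symm ⁻¹' c'.source)) :
    letI := chartedSpaceOfCharts P cover
    IsManifold (𝓡 d) ∞ Y := by
  let := chartedSpaceOfCharts P cover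
  refine isManifold_of_contDiffOn _ _ _ fun c c' hc hc' => ?_
  refine (compat c hc c' hc').congr_mono (fun x _ => rfl) ?_
  rintro x ⟨hx, -⟩
  rw [Set.mem_preimage, OpenPartialHomeomorph.trans_source] at hx
  exact hx

end Charts

/-! ### Local trivializations of smooth principal bundles -/

/-- A local trivialization, over an open set `base`, of a smooth principal bundle `π` with structure
group `K` acting by `act`: a smooth section of `π` and the smooth map that sends a point of the
total space to the group element that carries the section to it. -/
structure LocalTriv (k d m : ℕ) {K E B : Type*} [TopologicalSpace K]
    [ChartedSpace (EuclideanSpace ℝ (Fin k)) K] [TopologicalSpace E]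
    [ChartedSpace (EuclideanSpace ℝ (Fin d)) E] [TopologicalSpace B]
    [ChartedSpace (EuclideanSpace ℝ (Fin m)) B] (act : K → E → E) (π : E → B) where
  base : Set B
  isOpen_base : IsOpen base
  sec : B → E
  trans : E → K
  contMDiffOn_sec : ContMDiffOn (𝓡 m) (𝓡 d) ∞ sec base
  contMDiffOn_trans : ContMDiffOn (𝓡 d) (𝓡 k) ∞ trans (π ⁻¹' base)
  proj_sec : ∀ b ∈ base, π (sec b) = b
  trans_act_sec : ∀ e, π e ∈ base → act (trans e) (sec (π e)) = e
  trans_smul_sec : ∀ g, ∀ b ∈ base, trans (act g (sec b)) = g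

/-! ### Quotient manifolds -/

section Quotient

variable {l n m : ℕ} {H X Q : Type*} [Group H] [TopologicalSpace H]
  [ChartedSpace (EuclideanSpace ℝ (Fin l)) H] [LieGroup (𝓡 l) ∞ H]
  [TopologicalSpace X] [ChartedSpace (EuclideanSpace ℝ (Fin n)) X] [IsManifold (𝓡 n) ∞ X]
  [MulAction H X] [TopologicalSpace Q] {q : X → Q}

namespace Slice

variable (S : Slice l n m H X)

omit [LieGroup (𝓡 l) ∞ H] [IsManifold (𝓡 n) ∞ X]

theorem smul_mem {x : X} (hx : x ∈ S.domain) (h : H) : h • x ∈ S.domain := by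
  rw [← S.smul_sec_coord x hx, smul_smul]
  exact S.smul_sec_mem _ _ (S.coord_mem x hx)

theorem coord_smul {x : X} (hx : x ∈ S.domain) (h : H) : S.coord (h • x) = S.coord x := by
  conv_lhs => rw [← S.smul_sec_coord x hx, smul_smul]
  exact S.coord_smul_sec _ _ (S.coord_mem x hx)

theorem sec_mem {v : EuclideanSpace ℝ (Fin m)} (hv : v ∈ S.target) : S.sec v ∈ S.domain := by
  have := S.smul_sec_mem 1 v hv
  rwa [one_smul] at this

theorem coord_sec {v : EuclideanSpace ℝ (Fin m)} (hv : v ∈ S.target) : S.coord (S.sec v) = v := by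
  have := S.coord_smul_sec 1 v hv
  rwa [one_smul] at this

variable (hq : IsOpenQuotientMap q) (hqH : ∀ x y, q x = q y ↔ ∃ h : H, h • y = x)

omit [TopologicalSpace Q] in
include hqH in
theorem mem_domain_of_eq {x y : X} (hxy : q x = q y) (hy : y ∈ S.domain) : x ∈ S.domain := by
  obtain ⟨h, rfl⟩ := (hqH x y).1 hxy
  exact S.smul_mem hy h

omit [TopologicalSpace Q] in
include hqH in
theorem coord_eq_of_eq {x y : X} (hxy : q x = q y) (hy : y ∈ S.domain) :
    S.coord x = S.coord y := by
  obtain ⟨h, rfl⟩ := (hqH x y).1 hxy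
  exact S.coord_smul hy h

omit [TopologicalSpace Q] in
include hqH in
theorem proj_sec_coord {x : X} (hx : x ∈ S.domain) : q (S.sec (S.coord x)) = q x :=
  ((hqH _ _).2 ⟨S.trans x, S.smul_sec_coord x hx⟩).symm

/-- The chart of the orbit space given by a slice. -/
def chart : OpenPartialHomeomorph Q (EuclideanSpace ℝ (Fin m)) where
  -- Any preimage of `y` may be used, because `coord` is constant on orbits; continuity is
  -- accordingly tested after composing with `q`.
  toFun y := S.coord (Function.surjInv hq.surjective y)
  invFun v := q (S.sec v)
  source := q '' S.domain
  target := S.target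
  map_source' := by
    rintro _ ⟨x, hx, rfl⟩
    exact S.coord_mem _ (S.mem_domain_of_eq hqH (Function.surjInv_eq hq.surjective (q x)) hx)
  map_target' v hv := ⟨_, S.sec_mem hv, rfl⟩
  left_inv' := by
    rintro _ ⟨x, hx, rfl⟩
    have h1 := Function.surjInv_eq hq.surjective (q x)
    rw [S.proj_sec_coord hqH (S.mem_domain_of_eq hqH h1 hx), h1]
  right_inv' v hv := by
    rw [S.coord_eq_of_eq hqH (Function.surjInv_eq hq.surjective _) (S.sec_mem hv), S.coord_sec hv]
  open_source := hq.isOpenMap _ S.isOpen_domain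
  open_target := S.isOpen_target
  continuousOn_toFun := by
    rintro _ ⟨x, hx, rfl⟩
    refine ContinuousAt.continuousWithinAt ?_
    rw [← hq.continuousAt_comp_iff]
    refine (S.contMDiffOn_coord.continuousOn.continuousAt
      (S.isOpen_domain.mem_nhds hx)).congr ?_
    filter_upwards [S.isOpen_domain.mem_nhds hx] with z hz
    exact (S.coord_eq_of_eq hqH (Function.surjInv_eq hq.surjective (q z)) hz).symm
  continuousOn_invFun := hq.continuous.comp_continuousOn S.contMDiffOn_sec.continuousOn

theorem chart_proj {x : X} (hx : x ∈ S.domain) : S.chart hq hqH (q x) = S.coord x :=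
  S.coord_eq_of_eq hqH (Function.surjInv_eq hq.surjective (q x)) hx

end Slice

variable (l n m H q) in
/-- The charts of an orbit space that are compatible with the smooth structure of the manifold. -/
def quotientCharts : Set (OpenPartialHomeomorph Q (EuclideanSpace ℝ (Fin m))) :=
  {c | ContMDiffOn (𝓡 n) (𝓡 m) ∞ (c ∘ q) (q ⁻¹' c.source) ∧
    ∃ σ : EuclideanSpace ℝ (Fin m) → X, ContMDiffOn (𝓡 m) (𝓡 n) ∞ σ c.target ∧
      ∀ v ∈ c.target, q (σ v) = c.symm v}

omit [LieGroup (𝓡 l) ∞ H] [IsManifold (𝓡 n) ∞ X] in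
theorem Slice.chart_mem (S : Slice l n m H X) (hq : IsOpenQuotientMap q)
    (hqH : ∀ x y, q x = q y ↔ ∃ h : H, h • y = x) :
    S.chart hq hqH ∈ quotientCharts n m q := by
  refine ⟨?_, S.sec, S.contMDiffOn_sec, fun v hv => rfl⟩
  have hsub : q ⁻¹' (S.chart hq hqH).source ⊆ S.domain := by
    rintro x ⟨y, hy, hxy⟩
    exact S.mem_domain_of_eq hqH hxy.symm hy
  exact (S.contMDiffOn_coord.mono hsub).congr fun x hx => S.chart_proj hq hqH (hsub hx)

omit [IsManifold (𝓡 n) ∞ X] in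
-- The transition map factors as `(c' ∘ q) ∘ σ`, with `σ` the smooth lift of the inverse of the
-- first chart; both factors are smooth by the definition of `quotientCharts`.
theorem quotientCharts_compat {c c' : OpenPartialHomeomorph Q (EuclideanSpace ℝ (Fin m))}
    (hc : c ∈ quotientCharts n m q) (hc' : c' ∈ quotientCharts n m q) :
    ContDiffOn ℝ ∞ (c' ∘ c.symm) (c.target ∩ c.symm ⁻¹' c'.source) := by
  obtain ⟨-, σ, hσ, hqσ⟩ := hc
  rw [← contMDiffOn_iff_contDiffOn]
  refine (hc'.1.comp (hσ.mono Set.inter_subset_left) ?_).congr ?_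
  · intro v hv
    rw [Set.mem_preimage, Set.mem_preimage, hqσ v hv.1]
    exact hv.2
  · intro v hv
    simp only [Function.comp_apply, hqσ v hv.1]

variable [ContMDiffSMul (𝓡 l) (𝓡 n) ∞ H X]

/-- The quotient manifold theorem for a free and proper smooth action. -/
theorem exists_quotient_manifold [SecondCountableTopology X]
    (hfree : ∀ (h : H) (x : X), h • x = x → h = 1)
    (hprop : IsProperMap fun p : H × X => (p.1 • p.2, p.2)) (hq : IsOpenQuotientMap q)
    (hqH : ∀ x y, q x = q y ↔ ∃ h : H, h • y = x) :
    ∃ (m : ℕ) (_ : ChartedSpace (EuclideanSpace ℝ (Fin m)) Q),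
      IsManifold (𝓡 m) ∞ Q ∧ T2Space Q ∧ SecondCountableTopology Q ∧
      Manifold.IsSubmersion (𝓡 n) (𝓡 m) ∞ q ∧
      ∀ y : Q, ∃ t : LocalTriv l n m (fun (h : H) (x : X) => h • x) q, y ∈ t.base := by
  -- The dimension `m` is dictated by any point of `X`. If `X` is empty, no value is forced and `0`
  -- is taken, which is why `l + m = n` is asserted only in the presence of a point.
  have hslice : ∃ m : ℕ, (X → l + m = n) ∧ ∀ x₀ : X, ∃ S : Slice l n m H X, x₀ ∈ S.domain := by
    by_cases hX : Nonempty X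
    · obtain ⟨x⟩ := hX
      obtain ⟨m, hm⟩ := Nat.exists_eq_add_of_le (dim_le_of_free (l := l) (n := n) hfree x)
      exact ⟨m, fun _ => hm.symm, exists_slice hfree hprop hm.symm⟩
    · exact ⟨0, fun x => (hX ⟨x⟩).elim, fun x => (hX ⟨x⟩).elim⟩
  obtain ⟨m, hdim, hslice⟩ := hslice
  have cover : ∀ y : Q, ∃ c ∈ quotientCharts n m q, y ∈ c.source := by
    intro y
    obtain ⟨x, rfl⟩ := hq.surjective y
    obtain ⟨S, hS⟩ := hslice x
    exact ⟨S.chart hq hqH, S.chart_mem hq hqH, x, hS, rfl⟩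
  let := chartedSpaceOfCharts _ cover
  have hman : IsManifold (𝓡 m) ∞ Q := isManifold_chartedSpaceOfCharts cover
    fun c hc c' hc' => quotientCharts_compat hc hc'
  have hmax : ∀ c ∈ quotientCharts n m q, c ∈ IsManifold.maximalAtlas (𝓡 m) ∞ Q := fun c hc =>
    IsManifold.subset_maximalAtlas hc
  refine ⟨m, inferInstance, hman, ?_, ?_, ?_, ?_⟩
  -- The orbit relation is the range of the proper, hence closed, map `(h, x) ↦ (h • x, x)`. For an
  -- open quotient map a closed relation gives a Hausdorff quotient.
  · have hcl : IsClosed {p : X × X | q p.1 = q p.2} := by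
      have := hprop.isClosedMap.isClosed_range
      convert this using 1
      ext ⟨x, y⟩
      simp only [Set.mem_ofPred_eq, Set.mem_range, Prod.exists, Prod.mk.injEq, hqH]
      exact ⟨fun ⟨h, hh⟩ => ⟨h, y, hh, rfl⟩, fun ⟨h, z, hh, hz⟩ => ⟨h, hz ▸ hh⟩⟩
    rw [t2_iff_isClosed_diagonal, ← (hq.prodMap hq).isQuotientMap.isClosed_preimage]
    exact hcl
  · exact hq.isQuotientMap.secondCountableTopology hq.isOpenMap
  · refine ⟨EuclideanSpace ℝ (Fin l), inferInstance, inferInstance, fun x₀ => ?_⟩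
    obtain ⟨S, hS⟩ := hslice x₀
    let A : EuclideanSpace ℝ (Fin n) ≃L[ℝ] EuclideanSpace ℝ (Fin m) × EuclideanSpace ℝ (Fin l) :=
      ContinuousLinearEquiv.ofFinrankEq (by simp [← hdim x₀, add_comm])
    let κ := chartAt (EuclideanSpace ℝ (Fin l)) (S.trans x₀)
    have hκ := contMDiffOn_chart (I := 𝓡 l) (n := ∞) (x := S.trans x₀)
    have hκ' := contMDiffOn_chart_symm (I := 𝓡 l) (n := ∞) (x := S.trans x₀)
    have hsm1 : ContMDiffOn (𝓡 n) (𝓡 n) ∞ (fun x => A.symm (S.coord x, κ (S.trans x)))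
        (S.domain ∩ S.trans ⁻¹' κ.source) := by
      have h1 := hκ.comp (S.contMDiffOn_trans.mono Set.inter_subset_left) fun x hx => hx.2
      have h2 := S.contMDiffOn_coord.mono (Set.inter_subset_left (t := S.trans ⁻¹' κ.source))
      exact A.symm.contDiff.contMDiff.comp_contMDiffOn (h2.prodMk_space h1)
    have hsm2 : ContMDiffOn (𝓡 n) (𝓡 n) ∞ (fun w => κ.symm (A w).2 • S.sec (A w).1)
        (A ⁻¹' (S.target ×ˢ κ.target)) := by
      have hA1 : ContMDiff (𝓡 n) (𝓡 m) ∞ fun w => (A w).1 :=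
        (contDiff_fst.comp A.contDiff).contMDiff
      have hA2 : ContMDiff (𝓡 n) (𝓡 l) ∞ fun w => (A w).2 :=
        (contDiff_snd.comp A.contDiff).contMDiff
      have h1 := hκ'.comp hA2.contMDiffOn (s := A ⁻¹' (S.target ×ˢ κ.target)) fun x hx => hx.2
      have h2 := S.contMDiffOn_sec.comp hA1.contMDiffOn (s := A ⁻¹' (S.target ×ˢ κ.target))
        fun x hx => hx.1
      exact h1.smul h2
    -- The slice identifies a neighbourhood of `x₀` with transversal times group; in this chart and
    -- the slice chart of `Q` the projection is literally the first projection.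
    let φ : OpenPartialHomeomorph X (EuclideanSpace ℝ (Fin n)) :=
      { toFun := fun x => A.symm (S.coord x, κ (S.trans x))
        invFun := fun w => κ.symm (A w).2 • S.sec (A w).1
        source := S.domain ∩ S.trans ⁻¹' κ.source
        target := A ⁻¹' (S.target ×ˢ κ.target)
        map_source' := fun x hx => by
          rw [Set.mem_preimage, A.apply_symm_apply]
          exact ⟨S.coord_mem x hx.1, κ.map_source hx.2⟩
        map_target' := fun w hw => by
          refine ⟨S.smul_sec_mem _ _ hw.1, ?_⟩
          rw [Set.mem_preimage, S.trans_smul_sec _ _ hw.1]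
          exact κ.map_target hw.2
        left_inv' := fun x hx => by
          simp only [A.apply_symm_apply, κ.left_inv hx.2]
          exact S.smul_sec_coord x hx.1
        right_inv' := fun w hw => by
          simp only [S.trans_smul_sec _ _ hw.1, S.coord_smul_sec _ _ hw.1, κ.right_inv hw.2]
          exact A.symm_apply_apply w
        open_source := S.contMDiffOn_trans.continuousOn.isOpen_inter_preimage S.isOpen_domain
          κ.open_source
        open_target := (S.isOpen_target.prod κ.open_target).preimage A.continuous
        continuousOn_toFun := hsm1.continuousOn
        continuousOn_invFun := hsm2.continuousOn }
    refine Manifold.IsSubmersionAtOfComplement.mk_of_charts A φ (S.chart hq hqH)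
      ⟨hS, mem_chart_source _ _⟩ ⟨x₀, hS, rfl⟩
      (φ.mem_maximalAtlas_of_contMDiffOn hsm1 hsm2) (hmax _ (S.chart_mem hq hqH))
      (fun x hx => ⟨x, hx.1, rfl⟩) ?_
    intro w hw
    have hw' : w ∈ φ.target := by simpa using hw
    have h1 : S.chart hq hqH (q (φ.symm w)) = S.coord (φ.symm w) :=
      S.chart_proj hq hqH (φ.map_target hw').1
    have h2 : S.coord (φ.symm w) = (A w).1 := S.coord_smul_sec _ _ hw'.1
    simpa using h1.trans h2
  · intro y
    obtain ⟨x, rfl⟩ := hq.surjective y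
    obtain ⟨S, hS⟩ := hslice x
    have hmem : ∀ z, q z ∈ (S.chart hq hqH).source → z ∈ S.domain := by
      rintro z ⟨w, hw, hzw⟩
      exact S.mem_domain_of_eq hqH hzw.symm hw
    refine ⟨{
      base := (S.chart hq hqH).source
      isOpen_base := (S.chart hq hqH).open_source
      sec := fun y => S.sec (S.chart hq hqH y)
      trans := S.trans
      contMDiffOn_sec := S.contMDiffOn_sec.comp
        (contMDiffOn_of_mem_maximalAtlas (hmax _ (S.chart_mem hq hqH)))
        fun y hy => (S.chart hq hqH).map_source hy
      contMDiffOn_trans := S.contMDiffOn_trans.mono fun z hz => hmem z hz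
      proj_sec := fun y hy => (S.chart hq hqH).left_inv hy
      trans_act_sec := fun z hz => by
        simp only [S.chart_proj hq hqH (hmem z hz)]
        exact S.smul_sec_coord z (hmem z hz)
      trans_smul_sec := fun h y hy => S.trans_smul_sec _ _ ((S.chart hq hqH).map_source hy) },
      x, hS, rfl⟩

end Quotient

/-! ### Smooth principal bundles through local trivializations -/

/-- A smooth principal bundle `π : E → B` whose structure group `K` acts by `act`, presented by
local sections and their transition maps. -/
structure IsPrincipal (k d m : ℕ) {K E B : Type*} [Group K] [TopologicalSpace K]
    [ChartedSpace (EuclideanSpace ℝ (Fin k)) K] [TopologicalSpace E]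
    [ChartedSpace (EuclideanSpace ℝ (Fin d)) E] [TopologicalSpace B]
    [ChartedSpace (EuclideanSpace ℝ (Fin m)) B] (act : K → E → E) (π : E → B) : Prop where
  contMDiff_act : ContMDiff ((𝓡 k).prod (𝓡 d)) (𝓡 d) ∞ fun p : K × E => act p.1 p.2
  contMDiff_proj : ContMDiff (𝓡 d) (𝓡 m) ∞ π
  act_mul : ∀ g h e, act (g * h) e = act g (act h e)
  proj_act : ∀ g e, π (act g e) = π e
  exists_localTriv : ∀ b, ∃ t : LocalTriv k d m act π, b ∈ t.base

section Principal

variable {k d m : ℕ} {K E B : Type*} [Group K] [TopologicalSpace K]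
  [ChartedSpace (EuclideanSpace ℝ (Fin k)) K] [TopologicalSpace E]
  [ChartedSpace (EuclideanSpace ℝ (Fin d)) E] [TopologicalSpace B]
  [ChartedSpace (EuclideanSpace ℝ (Fin m)) B] {act : K → E → E} {π : E → B}

variable {ET HT : Type*} [NormedAddCommGroup ET] [NormedSpace ℝ ET] [TopologicalSpace HT]
  {I : ModelWithCorners ℝ ET HT} {T : Type*} [TopologicalSpace T] [ChartedSpace HT T]

namespace IsPrincipal

variable (P : IsPrincipal k d m act π)

include P

theorem trans_act {t : LocalTriv k d m act π} (g : K) {e : E} (he : π e ∈ t.base) :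
    t.trans (act g e) = g * t.trans e := by
  conv_lhs => rw [← t.trans_act_sec e he, ← P.act_mul]
  exact t.trans_smul_sec _ _ he

/-- The unit law is not among the axioms of `IsPrincipal`: it follows from multiplicativity because
every point is the translate of a value of a local section. -/
theorem act_one (e : E) : act 1 e = e := by
  obtain ⟨t, ht⟩ := P.exists_localTriv (π e)
  rw [← t.trans_act_sec e ht, ← P.act_mul, one_mul]

theorem act_injective {g h : K} {e : E} (hgh : act g e = act h e) : g = h := by
  obtain ⟨t, ht⟩ := P.exists_localTriv (π e)
  have := congrArg t.trans hgh
  rw [P.trans_act g ht, P.trans_act h ht] at this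
  exact mul_right_cancel this

theorem exists_act_eq {e e' : E} (h : π e = π e') : ∃ g, act g e' = e := by
  obtain ⟨t, ht⟩ := P.exists_localTriv (π e)
  refine ⟨t.trans e * (t.trans e')⁻¹, ?_⟩
  have ht' : π e' ∈ t.base := h ▸ ht
  have h1 := congrArg (act (t.trans e')⁻¹) (t.trans_act_sec e' ht')
  rw [← P.act_mul, inv_mul_cancel, P.act_one] at h1
  rw [P.act_mul, ← h1, ← h]
  exact t.trans_act_sec e ht

theorem surjective : Function.Surjective π := fun b => by
  obtain ⟨t, ht⟩ := P.exists_localTriv b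
  exact ⟨_, t.proj_sec b ht⟩

end IsPrincipal

open Classical in
/-- The group element that carries `e'` to `e`, if there is one. -/
def divAct (act : K → E → E) (e e' : E) : K := if h : ∃ g, act g e' = e then h.choose else 1

namespace IsPrincipal

variable (P : IsPrincipal k d m act π)

include P

theorem divAct_act {e e' : E} (h : π e = π e') : act (divAct act e e') e' = e := by
  have h' := P.exists_act_eq h
  rw [divAct, dif_pos h']
  exact h'.choose_spec

theorem divAct_eq {e e' : E} {g : K} (h : act g e' = e) : divAct act e e' = g :=
  P.act_injective ((P.divAct_act (by rw [← h, P.proj_act])).trans h.symm)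

theorem contMDiffAt_act {f : T → K} {g : T → E} {x : T} (hf : ContMDiffAt I (𝓡 k) ∞ f x)
    (hg : ContMDiffAt I (𝓡 d) ∞ g x) : ContMDiffAt I (𝓡 d) ∞ (fun t => act (f t) (g t)) x :=
  P.contMDiff_act.contMDiffAt.comp x (hf.prodMk hg)

/-- In a trivialization the element is the coordinate of `u` times the inverse of the coordinate of
`v`. Later choices of lifts made pointwise are proved smooth by expressing them through this element
and a smooth local section. -/
theorem contMDiffAt_divAct [LieGroup (𝓡 k) ∞ K] {u v : T → E} {x : T}
    (hu : ContMDiffAt I (𝓡 d) ∞ u x) (hv : ContMDiffAt I (𝓡 d) ∞ v x)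
    (huv : ∀ᶠ t in 𝓝 x, π (u t) = π (v t)) :
    ContMDiffAt I (𝓡 k) ∞ (fun t => divAct act (u t) (v t)) x := by
  obtain ⟨t, ht⟩ := P.exists_localTriv (π (u x))
  have hux := huv.self_of_nhds
  have hopen : IsOpen (π ⁻¹' t.base) := t.isOpen_base.preimage P.contMDiff_proj.continuous
  have h1 : ContMDiffAt I (𝓡 k) ∞ (fun z => t.trans (u z)) x :=
    (t.contMDiffOn_trans.contMDiffAt (hopen.mem_nhds ht)).comp x hu
  have h2 : ContMDiffAt I (𝓡 k) ∞ (fun z => t.trans (v z)) x :=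
    (t.contMDiffOn_trans.contMDiffAt (hopen.mem_nhds (by
      rw [Set.mem_preimage, ← hux]; exact ht))).comp x hv
  refine (h1.mul h2.inv).congr_of_eventuallyEq ?_
  filter_upwards [huv, hu.continuousAt.preimage_mem_nhds (hopen.mem_nhds ht)] with z hz hzt
  have hzt' : π (v z) ∈ t.base := hz ▸ hzt
  have h3 := congrArg t.trans (P.divAct_act hz)
  rw [P.trans_act _ hzt'] at h3
  exact eq_mul_inv_of_mul_eq h3

/-- A smooth local section through a given point. -/
theorem exists_section (e : E) :
    ∃ s : B → E, ContMDiffAt (𝓡 m) (𝓡 d) ∞ s (π e) ∧ s (π e) = e ∧ ∀ᶠ b in 𝓝 (π e), π (s b) = b := by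
  obtain ⟨t, ht⟩ := P.exists_localTriv (π e)
  refine ⟨fun b => act (t.trans e) (t.sec b), P.contMDiffAt_act contMDiffAt_const
    (t.contMDiffOn_sec.contMDiffAt (t.isOpen_base.mem_nhds ht)), t.trans_act_sec e ht, ?_⟩
  filter_upwards [t.isOpen_base.mem_nhds ht] with b hb
  rw [P.proj_act, t.proj_sec b hb]

/-- A map from the base is smooth at a point if its composite with the projection is smooth at some
point above it. -/
theorem contMDiffAt_of_comp_proj {f : B → T} {e : E} (h : ContMDiffAt (𝓡 d) I ∞ (f ∘ π) e) :
    ContMDiffAt (𝓡 m) I ∞ f (π e) := by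
  obtain ⟨s, hs, hse, hπs⟩ := P.exists_section e
  have h1 : ContMDiffAt (𝓡 m) I ∞ ((f ∘ π) ∘ s) (π e) :=
    ContMDiffAt.comp (π e) (by rw [hse]; exact h) hs
  refine h1.congr_of_eventuallyEq ?_
  filter_upwards [hπs] with b hb
  simp only [Function.comp_apply, hb]

theorem contMDiff_of_comp_proj {f : B → T} (h : ContMDiff (𝓡 d) I ∞ (f ∘ π)) :
    ContMDiff (𝓡 m) I ∞ f := fun b => by
  obtain ⟨e, rfl⟩ := P.surjective b
  exact P.contMDiffAt_of_comp_proj h.contMDiffAt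

end IsPrincipal

/-! ### Equivariant maps of principal bundles as Cartesian squares. -/

section Cartesian

variable {d' m' : ℕ} {E' B' : Type*} [TopologicalSpace E']
  [ChartedSpace (EuclideanSpace ℝ (Fin d')) E'] [TopologicalSpace B']
  [ChartedSpace (EuclideanSpace ℝ (Fin m')) B'] {act' : K → E' → E'} {π' : E' → B'}

/-- A morphism of principal bundles is Cartesian. -/
theorem IsPrincipal.exists_lift [LieGroup (𝓡 k) ∞ K] (P : IsPrincipal k d m act π)
    (P' : IsPrincipal k d' m' act' π') {F : E → E'} {f : B → B'}
    (hF : ContMDiff (𝓡 d) (𝓡 d') ∞ F) (hFact : ∀ g e, F (act g e) = act' g (F e))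
    (hFf : ∀ e, π' (F e) = f (π e)) {u : T → E'} {v : T → B} (hu : ContMDiff I (𝓡 d') ∞ u)
    (hv : ContMDiff I (𝓡 m) ∞ v) (huv : ∀ t, π' (u t) = f (v t)) :
    ∃ w : T → E, ContMDiff I (𝓡 d) ∞ w ∧ (∀ t, F (w t) = u t) ∧ ∀ t, π (w t) = v t := by
  have hex : ∀ t, ∃ e, F e = u t ∧ π e = v t := by
    intro t
    obtain ⟨e, he⟩ := P.surjective (v t)
    obtain ⟨g, hg⟩ := P'.exists_act_eq (e := u t) (e' := F e) (by rw [hFf, he, huv])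
    exact ⟨act g e, by rw [hFact, hg], by rw [P.proj_act, he]⟩
  choose w hw1 hw2 using hex
  refine ⟨w, fun t => ?_, hw1, hw2⟩
  -- The lift is chosen pointwise; near `t` it equals `s ∘ v` translated by the element that carries
  -- `F (s (v z))` to `u z`, and this expression is smooth.
  obtain ⟨s, hs, hst, hπs⟩ := P.exists_section (w t)
  rw [hw2 t] at hs hst hπs
  have h1 : ContMDiffAt I (𝓡 d) ∞ (fun z => s (v z)) t := ContMDiffAt.comp t hs hv.contMDiffAt
  have hπ1 : ∀ᶠ z in 𝓝 t, π (s (v z)) = v z := hv.continuous.continuousAt.eventually hπs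
  have h2 : ContMDiffAt I (𝓡 k) ∞ (fun z => divAct act' (u z) (F (s (v z)))) t := by
    refine P'.contMDiffAt_divAct hu.contMDiffAt (hF.contMDiffAt.comp t h1) ?_
    filter_upwards [hπ1] with z hz
    rw [hFf, hz, huv]
  refine (P.contMDiffAt_act h2 h1).congr_of_eventuallyEq ?_
  filter_upwards [hπ1] with z hz
  obtain ⟨g, hg⟩ := P.exists_act_eq (e := w z) (e' := s (v z)) (by rw [hw2, hz])
  have : act' g (F (s (v z))) = u z := by rw [← hFact, hg, hw1]
  rw [P'.divAct_eq this, hg]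

theorem IsPrincipal.lift_unique (P : IsPrincipal k d m act π)
    (P' : IsPrincipal k d' m' act' π') {F : E → E'}
    (hFact : ∀ g e, F (act g e) = act' g (F e)) {e₁ e₂ : E}
    (hF : F e₁ = F e₂) (hπ : π e₁ = π e₂) : e₁ = e₂ := by
  obtain ⟨g, rfl⟩ := P.exists_act_eq hπ
  rw [hFact] at hF
  have : g = 1 := P'.act_injective (hF.trans (P'.act_one _).symm)
  rw [this, P.act_one]

end Cartesian

end Principal

section IsSmoothPrincipalBundle

variable {k d m : ℕ} {G E B : Type u} [Group G] [TopologicalSpace G]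
  [ChartedSpace (EuclideanSpace ℝ (Fin k)) G] [TopologicalSpace E]
  [ChartedSpace (EuclideanSpace ℝ (Fin d)) E] [TopologicalSpace B]
  [ChartedSpace (EuclideanSpace ℝ (Fin m)) B] [MulAction G E] {π : E → B}

theorem IsSmoothPrincipalBundle.isPrincipal (h : IsSmoothPrincipalBundle k d m G π)
    (hπ : ContMDiff (𝓡 d) (𝓡 m) ∞ π) : IsPrincipal k d m (fun (g : G) (e : E) => g • e) π where
  contMDiff_act := h.contMDiffSMul.contMDiff_smul
  contMDiff_proj := hπ
  act_mul := mul_smul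
  proj_act := h.proj_smul
  exists_localTriv b := by
    obtain ⟨t, hb, ht, ht', hG⟩ := h.locally_trivial b
    have hsrc : ∀ e, e ∈ t.source ↔ π e ∈ t.baseSet := fun e => t.mem_source
    have htar : ∀ (b : B) (g : G), b ∈ t.baseSet → (b, g) ∈ t.target := fun b g hb =>
      t.mem_target.2 hb
    have hproj : ∀ c ∈ t.baseSet, π (t.toOpenPartialHomeomorph.symm (c, 1)) = c := fun c hc =>
      t.proj_symm_apply (htar c 1 hc)
    have hval : ∀ c ∈ t.baseSet, (t (t.toOpenPartialHomeomorph.symm (c, 1))).2 = 1 := fun c hc => by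
      rw [t.apply_symm_apply (htar c 1 hc)]
    refine ⟨{
      base := t.baseSet
      isOpen_base := t.open_baseSet
      sec := fun c => t.toOpenPartialHomeomorph.symm (c, 1)
      trans := fun e => (t e).2
      contMDiffOn_sec := ht'.comp (contMDiff_id.prodMk contMDiff_const).contMDiffOn
        fun c hc => htar c 1 hc
      contMDiffOn_trans := by
        refine contMDiff_snd.comp_contMDiffOn (ht.mono fun e he => (hsrc e).2 he)
      proj_sec := hproj
      trans_act_sec := fun e he => ?_
      trans_smul_sec := fun g c hc => ?_ }, hb⟩
    · have h1 : π ((t e).2 • t.toOpenPartialHomeomorph.symm (π e, 1)) = π e := by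
        rw [h.proj_smul, hproj _ he]
      have h2 : (t e).2 • t.toOpenPartialHomeomorph.symm (π e, 1) ∈ t.source := by
        rw [hsrc, h1]; exact he
      refine t.injOn h2 ((hsrc e).2 he) (Prod.ext ?_ ?_)
      · change (t _).1 = (t e).1
        rw [t.coe_fst h2, t.coe_fst ((hsrc e).2 he), h1]
      · change (t _).2 = (t e).2
        rw [hG _ _ (by rw [hproj _ he]; exact he), hval _ he, mul_one]
    · rw [hG _ _ (by rw [hproj _ hc]; exact hc), hval _ hc, mul_one]

theorem IsPrincipal.isSmoothPrincipalBundle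
    (P : IsPrincipal k d m (fun (g : G) (e : E) => g • e) π) :
    IsSmoothPrincipalBundle k d m G π where
  contMDiffSMul := ⟨P.contMDiff_act⟩
  proj_smul := P.proj_act
  locally_trivial b := by
    obtain ⟨t, hb⟩ := P.exists_localTriv b
    have hopen : IsOpen (π ⁻¹' t.base) := t.isOpen_base.preimage P.contMDiff_proj.continuous
    have h1 : ContMDiffOn (𝓡 d) ((𝓡 m).prod (𝓡 k)) ∞ (fun e => (π e, t.trans e))
        (π ⁻¹' t.base) := P.contMDiff_proj.contMDiffOn.prodMk t.contMDiffOn_trans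
    have h2 : ContMDiffOn ((𝓡 m).prod (𝓡 k)) (𝓡 d) ∞ (fun p : B × G => p.2 • t.sec p.1)
        (t.base ×ˢ Set.univ) :=
      P.contMDiff_act.comp_contMDiffOn (contMDiff_snd.contMDiffOn.prodMk
        (t.contMDiffOn_sec.comp contMDiff_fst.contMDiffOn fun p hp => hp.1))
    refine ⟨{
      toFun := fun e => (π e, t.trans e)
      invFun := fun p => p.2 • t.sec p.1
      source := π ⁻¹' t.base
      target := t.base ×ˢ Set.univ
      map_source' := fun e he => ⟨he, trivial⟩
      map_target' := fun p hp => by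
        rw [Set.mem_preimage, P.proj_act, t.proj_sec _ hp.1]
        exact hp.1
      left_inv' := fun e he => t.trans_act_sec e he
      right_inv' := fun p hp => by
        refine Prod.ext ?_ (t.trans_smul_sec _ _ hp.1)
        exact (P.proj_act _ _).trans (t.proj_sec _ hp.1)
      open_source := hopen
      open_target := t.isOpen_base.prod isOpen_univ
      continuousOn_toFun := h1.continuousOn
      continuousOn_invFun := h2.continuousOn
      baseSet := t.base
      open_baseSet := t.isOpen_base
      source_eq := rfl
      target_eq := rfl
      proj_toFun := fun e he => rfl }, hb, h1, h2, fun g e he => P.trans_act g he⟩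

end IsSmoothPrincipalBundle

/-! ### Pullbacks of principal bundles -/

section Pullback

variable {k d m c : ℕ} {K E B T : Type u} [Group K] [TopologicalSpace K]
  [ChartedSpace (EuclideanSpace ℝ (Fin k)) K] [LieGroup (𝓡 k) ∞ K] [TopologicalSpace E]
  [ChartedSpace (EuclideanSpace ℝ (Fin d)) E] [TopologicalSpace B]
  [ChartedSpace (EuclideanSpace ℝ (Fin m)) B] {act : K → E → E} {π : E → B}
  [TopologicalSpace T] [ChartedSpace (EuclideanSpace ℝ (Fin c)) T] [IsManifold (𝓡 c) ∞ T]
  {f : T → B}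

/-- The total space of the pullback of a principal bundle `π` along a smooth map `f`. -/
def PullbackSpace (_ : IsPrincipal k d m act π) (_ : ContMDiff (𝓡 c) (𝓡 m) ∞ f) : Type u :=
  {p : T × E // f p.1 = π p.2}

variable (P : IsPrincipal k d m act π) (hf : ContMDiff (𝓡 c) (𝓡 m) ∞ f)

namespace PullbackSpace

omit [LieGroup (𝓡 k) ∞ K] [IsManifold (𝓡 c) ∞ T]

variable {P hf} in
/-- The inclusion of the pullback into the product. -/
def val (p : PullbackSpace P hf) : T × E := Subtype.val p

instance : TopologicalSpace (PullbackSpace P hf) :=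
  inferInstanceAs (TopologicalSpace {p : T × E // f p.1 = π p.2})

instance [T2Space T] [T2Space E] : T2Space (PullbackSpace P hf) :=
  inferInstanceAs (T2Space {p : T × E // f p.1 = π p.2})

theorem isEmbedding_val : IsEmbedding (val : PullbackSpace P hf → T × E) :=
  IsEmbedding.subtypeVal

instance [SecondCountableTopology T] [SecondCountableTopology E] :
    SecondCountableTopology (PullbackSpace P hf) :=
  (isEmbedding_val P hf).secondCountableTopology

theorem val_injective : Function.Injective (val : PullbackSpace P hf → T × E) :=
  Subtype.val_injective

variable {P hf} in
theorem property (p : PullbackSpace P hf) : f p.val.1 = π p.val.2 := Subtype.property p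

/-- The charts of the pullback that are compatible with its inclusion into the product. -/
def charts : Set (OpenPartialHomeomorph (PullbackSpace P hf) (EuclideanSpace ℝ (Fin (c + k)))) :=
  {φ | ContMDiffOn (𝓡 (c + k)) ((𝓡 c).prod (𝓡 d)) ∞ (val ∘ φ.symm) φ.target ∧
    ∃ (W : Set (T × E)) (φ' : T × E → EuclideanSpace ℝ (Fin (c + k))), IsOpen W ∧
      ContMDiffOn ((𝓡 c).prod (𝓡 d)) (𝓡 (c + k)) ∞ φ' W ∧ ∀ p ∈ φ.source, p.val ∈ W ∧
        φ p = φ' p.val}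

/-- The second chart is the restriction of a smooth function on an open set of `T × E`, and the
inverse of the first is smooth as a map into `T × E`. -/
theorem charts_compat {φ φ' : OpenPartialHomeomorph (PullbackSpace P hf)
    (EuclideanSpace ℝ (Fin (c + k)))} (hφ : φ ∈ charts P hf) (hφ' : φ' ∈ charts P hf) :
    ContDiffOn ℝ ∞ (φ' ∘ φ.symm) (φ.target ∩ φ.symm ⁻¹' φ'.source) := by
  obtain ⟨W, ψ, -, hψ, hW⟩ := hφ'.2
  rw [← contMDiffOn_iff_contDiffOn]
  exact (hψ.comp (hφ.1.mono Set.inter_subset_left) fun v hv => (hW _ hv.2).1).congr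
    fun v hv => (hW _ hv.2).2

end PullbackSpace

/-- Over a trivializing set, a point of the pullback is a point `x` of `T` and an element `g` of
`K`, the second component being `g` applied to the section at `f x`. Charts of `T` and `K` then give
the coordinates. -/
theorem PullbackSpace.exists_chart (p₀ : PullbackSpace P hf) :
    ∃ φ ∈ charts P hf, p₀ ∈ φ.source := by
  classical
  obtain ⟨t, ht⟩ := P.exists_localTriv (π p₀.val.2)
  let A : (EuclideanSpace ℝ (Fin c) × EuclideanSpace ℝ (Fin k)) ≃L[ℝ]
    EuclideanSpace ℝ (Fin (c + k)) := ContinuousLinearEquiv.ofFinrankEq (by simp)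
  let κ := chartAt (EuclideanSpace ℝ (Fin c)) p₀.val.1
  let ν := chartAt (EuclideanSpace ℝ (Fin k)) (t.trans p₀.val.2)
  have hκ := contMDiffOn_chart (I := 𝓡 c) (n := ∞) (x := p₀.val.1)
  have hκ' := contMDiffOn_chart_symm (I := 𝓡 c) (n := ∞) (x := p₀.val.1)
  have hν := contMDiffOn_chart (I := 𝓡 k) (n := ∞) (x := t.trans p₀.val.2)
  have hν' := contMDiffOn_chart_symm (I := 𝓡 k) (n := ∞) (x := t.trans p₀.val.2)
  have hbase : IsOpen (π ⁻¹' t.base) := t.isOpen_base.preimage P.contMDiff_proj.continuous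
  have htr : IsOpen (π ⁻¹' t.base ∩ t.trans ⁻¹' ν.source) :=
    t.contMDiffOn_trans.continuousOn.isOpen_inter_preimage hbase ν.open_source
  let W : Set (T × E) := κ.source ×ˢ (π ⁻¹' t.base ∩ t.trans ⁻¹' ν.source)
  have hW : IsOpen W := κ.open_source.prod htr
  let φ' : T × E → EuclideanSpace ℝ (Fin (c + k)) := fun p => A (κ p.1, ν (t.trans p.2))
  have hφ' : ContMDiffOn ((𝓡 c).prod (𝓡 d)) (𝓡 (c + k)) ∞ φ' W := by
    have h1 : ContMDiffOn ((𝓡 c).prod (𝓡 d)) (𝓡 c) ∞ (fun p : T × E => κ p.1) W :=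
      hκ.comp contMDiff_fst.contMDiffOn fun p hp => hp.1
    have h2 : ContMDiffOn ((𝓡 c).prod (𝓡 d)) (𝓡 k) ∞ (fun p : T × E => t.trans p.2) W :=
      t.contMDiffOn_trans.comp contMDiff_snd.contMDiffOn fun p hp => hp.2.1
    have h3 : ContMDiffOn ((𝓡 c).prod (𝓡 d)) (𝓡 k) ∞ (fun p : T × E => ν (t.trans p.2)) W :=
      hν.comp h2 fun p hp => hp.2.2
    exact A.contDiff.contMDiff.comp_contMDiffOn (h1.prodMk_space h3)
  let V₁ : Set (EuclideanSpace ℝ (Fin c)) := κ.target ∩ κ.symm ⁻¹' (f ⁻¹' t.base)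
  have hV₁ : IsOpen V₁ := κ.symm.isOpen_inter_preimage (t.isOpen_base.preimage hf.continuous)
  let V : Set (EuclideanSpace ℝ (Fin (c + k))) := A.symm ⁻¹' (V₁ ×ˢ ν.target)
  have hV : IsOpen V := (hV₁.prod ν.open_target).preimage A.symm.continuous
  let tot : EuclideanSpace ℝ (Fin (c + k)) → T × E := fun w =>
    (κ.symm (A.symm w).1, act (ν.symm (A.symm w).2) (t.sec (f (κ.symm (A.symm w).1))))
  have htot : ContMDiffOn (𝓡 (c + k)) ((𝓡 c).prod (𝓡 d)) ∞ tot V := by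
    have hA1 : ContMDiff (𝓡 (c + k)) (𝓡 c) ∞ fun w => (A.symm w).1 :=
      (contDiff_fst.comp A.symm.contDiff).contMDiff
    have hA2 : ContMDiff (𝓡 (c + k)) (𝓡 k) ∞ fun w => (A.symm w).2 :=
      (contDiff_snd.comp A.symm.contDiff).contMDiff
    have h1 : ContMDiffOn (𝓡 (c + k)) (𝓡 c) ∞ (fun w => κ.symm (A.symm w).1) V :=
      hκ'.comp hA1.contMDiffOn fun w hw => hw.1.1
    have h2 : ContMDiffOn (𝓡 (c + k)) (𝓡 k) ∞ (fun w => ν.symm (A.symm w).2) V :=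
      hν'.comp hA2.contMDiffOn fun w hw => hw.2
    have h3 : ContMDiffOn (𝓡 (c + k)) (𝓡 d) ∞ (fun w => t.sec (f (κ.symm (A.symm w).1))) V :=
      t.contMDiffOn_sec.comp (hf.comp_contMDiffOn h1) fun w hw => hw.1.2
    exact h1.prodMk (P.contMDiff_act.comp_contMDiffOn (h2.prodMk h3))
  have htotmem : ∀ w ∈ V, f (tot w).1 = π (tot w).2 := fun w hw => by
    simp only [tot]
    rw [P.proj_act, t.proj_sec _ hw.1.2]
  let inv : EuclideanSpace ℝ (Fin (c + k)) → PullbackSpace P hf := fun w =>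
    if h : f (tot w).1 = π (tot w).2 then ⟨tot w, h⟩ else p₀
  have hinv : ∀ w ∈ V, (inv w).val = tot w := fun w hw => by
    have : inv w = ⟨tot w, htotmem w hw⟩ := dif_pos (htotmem w hw)
    rw [this]
    rfl
  let φ : OpenPartialHomeomorph (PullbackSpace P hf) (EuclideanSpace ℝ (Fin (c + k))) :=
    { toFun := fun p => φ' p.val
      invFun := inv
      source := PullbackSpace.val ⁻¹' W
      target := V
      map_source' := fun p hp => by
        have hA : A.symm (φ' p.val) = (κ p.val.1, ν (t.trans p.val.2)) := A.symm_apply_apply _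
        rw [Set.mem_preimage, hA]
        refine ⟨⟨κ.map_source hp.1, ?_⟩, ν.map_source hp.2.2⟩
        rw [Set.mem_preimage, Set.mem_preimage, κ.left_inv hp.1, p.property]
        exact hp.2.1
      map_target' := fun w hw => by
        rw [Set.mem_preimage, hinv w hw]
        refine ⟨κ.map_target hw.1.1, ?_, ?_⟩
        · rw [Set.mem_preimage, ← htotmem w hw]
          exact hw.1.2
        · rw [Set.mem_preimage, t.trans_smul_sec _ _ hw.1.2]
          exact ν.map_target hw.2
      left_inv' := fun p hp => by
        have hA : A.symm (φ' p.val) = (κ p.val.1, ν (t.trans p.val.2)) := A.symm_apply_apply _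
        have hmem : φ' p.val ∈ V := by
          rw [Set.mem_preimage, hA]
          refine ⟨⟨κ.map_source hp.1, ?_⟩, ν.map_source hp.2.2⟩
          rw [Set.mem_preimage, Set.mem_preimage, κ.left_inv hp.1, p.property]
          exact hp.2.1
        refine PullbackSpace.val_injective P hf ?_
        rw [hinv _ hmem]
        simp only [tot, hA, κ.left_inv hp.1, ν.left_inv hp.2.2, p.property]
        rw [t.trans_act_sec _ hp.2.1]
      right_inv' := fun w hw => by
        rw [hinv w hw]
        simp only [φ', tot, κ.right_inv hw.1.1]
        rw [t.trans_smul_sec _ _ hw.1.2, ν.right_inv hw.2]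
        exact A.apply_symm_apply w
      open_source := hW.preimage (PullbackSpace.isEmbedding_val P hf).continuous
      open_target := hV
      continuousOn_toFun := hφ'.continuousOn.comp
        (PullbackSpace.isEmbedding_val P hf).continuous.continuousOn fun p hp => hp
      continuousOn_invFun := by
        rw [(PullbackSpace.isEmbedding_val P hf).isInducing.continuousOn_iff]
        exact htot.continuousOn.congr hinv }
  refine ⟨φ, ⟨htot.congr hinv, W, φ', hW, hφ', fun p hp => ⟨hp, rfl⟩⟩, ?_⟩
  exact ⟨mem_chart_source _ _, ht, mem_chart_source _ _⟩

namespace PullbackSpace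

instance : ChartedSpace (EuclideanSpace ℝ (Fin (c + k))) (PullbackSpace P hf) :=
  chartedSpaceOfCharts (charts P hf) (exists_chart P hf)

instance : IsManifold (𝓡 (c + k)) ∞ (PullbackSpace P hf) :=
  isManifold_chartedSpaceOfCharts (exists_chart P hf) fun _ h _ h' => charts_compat P hf h h'

theorem contMDiff_val :
    ContMDiff (𝓡 (c + k)) ((𝓡 c).prod (𝓡 d)) ∞ (val : PullbackSpace P hf → T × E) := by
  intro p
  obtain ⟨φ, hφ, hp⟩ := exists_chart P hf p
  have h1 : ContMDiffAt (𝓡 (c + k)) (𝓡 (c + k)) ∞ φ p :=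
    contMDiffAt_of_mem_maximalAtlas (IsManifold.subset_maximalAtlas hφ) hp
  have h2 := (hφ.1.contMDiffAt (φ.open_target.mem_nhds (φ.map_source hp))).comp p h1
  refine h2.congr_of_eventuallyEq ?_
  filter_upwards [φ.open_source.mem_nhds hp] with z hz
  simp only [Function.comp_apply, φ.left_inv hz]

theorem contMDiff_fst : ContMDiff (𝓡 (c + k)) (𝓡 c) ∞ fun p : PullbackSpace P hf => p.val.1 :=
  _root_.contMDiff_fst.comp (contMDiff_val P hf)

theorem contMDiff_snd : ContMDiff (𝓡 (c + k)) (𝓡 d) ∞ fun p : PullbackSpace P hf => p.val.2 :=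
  _root_.contMDiff_snd.comp (contMDiff_val P hf)

variable {P hf}

/-- The charts are restrictions of smooth functions on the product, so smoothness of the two
components suffices; continuity into the subspace comes first, to stay inside one chart. -/
theorem contMDiffAt_of_val {ES HS : Type*} [NormedAddCommGroup ES] [NormedSpace ℝ ES]
    [TopologicalSpace HS] {I : ModelWithCorners ℝ ES HS} {S : Type*} [TopologicalSpace S]
    [ChartedSpace HS S] {g : S → PullbackSpace P hf} {x : S}
    (h1 : ContMDiffAt I (𝓡 c) ∞ (fun s => (g s).val.1) x)
    (h2 : ContMDiffAt I (𝓡 d) ∞ (fun s => (g s).val.2) x) :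
    ContMDiffAt I (𝓡 (c + k)) ∞ g x := by
  obtain ⟨φ, hφ, hp⟩ := exists_chart P hf (g x)
  obtain ⟨W, φ', hW, hφ', hWφ⟩ := hφ.2
  have hg : ContinuousAt g x := by
    rw [(isEmbedding_val P hf).continuousAt_iff]
    exact h1.continuousAt.prodMk h2.continuousAt
  have h3 : ContMDiffAt I (𝓡 (c + k)) ∞ (fun s => φ' (g s).val) x :=
    (hφ'.contMDiffAt (hW.mem_nhds (hWφ _ hp).1)).comp x (h1.prodMk h2)
  have h4 : ContMDiffAt I (𝓡 (c + k)) ∞ (fun s => φ.symm (φ' (g s).val)) x := by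
    refine ContMDiffAt.comp x (g := φ.symm) ?_ h3
    refine contMDiffAt_symm_of_mem_maximalAtlas (IsManifold.subset_maximalAtlas hφ) ?_
    rw [← (hWφ _ hp).2]
    exact φ.map_source hp
  refine h4.congr_of_eventuallyEq ?_
  filter_upwards [hg.preimage_mem_nhds (φ.open_source.mem_nhds hp)] with s hs
  rw [← (hWφ _ hs).2, φ.left_inv hs]

end PullbackSpace

end Pullback

/-! ### Orbit spaces of equivariant maps -/

section OrbitMaps

variable {H G Γ : Type u} [Group H] [Group G] [Group Γ] (S : GroupExtension H G Γ)
  {E E' B : Type u} [MulAction G E] [MulAction G E']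

theorem orbitMk_surjective : Function.Surjective (orbitMk S : E → OrbitSpace S E) :=
  Quotient.mk_surjective

theorem isOpenQuotientMap_orbitMk [TopologicalSpace E] [ContinuousConstSMul G E] :
    IsOpenQuotientMap (orbitMk S : E → OrbitSpace S E) :=
  have : ContinuousConstSMul S.inl.range E := ⟨fun c => continuous_const_smul (c : G)⟩
  MulAction.isOpenQuotientMap_quotientMk (Γ := S.inl.range)

theorem orbitMk_inl_smul (h : H) (e : E) : orbitMk S (S.inl h • e) = orbitMk S e :=
  orbitMk_eq_iff.2 ⟨h, rfl⟩

/-- An invariant map descends to the orbit space. -/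
def orbitLift (f : E → B) (hf : ∀ (h : H) (e : E), f (S.inl h • e) = f e) : OrbitSpace S E → B :=
  fun y => Quotient.liftOn y f fun a b hab => by
    obtain ⟨h, rfl⟩ := orbitMk_eq_iff.1 (show orbitMk S a = orbitMk S b from Quotient.sound hab)
    exact hf h b

@[simp]
theorem orbitLift_mk (f : E → B) (hf : ∀ (h : H) (e : E), f (S.inl h • e) = f e) (e : E) :
    orbitLift S f hf (orbitMk S e) = f e := rfl

/-- The map of orbit spaces induced by an equivariant map. -/
def orbitMap (f : E → E') (hf : ∀ (g : G) (e : E), f (g • e) = g • f e) :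
    OrbitSpace S E → OrbitSpace S E' :=
  orbitLift S (fun e => orbitMk S (f e)) fun h e => by rw [hf, orbitMk_inl_smul]

@[simp]
theorem orbitMap_mk (f : E → E') (hf : ∀ (g : G) (e : E), f (g • e) = g • f e) (e : E) :
    orbitMap S f hf (orbitMk S e) = orbitMk S (f e) := rfl

theorem orbitMap_smul (f : E → E') (hf : ∀ (g : G) (e : E), f (g • e) = g • f e) (γ : Γ)
    (y : OrbitSpace S E) : orbitMap S f hf (γ • y) = γ • orbitMap S f hf y := by
  obtain ⟨e, rfl⟩ := orbitMk_surjective S y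
  obtain ⟨g, rfl⟩ := S.rightHom_surjective γ
  rw [rightHom_smul_orbitMk, orbitMap_mk, orbitMap_mk, hf, rightHom_smul_orbitMk]

theorem orbitLift_smul (f : E → B) (hf : ∀ (g : G) (e : E), f (g • e) = f e) (γ : Γ)
    (y : OrbitSpace S E) :
    orbitLift S f (fun h e => hf _ e) (γ • y) = orbitLift S f (fun h e => hf _ e) y := by
  obtain ⟨e, rfl⟩ := orbitMk_surjective S y
  obtain ⟨g, rfl⟩ := S.rightHom_surjective γ
  rw [rightHom_smul_orbitMk, orbitLift_mk, orbitLift_mk, hf]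

/-- A subgroup that acts freely and properly on a space acts properly on every space that maps to
it equivariantly. -/
theorem isProperMap_of_equivariant [TopologicalSpace H] [TopologicalSpace E] [T2Space E]
    [TopologicalSpace E'] {a : E → E'} (ha : Continuous a)
    (hae : ∀ (g : G) (e : E), a (g • e) = g • a e)
    (hc : Continuous fun q : H × E => S.inl q.1 • q.2)
    (hprop : IsProperMap fun q : H × E' => (S.inl q.1 • q.2, q.2)) :
    IsProperMap fun q : H × E => (S.inl q.1 • q.2, q.2) := by
  rw [isProperMap_iff_ultrafilter] at hprop ⊢
  refine ⟨hc.prodMk continuous_snd, ?_⟩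
  rintro 𝒰 ⟨e', e₀⟩ h𝒰
  -- The ultrafilter is pushed to `H × E'`, where properness yields a limit `h₀` of the group
  -- components. The components in `E` already converge to `e₀`, and Hausdorffness of `E` identifies
  -- the image of the limit.
  have h1 : Filter.Tendsto (fun q : H × E' => (S.inl q.1 • q.2, q.2))
      (𝒰.map (Prod.map id a)) (𝓝 (a e', a e₀)) := by
    rw [Ultrafilter.coe_map, Filter.tendsto_map'_iff]
    refine (((ha.prodMap ha).tendsto (e', e₀)).comp h𝒰).congr fun q => ?_
    simp [hae]
  obtain ⟨⟨h₀, x₀⟩, -, hx⟩ := hprop.2 h1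
  have h2 : Filter.Tendsto (Prod.fst : H × E → H) 𝒰 (𝓝 h₀) := by
    have : Filter.Tendsto (Prod.map id a) (𝒰 : Filter (H × E)) (𝓝 (h₀, x₀)) := hx
    exact (continuous_fst.tendsto (h₀, x₀)).comp this
  have h3 : Filter.Tendsto (Prod.snd : H × E → E) 𝒰 (𝓝 e₀) :=
    (continuous_snd.tendsto (e', e₀)).comp h𝒰
  have h4 : Filter.Tendsto id (𝒰 : Filter (H × E)) (𝓝 (h₀, e₀)) := h2.prodMk_nhds h3
  refine ⟨(h₀, e₀), Prod.ext ?_ rfl, h4⟩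
  exact tendsto_nhds_unique ((hc.tendsto (h₀, e₀)).comp h4)
    ((continuous_fst.tendsto (e', e₀)).comp h𝒰)

end OrbitMaps

/-! ### Orbit spaces of free and proper actions as manifolds -/

section OrbitManifold

variable {l k r n m : ℕ} {H G Γ E B X : Type u}
  [Group H] [TopologicalSpace H] [ChartedSpace (EuclideanSpace ℝ (Fin l)) H] [LieGroup (𝓡 l) ∞ H]
  [Group G] [TopologicalSpace G] [ChartedSpace (EuclideanSpace ℝ (Fin k)) G] [LieGroup (𝓡 k) ∞ G]
  [Group Γ] [TopologicalSpace Γ] [ChartedSpace (EuclideanSpace ℝ (Fin r)) Γ] [LieGroup (𝓡 r) ∞ Γ]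
  [TopologicalSpace E] [ChartedSpace (EuclideanSpace ℝ (Fin n)) E]
  [MulAction G E] {S : GroupExtension H G Γ}

/-- The quotient manifold theorem for the orbit space of the kernel of a group extension. -/
theorem exists_orbit_manifold [IsManifold (𝓡 n) ∞ E] [ContMDiffSMul (𝓡 k) (𝓡 n) ∞ G E]
    [SecondCountableTopology E] (hι : ContMDiff (𝓡 l) (𝓡 k) ∞ S.inl)
    (hfree : ∀ (h : H) (x : E), S.inl h • x = x → h = 1)
    (hprop : IsProperMap fun q : H × E => (S.inl q.1 • q.2, q.2)) :
    ∃ (m : ℕ) (_ : ChartedSpace (EuclideanSpace ℝ (Fin m)) (OrbitSpace S E)),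
      IsQuotientManifold n E m S ∧
      IsPrincipal l n m (fun (h : H) (e : E) => S.inl h • e)
        (orbitMk S : E → OrbitSpace S E) := by
  have : ContinuousSMul G E := ContMDiffSMul.continuousSMul (I := 𝓡 k) (I' := 𝓡 n) ∞
  let : MulAction H E := MulAction.compHom E S.inl
  have hact : ContMDiff ((𝓡 l).prod (𝓡 n)) (𝓡 n) ∞ fun p : H × E => S.inl p.1 • p.2 :=
    (contMDiff_smul (I := 𝓡 k) (I' := 𝓡 n)).comp
      ((hι.comp contMDiff_fst).prodMk contMDiff_snd)
  have : ContMDiffSMul (𝓡 l) (𝓡 n) ∞ H E := ⟨hact⟩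
  obtain ⟨m, hm, hman, ht2, hsc, hsub, htriv⟩ := exists_quotient_manifold (l := l) (n := n)
    (H := H) (X := E) (q := orbitMk S) hfree hprop (isOpenQuotientMap_orbitMk S)
    (fun x y => orbitMk_eq_iff)
  exact ⟨m, hm, ⟨hman, ht2, hsc, hsub⟩, {
    contMDiff_act := hact
    contMDiff_proj := hsub.contMDiff
    act_mul := fun g h e => by rw [map_mul, mul_smul]
    proj_act := fun g e => orbitMk_inl_smul S g e
    exists_localTriv := htriv }⟩

variable [ChartedSpace (EuclideanSpace ℝ (Fin m)) (OrbitSpace S E)]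
  (P : IsPrincipal l n m (fun (h : H) (e : E) => S.inl h • e) (orbitMk S : E → OrbitSpace S E))
  (hsec : ∀ γ₀ : Γ, ∃ (U : Set Γ) (s : Γ → G), IsOpen U ∧ γ₀ ∈ U ∧
    ContMDiffOn (𝓡 r) (𝓡 k) ∞ s U ∧ ∀ γ ∈ U, S.rightHom (s γ) = γ)

include P hsec in
omit [LieGroup (𝓡 l) ∞ H] [LieGroup (𝓡 k) ∞ G] [LieGroup (𝓡 r) ∞ Γ] in
/-- The residual action on the orbit space is smooth. -/
theorem contMDiffSMul_orbitSpace [ContMDiffSMul (𝓡 k) (𝓡 n) ∞ G E] :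
    ContMDiffSMul (𝓡 r) (𝓡 m) ∞ Γ (OrbitSpace S E) := by
  refine ⟨?_⟩
  rintro ⟨γ₀, y₀⟩
  obtain ⟨e, rfl⟩ := orbitMk_surjective S y₀
  -- Locally the residual action is the class of `σ γ • s y`, for a smooth section `σ` of `G → Γ`
  -- and a smooth section `s` of the orbit projection.
  obtain ⟨U, σ, hU, hγ, hσ, hσU⟩ := hsec γ₀
  obtain ⟨s, hs, -, hπs⟩ := P.exists_section e
  have h1 : ContMDiffAt ((𝓡 r).prod (𝓡 m)) (𝓡 k) ∞
      (fun p : Γ × OrbitSpace S E => σ p.1) (γ₀, orbitMk S e) :=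
    ContMDiffAt.comp (γ₀, orbitMk S e) (hσ.contMDiffAt (hU.mem_nhds hγ)) contMDiffAt_fst
  have h2 : ContMDiffAt ((𝓡 r).prod (𝓡 m)) (𝓡 n) ∞
      (fun p : Γ × OrbitSpace S E => s p.2) (γ₀, orbitMk S e) :=
    ContMDiffAt.comp (γ₀, orbitMk S e) hs contMDiffAt_snd
  refine (P.contMDiff_proj.contMDiffAt.comp _ (h1.smul h2)).congr_of_eventuallyEq ?_
  have e1 : ∀ᶠ p : Γ × OrbitSpace S E in 𝓝 (γ₀, orbitMk S e), p.1 ∈ U :=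
    continuousAt_fst.eventually (hU.mem_nhds hγ)
  have e2 : ∀ᶠ p : Γ × OrbitSpace S E in 𝓝 (γ₀, orbitMk S e), orbitMk S (s p.2) = p.2 :=
    (continuousAt_snd (p := (γ₀, orbitMk S e))).eventually hπs
  filter_upwards [e1, e2] with p hp1 hp2
  conv_lhs => rw [← hp2, ← hσU p.1 hp1, rightHom_smul_orbitMk]
  rfl

include P in
omit [LieGroup (𝓡 l) ∞ H] [LieGroup (𝓡 k) ∞ G] [LieGroup (𝓡 r) ∞ Γ] in
theorem contMDiff_orbitLift {d : ℕ} [TopologicalSpace B]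
    [ChartedSpace (EuclideanSpace ℝ (Fin d)) B] {f : E → B}
    (hf : ∀ (h : H) (e : E), f (S.inl h • e) = f e) (hfs : ContMDiff (𝓡 n) (𝓡 d) ∞ f) :
    ContMDiff (𝓡 m) (𝓡 d) ∞ (orbitLift S f hf) :=
  P.contMDiff_of_comp_proj hfs

include P in
omit [LieGroup (𝓡 l) ∞ H] [LieGroup (𝓡 k) ∞ G] [LieGroup (𝓡 r) ∞ Γ] in
theorem contMDiff_orbitMap {n' m' : ℕ} {E' : Type u} [TopologicalSpace E']
    [ChartedSpace (EuclideanSpace ℝ (Fin n')) E'] [MulAction G E']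
    [ChartedSpace (EuclideanSpace ℝ (Fin m')) (OrbitSpace S E')]
    (P' : IsPrincipal l n' m' (fun (h : H) (e : E') => S.inl h • e)
      (orbitMk S : E' → OrbitSpace S E'))
    {f : E → E'} (hf : ∀ (g : G) (e : E), f (g • e) = g • f e)
    (hfs : ContMDiff (𝓡 n) (𝓡 n') ∞ f) : ContMDiff (𝓡 m) (𝓡 m') ∞ (orbitMap S f hf) :=
  P.contMDiff_of_comp_proj (P'.contMDiff_proj.comp hfs)

include P hsec in
omit [LieGroup (𝓡 l) ∞ H] [LieGroup (𝓡 r) ∞ Γ] in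
/-- If `E` is a principal `G`-bundle, then `E/H` is a principal `G/H`-bundle. -/
theorem IsPrincipal.orbitSpace {d : ℕ} [TopologicalSpace B]
    [ChartedSpace (EuclideanSpace ℝ (Fin d)) B] {π : E → B}
    (hφ : ContMDiff (𝓡 k) (𝓡 r) ∞ S.rightHom)
    (PG : IsPrincipal k n d (fun (g : G) (e : E) => g • e) π) :
    IsPrincipal r m d (fun (γ : Γ) (y : OrbitSpace S E) => γ • y)
      (orbitLift S π fun h e => PG.proj_act _ e) where
  contMDiff_act := by
    have : ContMDiffSMul (𝓡 k) (𝓡 n) ∞ G E := ⟨PG.contMDiff_act⟩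
    exact (contMDiffSMul_orbitSpace (k := k) P hsec).contMDiff_smul
  contMDiff_proj := contMDiff_orbitLift P _ PG.contMDiff_proj
  act_mul := mul_smul
  proj_act := fun γ y => orbitLift_smul S π PG.proj_act γ y
  exists_localTriv b := by
    obtain ⟨t, ht⟩ := PG.exists_localTriv b
    -- A different representative of the orbit changes the `G`-coordinate by a left factor from `H`,
    -- which disappears in `Γ`.
    let τ : OrbitSpace S E → Γ := fun y =>
      S.rightHom (t.trans (Function.surjInv (orbitMk_surjective S) y))
    have hτ : ∀ e, π e ∈ t.base → τ (orbitMk S e) = S.rightHom (t.trans e) := by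
      intro e he
      obtain ⟨h, hh⟩ := orbitMk_eq_iff.1
        (Function.surjInv_eq (orbitMk_surjective S) (orbitMk S e))
      have h1 := PG.trans_act (t := t) (S.inl h) he
      simp only [hh] at h1
      simp only [τ, h1, map_mul, S.rightHom_inl, one_mul]
    refine ⟨{
      base := t.base
      isOpen_base := t.isOpen_base
      sec := fun b => orbitMk S (t.sec b)
      trans := τ
      contMDiffOn_sec := P.contMDiff_proj.comp_contMDiffOn t.contMDiffOn_sec
      contMDiffOn_trans := ?_
      proj_sec := fun b hb => t.proj_sec b hb
      trans_act_sec := ?_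
      trans_smul_sec := ?_ }, ht⟩
    · intro y hy
      obtain ⟨e, rfl⟩ := orbitMk_surjective S y
      have hopen : IsOpen (π ⁻¹' t.base) := t.isOpen_base.preimage PG.contMDiff_proj.continuous
      refine ContMDiffAt.contMDiffWithinAt (P.contMDiffAt_of_comp_proj ?_)
      refine ContMDiffAt.congr_of_eventuallyEq (f := fun e => S.rightHom (t.trans e)) ?_ ?_
      · exact hφ.contMDiffAt.comp e (t.contMDiffOn_trans.contMDiffAt (hopen.mem_nhds hy))
      · filter_upwards [hopen.mem_nhds hy] with z hz using hτ z hz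
    · intro y hy
      obtain ⟨e, rfl⟩ := orbitMk_surjective S y
      simp only [hτ e hy]
      rw [rightHom_smul_orbitMk, orbitLift_mk, t.trans_act_sec e hy]
    · intro γ b hb
      obtain ⟨g, rfl⟩ := S.rightHom_surjective γ
      simp only [rightHom_smul_orbitMk]
      rw [hτ _ (by rw [PG.proj_act, t.proj_sec b hb]; exact hb), t.trans_smul_sec g b hb]

end OrbitManifold

/-! ### Morphisms of smooth quotient stacks -/

section SmoothQuot

variable {k n : ℕ} {G : Type u} [Group G] [TopologicalSpace G]
  [ChartedSpace (EuclideanSpace ℝ (Fin k)) G] {X : Type u} [TopologicalSpace X]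
  [ChartedSpace (EuclideanSpace ℝ (Fin n)) X] [MulAction G X]

theorem SmoothQuotObj.principal (P : SmoothQuotObj k n G X) :
    IsPrincipal k P.total.dim P.base.dim (fun (g : G) (e : P.total) => g • e) (fn P.proj) :=
  P.isPrincipal.isPrincipal P.proj.contMDiff

variable {P Q : SmoothQuotObj k n G X}

/-- An equivariant morphism of smooth principal bundles is a Cartesian square. -/
theorem isPullback_of_equivariant [LieGroup (𝓡 k) ∞ G] (b : P.base ⟶ Q.base)
    (t : P.total ⟶ Q.total) (ht : ∀ (g : G) (e : P.total), fn t (g • e) = g • fn t e)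
    (htb : ∀ e, fn Q.proj (fn t e) = fn b (fn P.proj e)) : IsPullback t P.proj Q.proj b := by
  have hlift : ∀ s : PullbackCone Q.proj b, ∃ w : s.pt ⟶ P.total, w ≫ t = s.fst ∧
      w ≫ P.proj = s.snd := by
    intro s
    obtain ⟨w, hw, h1, h2⟩ := P.principal.exists_lift Q.principal t.contMDiff ht htb
      s.fst.contMDiff s.snd.contMDiff fun z => congrFun (congrArg SmoothMap.toFun s.condition) z
    exact ⟨⟨w, hw⟩, SmoothMap.ext (funext h1), SmoothMap.ext (funext h2)⟩
  choose lift h1 h2 using hlift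
  refine ⟨⟨SmoothMap.ext (funext htb)⟩, ⟨PullbackCone.IsLimit.mk _ lift h1 h2 ?_⟩⟩
  intro s w hw1 hw2
  refine SmoothMap.ext (funext fun z => P.principal.lift_unique Q.principal ht
    (congrFun (congrArg SmoothMap.toFun (hw1.trans (h1 s).symm)) z)
    (congrFun (congrArg SmoothMap.toFun (hw2.trans (h2 s).symm)) z))

/-- The morphism of `[X/G]` given by an equivariant map. -/
def SmoothQuotHom.ofEquivariant [LieGroup (𝓡 k) ∞ G] (b : P.base ⟶ Q.base)
    (t : P.total ⟶ Q.total) (ht : ∀ (g : G) (e : P.total), fn t (g • e) = g • fn t e)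
    (htb : ∀ e, fn Q.proj (fn t e) = fn b (fn P.proj e))
    (hta : ∀ e, Q.anchor (fn t e) = P.anchor e) : P ⟶ Q :=
  { base := b
    total := t
    map_smul := ht
    isPullback := isPullback_of_equivariant b t ht htb
    anchor_map := hta }

theorem SmoothQuotHom.proj_total (f : P ⟶ Q) (e : P.total) :
    fn Q.proj (fn f.total e) = fn f.base (fn P.proj e) :=
  congrFun (congrArg SmoothMap.toFun f.isPullback.w) e

theorem SmoothQuotHom.hom_ext {f g : P ⟶ Q} (h : ∀ e, fn f.total e = fn g.total e) : f = g := by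
  have ht : f.total = g.total := SmoothMap.ext (funext h)
  refine SmoothQuotHom.ext (SmoothMap.ext (funext fun b => ?_)) ht
  obtain ⟨e, rfl⟩ := P.principal.surjective b
  change fn f.base _ = fn g.base _
  rw [← SmoothQuotHom.proj_total f, ← SmoothQuotHom.proj_total g, ht]

/-- A morphism of `[X/G]` over an isomorphism is an isomorphism. -/
theorem SmoothQuotHom.isIso_of_isIso_base (f : P ⟶ Q) [IsIso f.base] : IsIso f := by
  have : IsIso f.total := f.isPullback.isIso_fst_of_isIso
  have hinv : ∀ e, fn (inv f.total) (fn f.total e) = e := fun e =>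
    congrFun (congrArg SmoothMap.toFun (IsIso.hom_inv_id f.total)) e
  have hinv' : ∀ e, fn f.total (fn (inv f.total) e) = e := fun e =>
    congrFun (congrArg SmoothMap.toFun (IsIso.inv_hom_id f.total)) e
  refine ⟨⟨{
    base := inv f.base
    total := inv f.total
    map_smul := fun g e => ?_
    isPullback := IsPullback.of_horiz_isIso ⟨by
      rw [IsIso.inv_comp_eq, ← Category.assoc, IsIso.eq_comp_inv, f.isPullback.w]⟩
    anchor_map := fun e => ?_ }, ?_, ?_⟩⟩
  · conv_lhs => rw [← hinv' e, ← f.map_smul, hinv]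
  · conv_rhs => rw [← hinv' e, f.anchor_map]
  · exact SmoothQuotHom.ext (IsIso.hom_inv_id f.base) (IsIso.hom_inv_id f.total)
  · exact SmoothQuotHom.ext (IsIso.inv_hom_id f.base) (IsIso.inv_hom_id f.total)

end SmoothQuot

/-! ### Quotients in stages over manifolds -/

section Stages

variable {l k r n m : ℕ} {H G Γ X : Type u}
  [Group H] [TopologicalSpace H] [ChartedSpace (EuclideanSpace ℝ (Fin l)) H]
  [Group G] [TopologicalSpace G] [ChartedSpace (EuclideanSpace ℝ (Fin k)) G]
  [Group Γ] [TopologicalSpace Γ] [ChartedSpace (EuclideanSpace ℝ (Fin r)) Γ]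
  [TopologicalSpace X] [ChartedSpace (EuclideanSpace ℝ (Fin n)) X]
  [MulAction G X] {S : GroupExtension H G Γ}
  [ChartedSpace (EuclideanSpace ℝ (Fin m)) (OrbitSpace S X)]

variable (l k r n m X S) in
/-- An extension of Lie groups whose kernel acts freely and properly on `X`, together with the
quotient manifold `X/H`. -/
structure SmoothStages : Prop where
  contMDiff_inl : ContMDiff (𝓡 l) (𝓡 k) ∞ S.inl
  contMDiff_rightHom : ContMDiff (𝓡 k) (𝓡 r) ∞ S.rightHom
  free : ∀ (h : H) (x : X), S.inl h • x = x → h = 1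
  proper : IsProperMap fun q : H × X => (S.inl q.1 • q.2, q.2)
  principal : IsPrincipal l n m (fun (h : H) (x : X) => S.inl h • x)
    (orbitMk S : X → OrbitSpace S X)
  exists_section : ∀ γ₀ : Γ, ∃ (U : Set Γ) (s : Γ → G), IsOpen U ∧ γ₀ ∈ U ∧
    ContMDiffOn (𝓡 r) (𝓡 k) ∞ s U ∧ ∀ γ ∈ U, S.rightHom (s γ) = γ

variable (l S) in
/-- A quotient manifold of a manifold `E` by the kernel of an extension acting freely and
properly. -/
structure OrbitAtlas (d : ℕ) (E : Type u) [TopologicalSpace E]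
    [ChartedSpace (EuclideanSpace ℝ (Fin d)) E] [MulAction G E] where
  dim : ℕ
  charts : ChartedSpace (EuclideanSpace ℝ (Fin dim)) (OrbitSpace S E)
  isQuotientManifold : IsQuotientManifold d E dim S
  principal : IsPrincipal l d dim (fun (h : H) (e : E) => S.inl h • e)
    (orbitMk S : E → OrbitSpace S E)

namespace SmoothStages

variable [LieGroup (𝓡 l) ∞ H] [LieGroup (𝓡 k) ∞ G] [LieGroup (𝓡 r) ∞ Γ]
  (D : SmoothStages l k r n m X S) (P : SmoothQuotObj k n G X)

-- The anchor is equivariant, so freeness and properness of the action of `H` pass from `X` to the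
-- total space, and the quotient manifold theorem applies there.
include D in
theorem nonempty_orbitAtlas : Nonempty (OrbitAtlas l S P.total.dim P.total) := by
  have := P.isPrincipal.contMDiffSMul
  have : ContinuousSMul G P.total :=
    ContMDiffSMul.continuousSMul (I := 𝓡 k) (I' := 𝓡 P.total.dim) ∞
  have hcont : Continuous fun q : H × P.total => S.inl q.1 • q.2 :=
    (D.contMDiff_inl.continuous.comp continuous_fst).smul continuous_snd
  obtain ⟨d, c, h1, h2⟩ := exists_orbit_manifold (n := P.total.dim) (E := P.total)
    D.contMDiff_inl
    (fun h e he => D.free h (P.anchor e) (by rw [← P.anchor_smul, he]))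
    (isProperMap_of_equivariant S P.contMDiff_anchor.continuous P.anchor_smul hcont D.proper)
  exact ⟨⟨d, c, h1, h2⟩⟩

/-- The chosen quotient manifold of the total space by `H`. -/
def orbitAtlas : OrbitAtlas l S P.total.dim P.total := Classical.choice (D.nonempty_orbitAtlas P)

/-- The total space modulo `H`. -/
@[reducible]
def orbitTotal : SmoothManifold.{u} :=
  let := (D.orbitAtlas P).charts
  { carrier := OrbitSpace S P.total
    dim := (D.orbitAtlas P).dim
    isManifold := (D.orbitAtlas P).isQuotientManifold.isManifold
    t2Space := (D.orbitAtlas P).isQuotientManifold.t2Space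
    secondCountable := (D.orbitAtlas P).isQuotientManifold.secondCountable }

/-- The object `(B ← E/H → X/H)` of `[(X/H)/Γ]` associated to an object of `[X/G]`. -/
def obj : SmoothQuotObj r m Γ (OrbitSpace S X) :=
  let := (D.orbitAtlas P).charts
  { base := P.base
    total := D.orbitTotal P
    action := inferInstanceAs (MulAction Γ (OrbitSpace S P.total))
    proj := ⟨orbitLift S (fn P.proj) fun _ e => P.isPrincipal.proj_smul _ e,
      contMDiff_orbitLift (D.orbitAtlas P).principal _ P.proj.contMDiff⟩
    isPrincipal := ((D.orbitAtlas P).principal.orbitSpace D.exists_section D.contMDiff_rightHom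
      P.principal).isSmoothPrincipalBundle
    anchor := orbitMap S P.anchor P.anchor_smul
    contMDiff_anchor := contMDiff_orbitMap (D.orbitAtlas P).principal D.principal P.anchor_smul
      P.contMDiff_anchor
    anchor_smul := orbitMap_smul S P.anchor P.anchor_smul }

variable {P} {Q : SmoothQuotObj k n G X}

/-- The functor on morphisms. -/
def map (f : P ⟶ Q) : D.obj P ⟶ D.obj Q :=
  let := (D.orbitAtlas P).charts
  let := (D.orbitAtlas Q).charts
  SmoothQuotHom.ofEquivariant (P := D.obj P) (Q := D.obj Q) f.base
    ⟨orbitMap S (fn f.total) f.map_smul, contMDiff_orbitMap (D.orbitAtlas P).principal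
      (D.orbitAtlas Q).principal f.map_smul f.total.contMDiff⟩
    (orbitMap_smul S _ f.map_smul)
    (by
      intro y
      obtain ⟨e, rfl⟩ := orbitMk_surjective S y
      exact f.proj_total e)
    (by
      intro y
      obtain ⟨e, rfl⟩ := orbitMk_surjective S y
      exact congrArg (orbitMk S) (f.anchor_map e))

/-- The functor `[X/G] → [(X/H)/Γ]`. -/
def functor : BasedFunctor (smoothQuotientStack k n G X)
    (smoothQuotientStack r m Γ (OrbitSpace S X)) where
  toFunctor :=
    show SmoothQuotObj k n G X ⥤ SmoothQuotObj r m Γ (OrbitSpace S X) from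
    { obj := fun P => D.obj P
      map := fun f => D.map f
      map_id := fun P => SmoothQuotHom.hom_ext fun y => by
        obtain ⟨e, rfl⟩ := orbitMk_surjective S y
        rfl
      map_comp := fun f g => SmoothQuotHom.hom_ext fun y => by
        obtain ⟨e, rfl⟩ := orbitMk_surjective S y
        rfl }
  w := rfl

-- Two points of one `H`-orbit differ by some `h`; equality of the anchors makes `h` fix a point of
-- `X`, so `h = 1`. This injectivity of `E → E/H × X` underlies full faithfulness.
include D in
theorem eq_of_orbitMk_eq {e e' : P.total} (h : orbitMk S e = orbitMk S e')
    (ha : P.anchor e = P.anchor e') : e = e' := by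
  obtain ⟨a, rfl⟩ := orbitMk_eq_iff.1 h
  rw [P.anchor_smul] at ha
  rw [D.free a _ ha, map_one, one_smul]

theorem map_injective {f g : P ⟶ Q} (h : D.map f = D.map g) : f = g :=
  SmoothQuotHom.hom_ext fun e => D.eq_of_orbitMk_eq
    (congrFun (congrArg (fun φ : D.obj P ⟶ D.obj Q => fn φ.total) h) (orbitMk S e))
    ((f.anchor_map e).trans (g.anchor_map e).symm)

/-- The lift of a morphism is forced: the image of `e` must lie in the prescribed orbit and have the
anchor of `e`. Equivariance then follows from the same uniqueness, and only smoothness needs work.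
-/
theorem map_surjective (φ : D.obj P ⟶ D.obj Q) : ∃ f : P ⟶ Q, D.map f = φ := by
  let cP := (D.orbitAtlas P).charts
  let cQ := (D.orbitAtlas Q).charts
  have PQ := (D.orbitAtlas Q).principal
  have PP := (D.orbitAtlas P).principal
  obtain ⟨t, ht⟩ : ∃ t : OrbitSpace S P.total → OrbitSpace S Q.total, t = fn φ.total := ⟨_, rfl⟩
  have hts : ContMDiff (𝓡 (D.orbitAtlas P).dim) (𝓡 (D.orbitAtlas Q).dim) ∞ t := by
    rw [ht]; exact φ.total.contMDiff
  have ht1 : ∀ (γ : Γ) y, t (γ • y) = γ • t y := by rw [ht]; exact φ.map_smul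
  have ht2 : ∀ y, orbitMap S Q.anchor Q.anchor_smul (t y) = orbitMap S P.anchor P.anchor_smul y :=
    by rw [ht]; exact φ.anchor_map
  have ht3 : ∀ y, orbitLift S (fn Q.proj) (fun _ e => Q.isPrincipal.proj_smul _ e) (t y) =
      fn φ.base (orbitLift S (fn P.proj) (fun _ e => P.isPrincipal.proj_smul _ e) y) := by
    rw [ht]; exact φ.proj_total
  have hex : ∀ e : P.total, ∃ e' : Q.total,
      orbitMk S e' = t (orbitMk S e) ∧ Q.anchor e' = P.anchor e := by
    intro e
    obtain ⟨e₁, he₁⟩ := orbitMk_surjective S (t (orbitMk S e))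
    have h1 := ht2 (orbitMk S e)
    rw [← he₁, orbitMap_mk, orbitMap_mk] at h1
    obtain ⟨h, hh⟩ := orbitMk_eq_iff.1 h1.symm
    exact ⟨S.inl h • e₁, by rw [orbitMk_inl_smul, he₁], by rw [Q.anchor_smul, hh]⟩
  choose f hf1 hf2 using hex
  have := P.isPrincipal.contMDiffSMul
  have := Q.isPrincipal.contMDiffSMul
  have hsmooth : ContMDiff (𝓡 P.total.dim) (𝓡 Q.total.dim) ∞ f := by
    intro e
    obtain ⟨s, hs, hse, hπs⟩ := PQ.exists_section (f e)
    rw [hf1] at hs hse hπs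
    have hT : ContMDiff (𝓡 P.total.dim) (𝓡 (D.orbitAtlas Q).dim) ∞
        (fun z : P.total => t (orbitMk S z)) := hts.comp PP.contMDiff_proj
    have h1 : ContMDiffAt (𝓡 P.total.dim) (𝓡 Q.total.dim) ∞
        (fun z => s (t (orbitMk S z))) e := hs.comp e hT.contMDiffAt
    have h2 : ∀ᶠ z in 𝓝 e, orbitMk S (s (t (orbitMk S z))) = t (orbitMk S z) :=
      hT.continuous.continuousAt.eventually hπs
    -- A local section `s` produces a point in the right orbit but with the wrong anchor. The
    -- correcting element of `H` is measured in `X`, where `divAct` is smooth, and it is then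
    -- applied in the total space of `Q`.
    have h3 : ContMDiffAt (𝓡 P.total.dim) (𝓡 l) ∞
        (fun z => divAct (fun (h : H) (x : X) => S.inl h • x) (P.anchor z)
          (Q.anchor (s (t (orbitMk S z))))) e := by
      refine D.principal.contMDiffAt_divAct P.contMDiff_anchor.contMDiffAt
        (Q.contMDiff_anchor.contMDiffAt.comp e h1) ?_
      filter_upwards [h2] with z hz
      have := ht2 (orbitMk S z)
      rwa [← hz, orbitMap_mk, orbitMap_mk, eq_comm] at this
    refine (PQ.contMDiffAt_act h3 h1).congr_of_eventuallyEq ?_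
    filter_upwards [h2] with z hz
    refine D.eq_of_orbitMk_eq ?_ ?_
    · rw [orbitMk_inl_smul, hz, hf1]
    · have h4 := ht2 (orbitMk S z)
      rw [← hz, orbitMap_mk, orbitMap_mk, eq_comm] at h4
      rw [hf2, Q.anchor_smul]
      exact (D.principal.divAct_act h4).symm
  refine ⟨SmoothQuotHom.ofEquivariant φ.base ⟨f, hsmooth⟩ ?_ ?_ hf2, ?_⟩
  · intro g e
    refine D.eq_of_orbitMk_eq ?_ ?_
    · rw [hf1, ← rightHom_smul_orbitMk, ht1, ← rightHom_smul_orbitMk, hf1]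
    · rw [hf2, Q.anchor_smul, hf2, P.anchor_smul]
  · intro e
    have := ht3 (orbitMk S e)
    rwa [← hf1] at this
  · refine SmoothQuotHom.hom_ext fun y => ?_
    obtain ⟨e, rfl⟩ := orbitMk_surjective S y
    have := hf1 e
    rw [ht] at this
    exact this

end SmoothStages

/-! ### The pullback of an object of `[(X/H)/Γ]` along `X → X/H` -/

namespace SmoothStages

variable [LieGroup (𝓡 l) ∞ H] [LieGroup (𝓡 k) ∞ G] [LieGroup (𝓡 r) ∞ Γ]
  (D : SmoothStages l k r n m X S) (Q : SmoothQuotObj r m Γ (OrbitSpace S X))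

/-- The pullback of the total space of `Q` along `X → X/H`. -/
abbrev Pull : Type u := PullbackSpace D.principal Q.contMDiff_anchor

instance : MulAction G (D.Pull Q) where
  smul g p := ⟨(S.rightHom g • p.val.1, g • p.val.2), by
    rw [Q.anchor_smul, p.property, rightHom_smul_orbitMk]⟩
  one_smul p := by
    refine PullbackSpace.val_injective _ _ (Prod.ext ?_ ?_)
    · change S.rightHom 1 • p.val.1 = _
      rw [map_one, one_smul]
    · exact one_smul G p.val.2
  mul_smul a b p := by
    refine PullbackSpace.val_injective _ _ (Prod.ext ?_ ?_)
    · change S.rightHom (a * b) • p.val.1 = S.rightHom a • S.rightHom b • p.val.1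
      rw [map_mul, mul_smul]
    · exact mul_smul a b p.val.2

theorem pull_val_smul (g : G) (p : D.Pull Q) :
    (g • p).val = (S.rightHom g • p.val.1, g • p.val.2) := rfl

/-- Freeness of `Γ` on the first component shows that `g` and `g'` have the same image in `Γ`; they
then differ by an element of `H`, which freeness on `X` makes trivial. -/
theorem pull_smul_injective {g g' : G} {p : D.Pull Q} (h : g • p = g' • p) : g = g' := by
  have h1 := congrArg PullbackSpace.val h
  rw [pull_val_smul, pull_val_smul, Prod.mk.injEq] at h1
  have h2 : S.rightHom (g * g'⁻¹) = 1 := by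
    rw [map_mul, map_inv, Q.principal.act_injective h1.1, mul_inv_cancel]
  rw [← MonoidHom.mem_ker, ← S.range_inl_eq_ker_rightHom] at h2
  obtain ⟨a, ha⟩ := h2
  have h3 : a = 1 := D.free a (g' • p.val.2) (by rw [ha, smul_smul, ← h1.2]; simp)
  rw [h3, map_one] at ha
  exact (mul_inv_eq_one.1 ha.symm)

variable [ContMDiffSMul (𝓡 k) (𝓡 n) ∞ G X]

/-- The pullback of a principal `Γ`-bundle along `X → X/H` is a principal `G`-bundle. -/
theorem pull_principal : IsPrincipal k (Q.total.dim + l) Q.base.dim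
    (fun (g : G) (p : D.Pull Q) => g • p) (fun p => fn Q.proj p.val.1) where
  contMDiff_act := by
    have := Q.isPrincipal.contMDiffSMul
    intro q
    refine PullbackSpace.contMDiffAt_of_val ?_ ?_
    · refine ContMDiff.contMDiffAt ?_
      exact (D.contMDiff_rightHom.comp contMDiff_fst).smul
        ((PullbackSpace.contMDiff_fst D.principal Q.contMDiff_anchor).comp contMDiff_snd)
    · refine ContMDiff.contMDiffAt ?_
      exact contMDiff_fst.smul
        ((PullbackSpace.contMDiff_snd D.principal Q.contMDiff_anchor).comp contMDiff_snd)
  contMDiff_proj := Q.proj.contMDiff.comp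
    (PullbackSpace.contMDiff_fst D.principal Q.contMDiff_anchor)
  act_mul := mul_smul
  proj_act := fun g p => Q.isPrincipal.proj_smul _ _
  exists_localTriv b := by
    classical
    have := Q.isPrincipal.contMDiffSMul
    obtain ⟨tF, hF⟩ := Q.principal.exists_localTriv b
    obtain ⟨tX, hX⟩ := D.principal.exists_localTriv (Q.anchor (tF.sec b))
    -- The local section of `X → X/H` is extended by arbitrary preimages, so that the pair defining
    -- `sec` satisfies the fibre product condition for every `b`.
    let σ : OrbitSpace S X → X := fun z =>
      if z ∈ tX.base then tX.sec z else Function.surjInv (orbitMk_surjective S) z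
    have hσ : ∀ z, orbitMk S (σ z) = z := by
      intro z
      by_cases hz : z ∈ tX.base
      · simp only [σ, if_pos hz]; exact tX.proj_sec z hz
      · simp only [σ, if_neg hz]; exact Function.surjInv_eq _ z
    have hσs : ContMDiffOn (𝓡 m) (𝓡 n) ∞ σ tX.base :=
      tX.contMDiffOn_sec.congr fun z hz => if_pos hz
    let sec : Q.base → D.Pull Q := fun b =>
      ⟨(tF.sec b, σ (Q.anchor (tF.sec b))), (hσ _).symm⟩
    have hsecv : ∀ b, (sec b).val = (tF.sec b, σ (Q.anchor (tF.sec b))) := fun _ => rfl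
    let base : Set Q.base := tF.base ∩ (fun b => Q.anchor (tF.sec b)) ⁻¹' tX.base
    have hanch : ContMDiffOn (𝓡 Q.base.dim) (𝓡 m) ∞ (fun b => Q.anchor (tF.sec b)) tF.base :=
      Q.contMDiff_anchor.comp_contMDiffOn tF.contMDiffOn_sec
    have hbase : IsOpen base :=
      hanch.continuousOn.isOpen_inter_preimage tF.isOpen_base tX.isOpen_base
    have hσa : ContMDiffOn (𝓡 Q.base.dim) (𝓡 n) ∞ (fun b => σ (Q.anchor (tF.sec b))) base :=
      hσs.comp (hanch.mono Set.inter_subset_left) fun b hb => hb.2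
    have hsec : ContMDiffOn (𝓡 Q.base.dim) (𝓡 (Q.total.dim + l)) ∞ sec base := by
      intro b hb
      refine ContMDiffAt.contMDiffWithinAt (PullbackSpace.contMDiffAt_of_val ?_ ?_)
      · exact tF.contMDiffOn_sec.contMDiffAt (tF.isOpen_base.mem_nhds hb.1)
      · exact hσa.contMDiffAt (hbase.mem_nhds hb)
    -- If `g` lifts the `Γ`-coordinate of `p`, then `g` moves the section to a point that agrees
    -- with `p` up to an element of `H`.
    have key : ∀ (p : D.Pull Q) (g : G), fn Q.proj p.val.1 ∈ tF.base →
        S.rightHom g = tF.trans p.val.1 →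
        orbitMk S p.val.2 = orbitMk S (g • σ (Q.anchor (tF.sec (fn Q.proj p.val.1)))) := by
      intro p g hp hg
      rw [← rightHom_smul_orbitMk, hσ, ← Q.anchor_smul, hg, tF.trans_act_sec _ hp, p.property]
    have key2 : ∀ (p : D.Pull Q) (g : G) (h : H), fn Q.proj p.val.1 ∈ tF.base →
        S.rightHom g = tF.trans p.val.1 →
        S.inl h • g • σ (Q.anchor (tF.sec (fn Q.proj p.val.1))) = p.val.2 →
        (S.inl h * g) • sec (fn Q.proj p.val.1) = p := by
      intro p g h hp hg hh
      refine PullbackSpace.val_injective _ _ ?_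
      rw [pull_val_smul, hsecv]
      refine Prod.ext ?_ ?_
      · change S.rightHom (S.inl h * g) • tF.sec _ = _
        rw [map_mul, S.rightHom_inl, one_mul, hg, tF.trans_act_sec _ hp]
      · change (S.inl h * g) • σ _ = _
        rw [mul_smul, hh]
    have hdiv : ∀ (p : D.Pull Q) (g : G), g • sec (fn Q.proj p.val.1) = p →
        divAct (fun (g : G) (p : D.Pull Q) => g • p) p (sec (fn Q.proj p.val.1)) = g := by
      intro p g hg
      have hex : ∃ g : G, g • sec (fn Q.proj p.val.1) = p := ⟨g, hg⟩
      rw [divAct, dif_pos hex]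
      exact D.pull_smul_injective Q (hex.choose_spec.trans hg.symm)
    have hact : ∀ p : D.Pull Q, fn Q.proj p.val.1 ∈ tF.base →
        ∃ g : G, g • sec (fn Q.proj p.val.1) = p := by
      intro p hp
      obtain ⟨g, hg⟩ := S.rightHom_surjective (tF.trans p.val.1)
      obtain ⟨h, hh⟩ := orbitMk_eq_iff.1 (key p g hp hg)
      exact ⟨_, key2 p g h hp hg hh⟩
    have hproj : ∀ b ∈ base, fn Q.proj (sec b).val.1 = b := fun b hb => tF.proj_sec b hb.1
    have hfst := PullbackSpace.contMDiff_fst D.principal Q.contMDiff_anchor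
    have hsnd := PullbackSpace.contMDiff_snd D.principal Q.contMDiff_anchor
    have hπ : ContMDiff (𝓡 (Q.total.dim + l)) (𝓡 Q.base.dim) ∞
        (fun p : D.Pull Q => fn Q.proj p.val.1) := Q.proj.contMDiff.comp hfst
    refine ⟨{
      base := base
      isOpen_base := hbase
      sec := sec
      trans := fun p => divAct (fun (g : G) (p : D.Pull Q) => g • p) p (sec (fn Q.proj p.val.1))
      contMDiffOn_sec := hsec
      contMDiffOn_trans := ?_
      proj_sec := hproj
      trans_act_sec := ?_
      trans_smul_sec := ?_ }, hF, hX⟩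
    · intro p hp
      refine ContMDiffAt.contMDiffWithinAt ?_
      -- The `G`-coordinate is `h * ς γ`, where `γ` is the `Γ`-coordinate, `ς` a smooth section of
      -- `G → Γ` and `h` the correction in `H` measured in `X`; each factor is smooth.
      obtain ⟨U, ς, hU, hγ, hς, hςU⟩ := D.exists_section (tF.trans p.val.1)
      have hopen : IsOpen (fn Q.proj ⁻¹' tF.base) :=
        tF.isOpen_base.preimage Q.proj.contMDiff.continuous
      have h1 : ContMDiffAt (𝓡 (Q.total.dim + l)) (𝓡 r) ∞
          (fun z : D.Pull Q => tF.trans z.val.1) p :=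
        (tF.contMDiffOn_trans.contMDiffAt (hopen.mem_nhds hp.1)).comp p hfst.contMDiffAt
      have h2 : ContMDiffAt (𝓡 (Q.total.dim + l)) (𝓡 k) ∞
          (fun z : D.Pull Q => ς (tF.trans z.val.1)) p :=
        (hς.contMDiffAt (hU.mem_nhds hγ)).comp p h1
      have h3 : ContMDiffAt (𝓡 (Q.total.dim + l)) (𝓡 n) ∞
          (fun z : D.Pull Q => σ (Q.anchor (tF.sec (fn Q.proj z.val.1)))) p :=
        ContMDiffAt.comp p (hσa.contMDiffAt (hbase.mem_nhds hp)) hπ.contMDiffAt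
      have hev : ∀ᶠ z : D.Pull Q in 𝓝 p, fn Q.proj z.val.1 ∈ tF.base ∧
          S.rightHom (ς (tF.trans z.val.1)) = tF.trans z.val.1 := by
        filter_upwards [hπ.continuous.continuousAt.preimage_mem_nhds
          (tF.isOpen_base.mem_nhds hp.1), h1.continuousAt.preimage_mem_nhds (hU.mem_nhds hγ)]
          with z hz1 hz2
        exact ⟨hz1, hςU _ hz2⟩
      have h4 := D.principal.contMDiffAt_divAct hsnd.contMDiffAt (h2.smul h3)
        (hev.mono fun z hz => key z _ hz.1 hz.2)
      refine ((D.contMDiff_inl.contMDiffAt.comp p h4).mul h2).congr_of_eventuallyEq ?_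
      filter_upwards [hev] with z hz
      exact hdiv z _ (key2 z _ _ hz.1 hz.2 (D.principal.divAct_act (key z _ hz.1 hz.2)))
    · intro p hp
      obtain ⟨g, hg⟩ := hact p hp.1
      simp only [hdiv p g hg, hg]
    · intro g b hb
      have h1 : fn Q.proj (g • sec b).val.1 = b :=
        (Q.isPrincipal.proj_smul _ _).trans (hproj b hb)
      exact hdiv _ _ (by rw [h1])

variable [IsManifold (𝓡 n) ∞ X] [T2Space X] [SecondCountableTopology X]

/-- The object of `[X/G]` obtained by pulling back along `X → X/H`. -/
def pullObj : SmoothQuotObj k n G X where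
  base := Q.base
  total := { carrier := D.Pull Q, dim := Q.total.dim + l }
  action := inferInstanceAs (MulAction G (D.Pull Q))
  proj := ⟨fun p : D.Pull Q => fn Q.proj p.val.1, (D.pull_principal Q).contMDiff_proj⟩
  isPrincipal := (D.pull_principal Q).isSmoothPrincipalBundle
  anchor := fun p : D.Pull Q => p.val.2
  contMDiff_anchor := PullbackSpace.contMDiff_snd D.principal Q.contMDiff_anchor
  anchor_smul := fun _ _ => rfl

/-- The quotient by `H` of the pullback is the given object. -/
def objPullObj : D.obj (D.pullObj Q) ⟶ Q :=
  let P := D.pullObj Q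
  let := (D.orbitAtlas P).charts
  have hinv : ∀ (h : H) (p : D.Pull Q), (S.inl h • p).val.1 = p.val.1 := fun h p => by
    rw [pull_val_smul, S.rightHom_inl, one_smul]
  SmoothQuotHom.ofEquivariant (P := D.obj P) (𝟙 Q.base)
    ⟨orbitLift (E := P.total) S (fun p : D.Pull Q => p.val.1) hinv,
      contMDiff_orbitLift (E := P.total) (f := fun p : D.Pull Q => p.val.1)
        (D.orbitAtlas P).principal hinv
        (PullbackSpace.contMDiff_fst D.principal Q.contMDiff_anchor)⟩
    (by
      intro γ y
      obtain ⟨p, rfl⟩ := orbitMk_surjective (E := P.total) S y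
      obtain ⟨g, rfl⟩ := S.rightHom_surjective γ
      exact (congrArg (orbitLift (E := P.total) S (fun p : D.Pull Q => p.val.1) hinv)
        (rightHom_smul_orbitMk (X := P.total) S g p)).trans rfl)
    (by
      intro y
      obtain ⟨p, rfl⟩ := orbitMk_surjective (E := P.total) S y
      rfl)
    (by
      intro y
      obtain ⟨p, rfl⟩ := orbitMk_surjective (E := P.total) S y
      exact PullbackSpace.property (P := D.principal) (hf := Q.contMDiff_anchor) p)

instance : D.functor.toFunctor.Faithful where
  map_injective h := D.map_injective h

instance : D.functor.toFunctor.Full where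
  map_surjective f := D.map_surjective f

/-- Beyond essential surjectivity, the isomorphism lies over an identity of the base; this is what
allows the functor to be inverted strictly over `Diff`. -/
theorem exists_vertical_iso (Q : (smoothQuotientStack r m Γ (OrbitSpace S X)).obj) :
    ∃ (P : (smoothQuotientStack k n G X).obj) (i : D.functor.obj P ≅ Q),
      (smoothQuotientStack r m Γ (OrbitSpace S X)).p.IsHomLift
        (𝟙 ((smoothQuotientStack r m Γ (OrbitSpace S X)).p.obj Q)) i.hom := by
  let Q' : SmoothQuotObj r m Γ (OrbitSpace S X) := Q
  have : IsIso (D.objPullObj Q').base := inferInstanceAs (IsIso (𝟙 Q'.base))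
  have := SmoothQuotHom.isIso_of_isIso_base (D.objPullObj Q')
  let i : D.obj (D.pullObj Q') ≅ Q' := asIso (D.objPullObj Q')
  refine ⟨D.pullObj Q', i, ?_⟩
  exact IsHomLift.map (smoothQuotientStack r m Γ (OrbitSpace S X)).p (D.objPullObj Q')

end SmoothStages

end Stages

/-! ### Topological principal bundles -/

section TopPrincipal

variable {G E B : Type u} [Group G] [TopologicalSpace G] [TopologicalSpace E] [TopologicalSpace B]
  [MulAction G E] {π : E → B}

variable (G π) in
/-- An equivariant local trivialization, presented by a local section and the group coordinate. -/
structure TopLocalTriv where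
  base : Set B
  isOpen_base : IsOpen base
  sec : B → E
  trans : E → G
  continuousOn_sec : ContinuousOn sec base
  continuousOn_trans : ContinuousOn trans (π ⁻¹' base)
  proj_sec : ∀ b ∈ base, π (sec b) = b
  trans_smul : ∀ e, π e ∈ base → trans e • sec (π e) = e
  trans_smul_sec : ∀ (g : G), ∀ b ∈ base, trans (g • sec b) = g

theorem IsTopPrincipalBundle.of_localTriv [ContinuousSMul G E] (hπ : Continuous π)
    (hinv : ∀ (g : G) (e : E), π (g • e) = π e)
    (h : ∀ b, ∃ t : TopLocalTriv G π, b ∈ t.base) : IsTopPrincipalBundle G π where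
  continuousSMul := inferInstance
  proj_smul := hinv
  locally_trivial b := by
    obtain ⟨t, hb⟩ := h b
    refine ⟨{
      toFun := fun e => (π e, t.trans e)
      invFun := fun p => p.2 • t.sec p.1
      source := π ⁻¹' t.base
      target := t.base ×ˢ Set.univ
      map_source' := fun e he => ⟨he, trivial⟩
      map_target' := fun p hp => by
        rw [Set.mem_preimage, hinv, t.proj_sec _ hp.1]
        exact hp.1
      left_inv' := fun e he => t.trans_smul e he
      right_inv' := fun p hp => by
        refine Prod.ext ?_ (t.trans_smul_sec _ _ hp.1)
        exact (hinv _ _).trans (t.proj_sec _ hp.1)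
      open_source := t.isOpen_base.preimage hπ
      open_target := t.isOpen_base.prod isOpen_univ
      continuousOn_toFun := hπ.continuousOn.prodMk t.continuousOn_trans
      continuousOn_invFun := continuous_snd.continuousOn.smul
        (t.continuousOn_sec.comp continuous_fst.continuousOn fun p hp => hp.1)
      baseSet := t.base
      open_baseSet := t.isOpen_base
      source_eq := rfl
      target_eq := rfl
      proj_toFun := fun e he => rfl }, hb, fun g e he => ?_⟩
    change t.trans (g • e) = g * t.trans e
    conv_lhs => rw [← t.trans_smul e he, smul_smul]
    exact t.trans_smul_sec _ _ he

namespace IsTopPrincipalBundle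

variable (h : IsTopPrincipalBundle G π)

include h

theorem exists_localTriv (b : B) : ∃ t : TopLocalTriv G π, b ∈ t.base := by
  obtain ⟨t, hb, hG⟩ := h.locally_trivial b
  have hsrc : ∀ e, e ∈ t.source ↔ π e ∈ t.baseSet := fun e => t.mem_source
  have htar : ∀ (b : B) (g : G), b ∈ t.baseSet → (b, g) ∈ t.target := fun b g hb =>
    t.mem_target.2 hb
  have hproj : ∀ c ∈ t.baseSet, π (t.toOpenPartialHomeomorph.symm (c, 1)) = c := fun c hc =>
    t.proj_symm_apply (htar c 1 hc)
  have hval : ∀ c ∈ t.baseSet, (t (t.toOpenPartialHomeomorph.symm (c, 1))).2 = 1 := fun c hc => by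
    rw [t.apply_symm_apply (htar c 1 hc)]
  refine ⟨{
    base := t.baseSet
    isOpen_base := t.open_baseSet
    sec := fun c => t.toOpenPartialHomeomorph.symm (c, 1)
    trans := fun e => (t e).2
    continuousOn_sec := t.continuousOn_invFun.comp (by fun_prop) fun c hc => htar c 1 hc
    continuousOn_trans := continuous_snd.comp_continuousOn
      (t.continuousOn_toFun.mono fun e he => (hsrc e).2 he)
    proj_sec := hproj
    trans_smul := fun e he => ?_
    trans_smul_sec := fun g c hc => ?_ }, hb⟩
  · have h1 : π ((t e).2 • t.toOpenPartialHomeomorph.symm (π e, 1)) = π e := by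
      rw [h.proj_smul, hproj _ he]
    have h2 : (t e).2 • t.toOpenPartialHomeomorph.symm (π e, 1) ∈ t.source := by
      rw [hsrc, h1]; exact he
    refine t.injOn h2 ((hsrc e).2 he) (Prod.ext ?_ ?_)
    · change (t _).1 = (t e).1
      rw [t.coe_fst h2, t.coe_fst ((hsrc e).2 he), h1]
    · change (t _).2 = (t e).2
      rw [hG _ _ (by rw [hproj _ he]; exact he), hval _ he, mul_one]
  · rw [hG _ _ (by rw [hproj _ hc]; exact hc), hval _ hc, mul_one]

/-- Continuity of the projection is not part of the definition of a topological principal bundle; it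
follows from local triviality. -/
theorem continuous_proj : Continuous π := by
  rw [continuous_iff_continuousAt]
  intro e
  obtain ⟨t, ht, -⟩ := h.locally_trivial (π e)
  exact t.continuousAt_proj (t.mem_source.2 ht)

omit h in
theorem _root_.QuotientStacks.TopLocalTriv.trans_smul_eq (t : TopLocalTriv G π) (g : G) {e : E}
    (he : π e ∈ t.base) : t.trans (g • e) = g * t.trans e := by
  conv_lhs => rw [← t.trans_smul e he, smul_smul]
  exact t.trans_smul_sec _ _ he

theorem smul_injective {g g' : G} {e : E} (hg : g • e = g' • e) : g = g' := by
  obtain ⟨t, ht⟩ := h.exists_localTriv (π e)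
  have := congrArg t.trans hg
  rw [t.trans_smul_eq g ht, t.trans_smul_eq g' ht] at this
  exact mul_right_cancel this

theorem exists_smul_eq {e e' : E} (he : π e = π e') : ∃ g : G, g • e' = e := by
  obtain ⟨t, ht⟩ := h.exists_localTriv (π e)
  refine ⟨t.trans e * (t.trans e')⁻¹, ?_⟩
  have ht' : π e' ∈ t.base := he ▸ ht
  rw [mul_smul, inv_smul_eq_iff.2 (t.trans_smul e' ht').symm, ← he]
  exact t.trans_smul e ht

theorem surjective : Function.Surjective π := fun b => by
  obtain ⟨t, ht⟩ := h.exists_localTriv b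
  exact ⟨_, t.proj_sec b ht⟩

theorem divAct_smul {e e' : E} (he : π e = π e') :
    divAct (fun (g : G) (e : E) => g • e) e e' • e' = e := by
  have h' := h.exists_smul_eq he
  rw [divAct, dif_pos h']
  exact h'.choose_spec

theorem divAct_eq {e e' : E} {g : G} (hg : g • e' = e) :
    divAct (fun (g : G) (e : E) => g • e) e e' = g :=
  h.smul_injective ((h.divAct_smul (by rw [← hg, h.proj_smul])).trans hg.symm)

variable {T : Type*} [TopologicalSpace T]

theorem continuousAt_divAct [IsTopologicalGroup G] {u v : T → E} {x : T} (hu : ContinuousAt u x)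
    (hv : ContinuousAt v x) (huv : ∀ᶠ z in 𝓝 x, π (u z) = π (v z)) :
    ContinuousAt (fun z => divAct (fun (g : G) (e : E) => g • e) (u z) (v z)) x := by
  obtain ⟨t, ht⟩ := h.exists_localTriv (π (u x))
  have hux := huv.self_of_nhds
  have hopen : IsOpen (π ⁻¹' t.base) := t.isOpen_base.preimage h.continuous_proj
  have h1 : ContinuousAt (fun z => t.trans (u z)) x :=
    ContinuousAt.comp (t.continuousOn_trans.continuousAt (hopen.mem_nhds ht)) hu
  have h2 : ContinuousAt (fun z => t.trans (v z)) x :=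
    ContinuousAt.comp (t.continuousOn_trans.continuousAt (hopen.mem_nhds (by
      rw [Set.mem_preimage, ← hux]; exact ht))) hv
  refine (h1.mul h2.inv).congr_of_eventuallyEq ?_
  filter_upwards [huv, hu.preimage_mem_nhds (hopen.mem_nhds ht)] with z hz hzt
  have hzt' : π (v z) ∈ t.base := hz ▸ hzt
  have h3 := congrArg t.trans (h.divAct_smul hz)
  rw [t.trans_smul_eq _ hzt'] at h3
  exact eq_mul_inv_of_mul_eq h3

/-- A continuous local section through a given point. -/
theorem exists_section (e : E) :
    ∃ s : B → E, ContinuousAt s (π e) ∧ s (π e) = e ∧ ∀ᶠ b in 𝓝 (π e), π (s b) = b := by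
  have := h.continuousSMul
  obtain ⟨t, ht⟩ := h.exists_localTriv (π e)
  refine ⟨fun b => t.trans e • t.sec b, continuousAt_const.smul
    (t.continuousOn_sec.continuousAt (t.isOpen_base.mem_nhds ht)), t.trans_smul e ht, ?_⟩
  filter_upwards [t.isOpen_base.mem_nhds ht] with b hb
  rw [h.proj_smul, t.proj_sec b hb]

variable {E' B' : Type u} [TopologicalSpace E'] [TopologicalSpace B'] [MulAction G E']
  {π' : E' → B'}

/-- A morphism of topological principal bundles is Cartesian. -/
theorem exists_lift [IsTopologicalGroup G] (h' : IsTopPrincipalBundle G π')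
    {F : E → E'} {f : B → B'} (hF : Continuous F) (hFs : ∀ (g : G) e, F (g • e) = g • F e)
    (hFf : ∀ e, π' (F e) = f (π e)) {u : T → E'} {v : T → B} (hu : Continuous u)
    (hv : Continuous v) (huv : ∀ t, π' (u t) = f (v t)) :
    ∃ w : T → E, Continuous w ∧ (∀ t, F (w t) = u t) ∧ ∀ t, π (w t) = v t := by
  have := h.continuousSMul
  have hex : ∀ t, ∃ e, F e = u t ∧ π e = v t := by
    intro t
    obtain ⟨e, he⟩ := h.surjective (v t)
    obtain ⟨g, hg⟩ := h'.exists_smul_eq (e := u t) (e' := F e) (by rw [hFf, he, huv])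
    exact ⟨g • e, by rw [hFs, hg], by rw [h.proj_smul, he]⟩
  choose w hw1 hw2 using hex
  refine ⟨w, continuous_iff_continuousAt.2 fun t => ?_, hw1, hw2⟩
  obtain ⟨s, hs, hst, hπs⟩ := h.exists_section (w t)
  rw [hw2 t] at hs hst hπs
  have h1 : ContinuousAt (fun z => s (v z)) t := ContinuousAt.comp hs hv.continuousAt
  have hπ1 : ∀ᶠ z in 𝓝 t, π (s (v z)) = v z := hv.continuousAt.eventually hπs
  have h2 : ContinuousAt
      (fun z => divAct (fun (g : G) (e : E') => g • e) (u z) (F (s (v z)))) t := by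
    refine h'.continuousAt_divAct hu.continuousAt (ContinuousAt.comp hF.continuousAt h1) ?_
    filter_upwards [hπ1] with z hz
    rw [hFf, hz, huv]
  refine (h2.smul h1).congr_of_eventuallyEq ?_
  filter_upwards [hπ1] with z hz
  obtain ⟨g, hg⟩ := h.exists_smul_eq (e := w z) (e' := s (v z)) (by rw [hw2, hz])
  have : g • F (s (v z)) = u z := by rw [← hFs, hg, hw1]
  rw [Pi.smul_apply', h'.divAct_eq this, hg]

theorem lift_unique (h' : IsTopPrincipalBundle G π') {F : E → E'}
    (hFs : ∀ (g : G) e, F (g • e) = g • F e) {e₁ e₂ : E}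
    (hF : F e₁ = F e₂) (hπ : π e₁ = π e₂) : e₁ = e₂ := by
  obtain ⟨g, rfl⟩ := h.exists_smul_eq hπ
  rw [hFs] at hF
  have : g = 1 := h'.smul_injective (hF.trans (one_smul G _).symm)
  rw [this, one_smul]

end IsTopPrincipalBundle

end TopPrincipal

/-! ### Morphisms of topological quotient stacks -/

section TopQuot

variable {G : Type u} [Group G] [TopologicalSpace G] {X : Type u} [TopologicalSpace X]
  [MulAction G X] {P Q : TopQuotObj G X}

/-- The morphism of `[X/G]` given by an equivariant map. -/
def TopQuotHom.ofEquivariant [IsTopologicalGroup G] (b : P.base ⟶ Q.base)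
    (t : P.total ⟶ Q.total) (ht : ∀ (g : G) (e : P.total), t (g • e) = g • t e)
    (htb : ∀ e, Q.proj (t e) = b (P.proj e))
    (hta : ∀ e, Q.anchor (t e) = P.anchor e) : P ⟶ Q :=
  { base := b
    total := t
    map_smul := ht
    isPullback := by
      have hlift : ∀ s : PullbackCone Q.proj b, ∃ w : s.pt ⟶ P.total, w ≫ t = s.fst ∧
          w ≫ P.proj = s.snd := by
        intro s
        obtain ⟨w, hw, h1, h2⟩ := P.isPrincipal.exists_lift Q.isPrincipal t.hom.continuous ht htb
          s.fst.hom.continuous s.snd.hom.continuous fun z => ConcreteCategory.congr_hom s.condition z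
        refine ⟨TopCat.ofHom ⟨w, hw⟩, ?_, ?_⟩
        · ext z; exact h1 z
        · ext z; exact h2 z
      choose lift h1 h2 using hlift
      refine ⟨⟨by ext z; exact htb z⟩, ⟨PullbackCone.IsLimit.mk _ lift h1 h2 ?_⟩⟩
      intro s w hw1 hw2
      ext z
      exact P.isPrincipal.lift_unique Q.isPrincipal ht
        (ConcreteCategory.congr_hom (hw1.trans (h1 s).symm) z)
        (ConcreteCategory.congr_hom (hw2.trans (h2 s).symm) z)
    anchor_map := hta }

theorem TopQuotHom.proj_total (f : P ⟶ Q) (e : P.total) :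
    Q.proj (f.total e) = f.base (P.proj e) :=
  ConcreteCategory.congr_hom f.isPullback.w e

theorem TopQuotHom.hom_ext {f g : P ⟶ Q} (h : ∀ e, f.total e = g.total e) : f = g := by
  have ht : f.total = g.total := by ext z; exact h z
  refine TopQuotHom.ext ?_ ht
  ext b
  obtain ⟨e, rfl⟩ := P.isPrincipal.surjective b
  rw [← TopQuotHom.proj_total f, ← TopQuotHom.proj_total g, ht]

/-- A morphism of `[X/G]` over an isomorphism is an isomorphism. -/
theorem TopQuotHom.isIso_of_isIso_base (f : P ⟶ Q) [IsIso f.base] : IsIso f := by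
  have : IsIso f.total := f.isPullback.isIso_fst_of_isIso
  have hinv : ∀ e, inv f.total (f.total e) = e := fun e =>
    ConcreteCategory.congr_hom (IsIso.hom_inv_id f.total) e
  have hinv' : ∀ e, f.total (inv f.total e) = e := fun e =>
    ConcreteCategory.congr_hom (IsIso.inv_hom_id f.total) e
  refine ⟨⟨{
    base := inv f.base
    total := inv f.total
    map_smul := fun g e => ?_
    isPullback := IsPullback.of_horiz_isIso ⟨by
      rw [IsIso.inv_comp_eq, ← Category.assoc, IsIso.eq_comp_inv, f.isPullback.w]⟩
    anchor_map := fun e => ?_ }, ?_, ?_⟩⟩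
  · conv_lhs => rw [← hinv' e, ← f.map_smul, hinv]
  · conv_rhs => rw [← hinv' e, f.anchor_map]
  · exact TopQuotHom.ext (IsIso.hom_inv_id f.base) (IsIso.hom_inv_id f.total)
  · exact TopQuotHom.ext (IsIso.inv_hom_id f.base) (IsIso.inv_hom_id f.total)

end TopQuot

/-! ### Quotients in stages over topological spaces -/

section TopStages

variable {H G Γ X : Type u} [Group H] [Group G] [TopologicalSpace G] [IsTopologicalGroup G]
  [Group Γ] [TopologicalSpace Γ] [IsTopologicalGroup Γ]
  [TopologicalSpace X] [MulAction G X] {S : GroupExtension H G Γ}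

theorem mem_range_inl_smul {E : Type u} [MulAction G E] {e e' : E} :
    orbitMk S e = orbitMk S e' ↔ ∃ h : S.inl.range, h • e' = e := by
  rw [orbitMk_eq_iff]
  constructor
  · rintro ⟨h, rfl⟩; exact ⟨⟨S.inl h, h, rfl⟩, rfl⟩
  · rintro ⟨⟨_, h, rfl⟩, rfl⟩; exact ⟨h, rfl⟩

theorem orbitMk_range_smul {E : Type u} [MulAction G E] (h : S.inl.range) (e : E) :
    orbitMk S (h • e) = orbitMk S e := mem_range_inl_smul.2 ⟨h, rfl⟩

theorem rightHom_range (h : S.inl.range) : S.rightHom (h : G) = 1 := by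
  obtain ⟨_, h, rfl⟩ := h
  exact S.rightHom_inl h

/-- The residual action on the orbit space is continuous. -/
theorem continuousSMul_orbitSpace (hφ : IsQuotientMap S.rightHom) (E : Type u)
    [TopologicalSpace E] [MulAction G E] [ContinuousSMul G E] :
    ContinuousSMul Γ (OrbitSpace S E) := by
  have h1 : IsOpenQuotientMap S.rightHom :=
    MonoidHom.isOpenQuotientMap_of_isQuotientMap hφ
  -- Both quotient maps are open, so their product is again a quotient map and continuity can be
  -- tested on `G × E`.
  have h2 := h1.prodMap (isOpenQuotientMap_orbitMk S (E := E))
  refine ⟨h2.isQuotientMap.continuous_iff.2 ?_⟩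
  exact ((isOpenQuotientMap_orbitMk S (E := E)).continuous.comp
    (continuous_smul (M := G) (X := E))).congr fun p => (rightHom_smul_orbitMk S p.1 p.2).symm

variable (S X) in
/-- An extension of topological groups whose kernel acts on `X` with a principal bundle as orbit
projection. -/
structure TopStages : Prop where
  isQuotientMap : IsQuotientMap S.rightHom
  principal : IsTopPrincipalBundle S.inl.range (orbitMk S : X → OrbitSpace S X)

namespace TopStages

variable [ContinuousSMul G X] (D : TopStages X S)

include D

/-- A space mapping equivariantly to `X` is a principal bundle over its orbit space. -/
theorem principal_of_equivariant {E : Type u} [TopologicalSpace E] [MulAction G E]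
    [ContinuousSMul G E] {a : E → X} (ha : Continuous a)
    (hae : ∀ (g : G) (e : E), a (g • e) = g • a e) :
    IsTopPrincipalBundle S.inl.range (orbitMk S : E → OrbitSpace S E) := by
  have hq := isOpenQuotientMap_orbitMk S (E := E)
  have hae' : ∀ (g : S.inl.range) (e : E), a (g • e) = g • a e := fun g e => hae g e
  have hmap : Continuous (orbitMap S a hae) :=
    hq.isQuotientMap.continuous_iff.2 ((isOpenQuotientMap_orbitMk S).continuous.comp ha)
  refine .of_localTriv hq.continuous orbitMk_range_smul fun y => ?_
  obtain ⟨t, ht⟩ := D.principal.exists_localTriv (orbitMap S a hae y)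
  -- Dividing `e` by the group coordinate of its image in `X` gives a point of the same orbit that
  -- depends only on the orbit, hence a continuous local section of `E → E/H`.
  let f : E → E := fun e => (t.trans (a e))⁻¹ • e
  have hf : ∀ (h : S.inl.range) (e : E), orbitMk S (a e) ∈ t.base → f (h • e) = f e := by
    intro h e he
    simp only [f]
    rw [hae', t.trans_smul_eq h he, mul_inv_rev, mul_smul, inv_smul_smul]
  let s : OrbitSpace S E → E := fun y => f (Function.surjInv (orbitMk_surjective S) y)
  have hs : ∀ e, orbitMk S (a e) ∈ t.base → s (orbitMk S e) = f e := by
    intro e he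
    obtain ⟨h, hh⟩ := mem_range_inl_smul.1
      (Function.surjInv_eq (orbitMk_surjective S) (orbitMk S e))
    simp only [s]
    rw [← hh, hf h e he]
  have hopen : IsOpen {e | orbitMk S (a e) ∈ t.base} :=
    t.isOpen_base.preimage (D.principal.continuous_proj.comp ha)
  have htrans : ContinuousOn (fun e => t.trans (a e)) {e | orbitMk S (a e) ∈ t.base} :=
    t.continuousOn_trans.comp ha.continuousOn fun e he => he
  refine ⟨{
    base := orbitMap S a hae ⁻¹' t.base
    isOpen_base := t.isOpen_base.preimage hmap
    sec := s
    trans := fun e => t.trans (a e)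
    continuousOn_sec := ?_
    continuousOn_trans := htrans
    proj_sec := ?_
    trans_smul := ?_
    trans_smul_sec := ?_ }, ht⟩
  · rw [hq.isQuotientMap.continuousOn_isOpen_iff (t.isOpen_base.preimage hmap)]
    refine ContinuousOn.congr (f := f) (htrans.inv.smul continuousOn_id) fun e he => hs e he
  · intro y hy
    obtain ⟨e, rfl⟩ := orbitMk_surjective S y
    rw [hs e hy]
    exact orbitMk_range_smul _ _
  · intro e he
    rw [hs e he]
    exact smul_inv_smul _ _
  · intro g y hy
    obtain ⟨e, rfl⟩ := orbitMk_surjective S y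
    have hy' : orbitMk S (a e) ∈ t.base := hy
    rw [hs e hy]
    simp only [f]
    rw [hae', hae', t.trans_smul_eq g (by rw [orbitMk_range_smul]; exact hy'),
      t.trans_smul_eq _ hy', inv_mul_cancel, mul_one]

/-- If `E` is a principal `G`-bundle, then `E/H` is a principal `G/H`-bundle. -/
theorem principal_orbitSpace {E B : Type u} [TopologicalSpace E] [TopologicalSpace B]
    [MulAction G E] {π : E → B} (h : IsTopPrincipalBundle G π) :
    IsTopPrincipalBundle Γ (orbitLift S π fun _ e => h.proj_smul _ e) := by
  have := h.continuousSMul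
  have := continuousSMul_orbitSpace D.isQuotientMap E
  have hq := isOpenQuotientMap_orbitMk S (E := E)
  have hcont : Continuous (orbitLift S π fun _ e => h.proj_smul _ e) :=
    hq.isQuotientMap.continuous_iff.2 h.continuous_proj
  refine .of_localTriv hcont
    (orbitLift_smul S π h.proj_smul) fun b => ?_
  obtain ⟨t, ht⟩ := h.exists_localTriv b
  let τ : OrbitSpace S E → Γ := fun y =>
    S.rightHom (t.trans (Function.surjInv (orbitMk_surjective S) y))
  have hτ : ∀ e, π e ∈ t.base → τ (orbitMk S e) = S.rightHom (t.trans e) := by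
    intro e he
    obtain ⟨a, ha⟩ := orbitMk_eq_iff.1
      (Function.surjInv_eq (orbitMk_surjective S) (orbitMk S e))
    simp only [τ]
    rw [← ha, t.trans_smul_eq _ he, map_mul, S.rightHom_inl, one_mul]
  have hopen : IsOpen (orbitLift S π (fun _ e => h.proj_smul _ e) ⁻¹' t.base) :=
    t.isOpen_base.preimage hcont
  refine ⟨{
    base := t.base
    isOpen_base := t.isOpen_base
    sec := fun b => orbitMk S (t.sec b)
    trans := τ
    continuousOn_sec := hq.continuous.comp_continuousOn t.continuousOn_sec
    continuousOn_trans := ?_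
    proj_sec := fun b hb => t.proj_sec b hb
    trans_smul := ?_
    trans_smul_sec := ?_ }, ht⟩
  · rw [hq.isQuotientMap.continuousOn_isOpen_iff hopen]
    exact ContinuousOn.congr (D.isQuotientMap.continuous.comp_continuousOn t.continuousOn_trans)
      fun e he => hτ e he
  · intro y hy
    obtain ⟨e, rfl⟩ := orbitMk_surjective S y
    rw [hτ e hy, rightHom_smul_orbitMk, orbitLift_mk, t.trans_smul e hy]
  · intro γ b hb
    obtain ⟨g, rfl⟩ := S.rightHom_surjective γ
    rw [rightHom_smul_orbitMk, hτ _ (by rw [h.proj_smul, t.proj_sec b hb]; exact hb),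
      t.trans_smul_sec g b hb]

/-- Local sections of the quotient homomorphism, obtained from those of an orbit projection. -/
theorem exists_section [Nonempty X] (γ₀ : Γ) :
    ∃ (U : Set Γ) (s : Γ → G), IsOpen U ∧ γ₀ ∈ U ∧ ContinuousOn s U ∧
      ∀ γ ∈ U, S.rightHom (s γ) = γ := by
  have hφ : IsOpenQuotientMap S.rightHom :=
    MonoidHom.isOpenQuotientMap_of_isQuotientMap D.isQuotientMap
  obtain ⟨x₀⟩ := ‹Nonempty X›
  obtain ⟨g₀, rfl⟩ := S.rightHom_surjective γ₀
  obtain ⟨t, ht⟩ := D.principal.exists_localTriv (orbitMk S (g₀ • x₀))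
  -- Replacing `g` by `h * g`, with `h` from the kernel, multiplies the coordinate of `g • x₀` by
  -- `h` on the left, so `f` depends only on the class of `g` in `Γ`; it lies in that class and is
  -- continuous near `g₀`. The trivialization of `X` thus yields one of `G → Γ`.
  let f : G → G := fun g => ((t.trans (g • x₀) : S.inl.range) : G)⁻¹ * g
  let s : Γ → G := fun γ => f (Function.surjInv S.rightHom_surjective γ)
  have hs : ∀ g, orbitMk S (g • x₀) ∈ t.base → s (S.rightHom g) = f g := by
    intro g hg
    let g' := Function.surjInv S.rightHom_surjective (S.rightHom g)
    have hg' : S.rightHom g' = S.rightHom g := Function.surjInv_eq S.rightHom_surjective _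
    have hmem : g' * g⁻¹ ∈ S.inl.range := by
      rw [S.range_inl_eq_ker_rightHom, MonoidHom.mem_ker]
      simp [hg']
    have h1 : t.trans (g' • x₀) = ⟨g' * g⁻¹, hmem⟩ * t.trans (g • x₀) := by
      rw [← t.trans_smul_eq _ hg]
      congr 1
      change g' • x₀ = (g' * g⁻¹) • g • x₀
      rw [smul_smul, inv_mul_cancel_right]
    change f g' = f g
    simp only [f, h1]
    simp [mul_assoc]
  have hmem : ∀ g, S.rightHom g ∈ (fun γ => γ • orbitMk S x₀) ⁻¹' t.base ↔
      orbitMk S (g • x₀) ∈ t.base := fun g => by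
    rw [Set.mem_preimage, rightHom_smul_orbitMk]
  have := continuousSMul_orbitSpace D.isQuotientMap X
  have hopen : IsOpen ((fun γ : Γ => γ • orbitMk S x₀) ⁻¹' t.base) :=
    t.isOpen_base.preimage (by fun_prop)
  refine ⟨(fun γ : Γ => γ • orbitMk S x₀) ⁻¹' t.base, s, hopen, (hmem g₀).2 ht, ?_, ?_⟩
  · rw [hφ.isQuotientMap.continuousOn_isOpen_iff hopen]
    refine ContinuousOn.congr (f := f) ?_ fun g hg => hs g ((hmem g).1 hg)
    refine ContinuousOn.mul (ContinuousOn.inv ?_) continuousOn_id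
    refine continuous_subtype_val.comp_continuousOn (t.continuousOn_trans.comp ?_ ?_)
    · exact (Continuous.continuousOn (by fun_prop))
    · exact fun g hg => (hmem g).1 hg
  · intro γ hγ
    obtain ⟨g, rfl⟩ := S.rightHom_surjective γ
    rw [hs g ((hmem g).1 hγ)]
    simp only [f]
    rw [map_mul, map_inv, rightHom_range, inv_one, one_mul]

end TopStages

/-! ### The functor over `Top`, its full faithfulness and its essential surjectivity. -/

namespace TopStages

variable [ContinuousSMul G X] (D : TopStages X S) (P : TopQuotObj G X)

include D in
theorem principal_total :
    IsTopPrincipalBundle S.inl.range (orbitMk S : P.total → OrbitSpace S P.total) :=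
  have := P.isPrincipal.continuousSMul
  D.principal_of_equivariant P.anchor.continuous P.anchor_smul

theorem continuous_orbitLift {E B : Type u} [TopologicalSpace E] [TopologicalSpace B]
    [MulAction G E] [ContinuousSMul G E] {f : E → B}
    (hf : ∀ (h : H) (e : E), f (S.inl h • e) = f e) (hc : Continuous f) :
    Continuous (orbitLift S f hf) :=
  (isOpenQuotientMap_orbitMk S).isQuotientMap.continuous_iff.2 hc

theorem continuous_orbitMap {E E' : Type u} [TopologicalSpace E] [TopologicalSpace E']
    [MulAction G E] [ContinuousSMul G E] [MulAction G E'] [ContinuousSMul G E'] {f : E → E'}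
    (hf : ∀ (g : G) (e : E), f (g • e) = g • f e) (hc : Continuous f) :
    Continuous (orbitMap S f hf) :=
  continuous_orbitLift _ ((isOpenQuotientMap_orbitMk S).continuous.comp hc)

/-- The object `(B ← E/H → X/H)` of `[(X/H)/Γ]` associated to an object of `[X/G]`. -/
def obj : TopQuotObj Γ (OrbitSpace S X) :=
  have := P.isPrincipal.continuousSMul
  { base := P.base
    total := TopCat.of (OrbitSpace S P.total)
    action := inferInstanceAs (MulAction Γ (OrbitSpace S P.total))
    proj := TopCat.ofHom ⟨orbitLift S P.proj fun _ e => P.isPrincipal.proj_smul _ e,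
      continuous_orbitLift _ P.isPrincipal.continuous_proj⟩
    isPrincipal := D.principal_orbitSpace P.isPrincipal
    anchor := ⟨orbitMap S P.anchor P.anchor_smul, continuous_orbitMap _ P.anchor.continuous⟩
    anchor_smul := orbitMap_smul S P.anchor P.anchor_smul }

variable {P} {Q : TopQuotObj G X}

/-- The functor on morphisms. -/
def map (f : P ⟶ Q) : D.obj P ⟶ D.obj Q :=
  have := P.isPrincipal.continuousSMul
  have := Q.isPrincipal.continuousSMul
  TopQuotHom.ofEquivariant (P := D.obj P) (Q := D.obj Q) f.base
    (TopCat.ofHom ⟨orbitMap S f.total f.map_smul, continuous_orbitMap _ f.total.hom.continuous⟩)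
    (orbitMap_smul S _ f.map_smul)
    (by
      intro y
      obtain ⟨e, rfl⟩ := orbitMk_surjective S y
      exact f.proj_total e)
    (by
      intro y
      obtain ⟨e, rfl⟩ := orbitMk_surjective S y
      exact congrArg (orbitMk S) (f.anchor_map e))

/-- The functor `[X/G] → [(X/H)/Γ]`. -/
def functor : BasedFunctor (topQuotientStack G X) (topQuotientStack Γ (OrbitSpace S X)) where
  toFunctor :=
    show TopQuotObj G X ⥤ TopQuotObj Γ (OrbitSpace S X) from
    { obj := fun P => D.obj P
      map := fun f => D.map f
      map_id := fun P => TopQuotHom.hom_ext fun y => by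
        obtain ⟨e, rfl⟩ := orbitMk_surjective S y
        rfl
      map_comp := fun f g => TopQuotHom.hom_ext fun y => by
        obtain ⟨e, rfl⟩ := orbitMk_surjective S y
        rfl }
  w := rfl

include D in
theorem eq_of_orbitMk_eq {e e' : P.total} (h : orbitMk S e = orbitMk S e')
    (ha : P.anchor e = P.anchor e') : e = e' := by
  obtain ⟨a, rfl⟩ := mem_range_inl_smul.1 h
  have h1 : a • P.anchor e' = (1 : S.inl.range) • P.anchor e' := by
    rw [one_smul]; exact (P.anchor_smul a e').symm.trans ha
  rw [D.principal.smul_injective h1, one_smul]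

theorem map_injective {f g : P ⟶ Q} (h : D.map f = D.map g) : f = g :=
  TopQuotHom.hom_ext fun e => D.eq_of_orbitMk_eq
    (congrArg (fun φ : D.obj P ⟶ D.obj Q => φ.total (orbitMk S e)) h)
    ((f.anchor_map e).trans (g.anchor_map e).symm)

theorem map_surjective (φ : D.obj P ⟶ D.obj Q) : ∃ f : P ⟶ Q, D.map f = φ := by
  have PQ := D.principal_total Q
  have PP := D.principal_total P
  have := P.isPrincipal.continuousSMul
  have := Q.isPrincipal.continuousSMul
  obtain ⟨t, ht⟩ : ∃ t : OrbitSpace S P.total → OrbitSpace S Q.total, t = φ.total := ⟨_, rfl⟩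
  have hts : Continuous t := by
    rw [ht]; exact φ.total.hom.continuous
  have ht1 : ∀ (γ : Γ) y, t (γ • y) = γ • t y := by rw [ht]; exact φ.map_smul
  have ht2 : ∀ y, orbitMap S Q.anchor Q.anchor_smul (t y) = orbitMap S P.anchor P.anchor_smul y :=
    by rw [ht]; exact φ.anchor_map
  have ht3 : ∀ y, orbitLift S Q.proj (fun _ e => Q.isPrincipal.proj_smul _ e) (t y) =
      φ.base (orbitLift S P.proj (fun _ e => P.isPrincipal.proj_smul _ e) y) := by
    rw [ht]; exact φ.proj_total
  have hex : ∀ e : P.total, ∃ e' : Q.total,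
      orbitMk S e' = t (orbitMk S e) ∧ Q.anchor e' = P.anchor e := by
    intro e
    obtain ⟨e₁, he₁⟩ := orbitMk_surjective S (t (orbitMk S e))
    have h1 := ht2 (orbitMk S e)
    rw [← he₁, orbitMap_mk, orbitMap_mk] at h1
    obtain ⟨h, hh⟩ := orbitMk_eq_iff.1 h1.symm
    exact ⟨S.inl h • e₁, by rw [orbitMk_inl_smul, he₁], by rw [Q.anchor_smul, hh]⟩
  choose f hf1 hf2 using hex
  have hcont : Continuous f := by
    rw [continuous_iff_continuousAt]
    intro e
    obtain ⟨s, hs, hse, hπs⟩ := PQ.exists_section (f e)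
    rw [hf1] at hs hse hπs
    have hT : Continuous (fun z : P.total => t (orbitMk S z)) := hts.comp PP.continuous_proj
    have h1 : ContinuousAt (fun z => s (t (orbitMk S z))) e :=
      ContinuousAt.comp hs hT.continuousAt
    have h2 : ∀ᶠ z in 𝓝 e, orbitMk S (s (t (orbitMk S z))) = t (orbitMk S z) :=
      hT.continuousAt.eventually hπs
    have h3 : ContinuousAt
        (fun z => divAct (fun (h : S.inl.range) (x : X) => h • x) (P.anchor z)
          (Q.anchor (s (t (orbitMk S z))))) e := by
      refine D.principal.continuousAt_divAct P.anchor.continuous.continuousAt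
        (ContinuousAt.comp Q.anchor.continuous.continuousAt h1) ?_
      filter_upwards [h2] with z hz
      have := ht2 (orbitMk S z)
      rwa [← hz, orbitMap_mk, orbitMap_mk, eq_comm] at this
    refine ((continuous_subtype_val.continuousAt.comp h3).smul h1).congr_of_eventuallyEq ?_
    filter_upwards [h2] with z hz
    refine D.eq_of_orbitMk_eq ?_ ?_
    · exact (hf1 z).trans (hz.symm.trans (orbitMk_range_smul _ _).symm)
    · have h4 := ht2 (orbitMk S z)
      rw [← hz, orbitMap_mk, orbitMap_mk, eq_comm] at h4
      rw [hf2]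
      exact (D.principal.divAct_smul h4).symm.trans (Q.anchor_smul _ _).symm
  refine ⟨TopQuotHom.ofEquivariant φ.base (TopCat.ofHom ⟨f, hcont⟩) ?_ ?_ hf2, ?_⟩
  · intro g e
    refine D.eq_of_orbitMk_eq (P := Q) (e := f (g • e)) (e' := g • f e) ?_ ?_
    · rw [hf1, ← rightHom_smul_orbitMk, ht1, ← rightHom_smul_orbitMk, hf1]
    · rw [hf2, Q.anchor_smul, hf2, P.anchor_smul]
  · intro e
    have := ht3 (orbitMk S e)
    rwa [← hf1] at this
  · refine TopQuotHom.hom_ext fun y => ?_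
    obtain ⟨e, rfl⟩ := orbitMk_surjective S y
    have := hf1 e
    rw [ht] at this
    exact this

/-! ### The pullback of an object of `[(X/H)/Γ]` along `X → X/H` -/

variable (S) in
/-- The pullback of the total space of `Q` along `X → X/H`. -/
def Pull (Q : TopQuotObj Γ (OrbitSpace S X)) : Type u :=
  {p : Q.total × X // Q.anchor p.1 = orbitMk S p.2}

variable (Q : TopQuotObj Γ (OrbitSpace S X))

instance : TopologicalSpace (Pull S Q) :=
  inferInstanceAs (TopologicalSpace {p : Q.total × X // Q.anchor p.1 = orbitMk S p.2})

instance : MulAction G (Pull S Q) where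
  smul g p := ⟨(S.rightHom g • p.1.1, g • p.1.2), by
    rw [Q.anchor_smul, p.2, rightHom_smul_orbitMk]⟩
  one_smul p := by
    refine Subtype.ext (Prod.ext ?_ ?_)
    · change S.rightHom 1 • p.1.1 = _
      rw [map_one, one_smul]
    · exact one_smul G p.1.2
  mul_smul a b p := by
    refine Subtype.ext (Prod.ext ?_ ?_)
    · change S.rightHom (a * b) • p.1.1 = S.rightHom a • S.rightHom b • p.1.1
      rw [map_mul, mul_smul]
    · exact mul_smul a b p.1.2

theorem pull_val_smul (g : G) (p : Pull S Q) :
    (g • p).1 = (S.rightHom g • p.1.1, g • p.1.2) := rfl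

include D in
theorem pull_smul_injective {g g' : G} {p : Pull S Q} (h : g • p = g' • p) : g = g' := by
  have h1 := congrArg Subtype.val h
  rw [pull_val_smul, pull_val_smul, Prod.mk.injEq] at h1
  have h2 : g * g'⁻¹ ∈ S.inl.range := by
    rw [S.range_inl_eq_ker_rightHom, MonoidHom.mem_ker, map_mul, map_inv,
      Q.isPrincipal.smul_injective h1.1, mul_inv_cancel]
  have h3 : (⟨g * g'⁻¹, h2⟩ : S.inl.range) = 1 := by
    refine D.principal.smul_injective (e := g' • p.1.2) ?_
    rw [one_smul, ← h1.2]
    change (g * g'⁻¹) • g • p.1.2 = _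
    rw [h1.2, smul_smul]
    simpa using h1.2
  exact mul_inv_eq_one.1 (congrArg Subtype.val h3)

include D in
/-- The pullback of a principal `Γ`-bundle along `X → X/H` is a principal `G`-bundle. -/
theorem pull_principal :
    IsTopPrincipalBundle G (fun p : Pull S Q => Q.proj p.1.1) := by
  classical
  have := Q.isPrincipal.continuousSMul
  have hval : Continuous (fun p : Pull S Q => p.1) := continuous_subtype_val
  have : ContinuousSMul G (Pull S Q) := ⟨by
    refine Continuous.subtype_mk (Continuous.prodMk ?_ ?_) _
    · exact (D.isQuotientMap.continuous.comp continuous_fst).smul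
        (continuous_fst.comp (hval.comp continuous_snd))
    · exact continuous_fst.smul (continuous_snd.comp (hval.comp continuous_snd))⟩
  have hfst : Continuous (fun p : Pull S Q => p.1.1) := continuous_fst.comp hval
  have hsnd : Continuous (fun p : Pull S Q => p.1.2) := continuous_snd.comp hval
  have hπ : Continuous (fun p : Pull S Q => Q.proj p.1.1) :=
    Q.isPrincipal.continuous_proj.comp hfst
  refine .of_localTriv hπ (fun g p => Q.isPrincipal.proj_smul _ _) fun b => ?_
  obtain ⟨tF, hF⟩ := Q.isPrincipal.exists_localTriv b
  obtain ⟨tX, hX⟩ := D.principal.exists_localTriv (Q.anchor (tF.sec b))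
  -- The local sections of `G → Γ` are built from an orbit in `X`; a point of `X` is available as
  -- soon as the base has a point.
  have : Nonempty X := ⟨tX.sec (Q.anchor (tF.sec b))⟩
  let σ : OrbitSpace S X → X := fun z =>
    if z ∈ tX.base then tX.sec z else Function.surjInv (orbitMk_surjective S) z
  have hσ : ∀ z, orbitMk S (σ z) = z := by
    intro z
    by_cases hz : z ∈ tX.base
    · simp only [σ, if_pos hz]; exact tX.proj_sec z hz
    · simp only [σ, if_neg hz]; exact Function.surjInv_eq _ z
  have hσs : ContinuousOn σ tX.base := tX.continuousOn_sec.congr fun z hz => if_pos hz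
  let sec : Q.base → Pull S Q := fun b =>
    ⟨(tF.sec b, σ (Q.anchor (tF.sec b))), (hσ _).symm⟩
  have hsecv : ∀ b, (sec b).1 = (tF.sec b, σ (Q.anchor (tF.sec b))) := fun _ => rfl
  let base : Set Q.base := tF.base ∩ (fun b => Q.anchor (tF.sec b)) ⁻¹' tX.base
  have hanch : ContinuousOn (fun b => Q.anchor (tF.sec b)) tF.base :=
    Q.anchor.continuous.comp_continuousOn tF.continuousOn_sec
  have hbase : IsOpen base := hanch.isOpen_inter_preimage tF.isOpen_base tX.isOpen_base
  have hσa : ContinuousOn (fun b => σ (Q.anchor (tF.sec b))) base :=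
    hσs.comp (hanch.mono Set.inter_subset_left) fun b hb => hb.2
  have hsec : ContinuousOn sec base := by
    refine Topology.IsInducing.subtypeVal.continuousOn_iff.2 ?_
    exact (tF.continuousOn_sec.mono Set.inter_subset_left).prodMk hσa
  have key : ∀ (p : Pull S Q) (g : G), Q.proj p.1.1 ∈ tF.base →
      S.rightHom g = tF.trans p.1.1 →
      orbitMk S p.1.2 = orbitMk S (g • σ (Q.anchor (tF.sec (Q.proj p.1.1)))) := by
    intro p g hp hg
    rw [← rightHom_smul_orbitMk, hσ, ← Q.anchor_smul, hg, tF.trans_smul _ hp, p.2]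
  have key2 : ∀ (p : Pull S Q) (g : G) (h : S.inl.range), Q.proj p.1.1 ∈ tF.base →
      S.rightHom g = tF.trans p.1.1 →
      h • g • σ (Q.anchor (tF.sec (Q.proj p.1.1))) = p.1.2 →
      ((h : G) * g) • sec (Q.proj p.1.1) = p := by
    intro p g h hp hg hh
    refine Subtype.ext ?_
    rw [pull_val_smul, hsecv]
    refine Prod.ext ?_ ?_
    · change S.rightHom (h * g) • tF.sec _ = _
      rw [map_mul, rightHom_range, one_mul, hg, tF.trans_smul _ hp]
    · change ((h : G) * g) • σ _ = _
      rw [mul_smul]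
      exact hh
  have hdiv : ∀ (p : Pull S Q) (g : G), g • sec (Q.proj p.1.1) = p →
      divAct (fun (g : G) (p : Pull S Q) => g • p) p (sec (Q.proj p.1.1)) = g := by
    intro p g hg
    have hex : ∃ g : G, g • sec (Q.proj p.1.1) = p := ⟨g, hg⟩
    rw [divAct, dif_pos hex]
    exact D.pull_smul_injective Q (hex.choose_spec.trans hg.symm)
  have hact : ∀ p : Pull S Q, Q.proj p.1.1 ∈ tF.base →
      ∃ g : G, g • sec (Q.proj p.1.1) = p := by
    intro p hp
    obtain ⟨g, hg⟩ := S.rightHom_surjective (tF.trans p.1.1)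
    obtain ⟨h, hh⟩ := mem_range_inl_smul.1 (key p g hp hg)
    exact ⟨_, key2 p g h hp hg hh⟩
  have hproj : ∀ b ∈ base, Q.proj (sec b).1.1 = b := fun b hb => tF.proj_sec b hb.1
  refine ⟨{
    base := base
    isOpen_base := hbase
    sec := sec
    trans := fun p => divAct (fun (g : G) (p : Pull S Q) => g • p) p (sec (Q.proj p.1.1))
    continuousOn_sec := hsec
    continuousOn_trans := ?_
    proj_sec := hproj
    trans_smul := ?_
    trans_smul_sec := ?_ }, hF, hX⟩
  · intro p hp
    refine ContinuousAt.continuousWithinAt ?_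
    obtain ⟨U, ς, hU, hγ, hς, hςU⟩ := D.exists_section (tF.trans p.1.1)
    have hopen : IsOpen (Q.proj ⁻¹' tF.base) :=
      tF.isOpen_base.preimage Q.isPrincipal.continuous_proj
    have h1 : ContinuousAt (fun z : Pull S Q => tF.trans z.1.1) p :=
      ContinuousAt.comp (tF.continuousOn_trans.continuousAt (hopen.mem_nhds hp.1))
        hfst.continuousAt
    have h2 : ContinuousAt (fun z : Pull S Q => ς (tF.trans z.1.1)) p :=
      ContinuousAt.comp (hς.continuousAt (hU.mem_nhds hγ)) h1
    have h3 : ContinuousAt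
        (fun z : Pull S Q => σ (Q.anchor (tF.sec (Q.proj z.1.1)))) p :=
      ContinuousAt.comp (f := fun z : Pull S Q => Q.proj z.1.1)
        (hσa.continuousAt (hbase.mem_nhds hp)) hπ.continuousAt
    have hev : ∀ᶠ z : Pull S Q in 𝓝 p, Q.proj z.1.1 ∈ tF.base ∧
        S.rightHom (ς (tF.trans z.1.1)) = tF.trans z.1.1 := by
      filter_upwards [hπ.continuousAt.preimage_mem_nhds
        (tF.isOpen_base.mem_nhds hp.1), h1.preimage_mem_nhds (hU.mem_nhds hγ)]
        with z hz1 hz2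
      exact ⟨hz1, hςU _ hz2⟩
    have h4 := D.principal.continuousAt_divAct hsnd.continuousAt (h2.smul h3)
      (hev.mono fun z hz => key z _ hz.1 hz.2)
    refine ((continuous_subtype_val.continuousAt.comp h4).mul h2).congr_of_eventuallyEq ?_
    filter_upwards [hev] with z hz
    exact hdiv z _ (key2 z _ _ hz.1 hz.2 (D.principal.divAct_smul (key z _ hz.1 hz.2)))
  · intro p hp
    obtain ⟨g, hg⟩ := hact p hp.1
    rw [hdiv p g hg, hg]
  · intro g b hb
    have h1 : Q.proj (g • sec b).1.1 = b :=
      (Q.isPrincipal.proj_smul _ _).trans (hproj b hb)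
    exact hdiv _ _ (by rw [h1])

/-- The object of `[X/G]` obtained by pulling back along `X → X/H`. -/
def pullObj : TopQuotObj G X where
  base := Q.base
  total := TopCat.of (Pull S Q)
  action := inferInstanceAs (MulAction G (Pull S Q))
  proj := TopCat.ofHom ⟨fun p : Pull S Q => Q.proj p.1.1, (D.pull_principal Q).continuous_proj⟩
  isPrincipal := D.pull_principal Q
  anchor := ⟨fun p : Pull S Q => p.1.2, continuous_snd.comp continuous_subtype_val⟩
  anchor_smul := fun _ _ => rfl

/-- The quotient by `H` of the pullback is the given object. -/
def objPullObj : D.obj (D.pullObj Q) ⟶ Q :=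
  let P := D.pullObj Q
  have : ContinuousSMul G P.total := P.isPrincipal.continuousSMul
  have hinv : ∀ (h : H) (p : Pull S Q), (S.inl h • p).1.1 = p.1.1 := fun h p => by
    rw [pull_val_smul, S.rightHom_inl, one_smul]
  TopQuotHom.ofEquivariant (P := D.obj P) (𝟙 Q.base)
    (TopCat.ofHom ⟨orbitLift (E := P.total) S (fun p : Pull S Q => p.1.1) hinv,
      continuous_orbitLift (E := P.total) (f := fun p : Pull S Q => p.1.1) hinv
        (continuous_fst.comp continuous_subtype_val)⟩)
    (by
      intro γ y
      obtain ⟨p, rfl⟩ := orbitMk_surjective (E := P.total) S y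
      obtain ⟨g, rfl⟩ := S.rightHom_surjective γ
      exact (congrArg (orbitLift (E := P.total) S (fun p : Pull S Q => p.1.1) hinv)
        (rightHom_smul_orbitMk (X := P.total) S g p)).trans rfl)
    (by
      intro y
      obtain ⟨p, rfl⟩ := orbitMk_surjective (E := P.total) S y
      rfl)
    (by
      intro y
      obtain ⟨p, rfl⟩ := orbitMk_surjective (E := P.total) S y
      exact Subtype.property (p := fun p : Q.total × X => Q.anchor p.1 = orbitMk S p.2) p)

include D in
theorem areEquivalent :
    AreEquivalent (topQuotientStack G X) (topQuotientStack Γ (OrbitSpace S X)) := by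
  refine ⟨D.functor, ⟨⟨fun h => D.map_injective h⟩, ⟨fun f => D.map_surjective f⟩, ⟨fun Q => ?_⟩⟩⟩
  let Q' : TopQuotObj Γ (OrbitSpace S X) := Q
  have : IsIso (D.objPullObj Q').base := inferInstanceAs (IsIso (𝟙 Q'.base))
  have := TopQuotHom.isIso_of_isIso_base (D.objPullObj Q')
  let i : D.obj (D.pullObj Q') ≅ Q' := asIso (D.objPullObj Q')
  exact ⟨D.pullObj Q', ⟨i⟩⟩

end TopStages

end TopStages

/-! ### Fibre products through universal isomorphisms -/

section UniversalIso

variable {𝒮 : Type w₁} [Category.{v₁} 𝒮] {𝒳 : BasedCategory.{v₂, w₂} 𝒮}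
  {𝒴 : BasedCategory.{v₃, w₃} 𝒮} {V W Z : 𝒮}

namespace underline

/-- A map to `M` as an object of `M̲`. -/
def mk {M T : 𝒮} (f : T ⟶ M) : (underline M).obj := Over.mk f

/-- A map over `M` as a morphism of `M̲`. -/
def hom {M T T' : 𝒮} {f : T ⟶ M} {f' : T' ⟶ M} (h : T ⟶ T') (w : h ≫ f' = f) : mk f ⟶ mk f' :=
  Over.homMk h w

theorem hom_comp {M T T' T'' : 𝒮} {f : T ⟶ M} {f' : T' ⟶ M} {f'' : T'' ⟶ M} (h : T ⟶ T')
    (w : h ≫ f' = f) (h' : T' ⟶ T'') (w' : h' ≫ f'' = f') :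
    hom h w ≫ hom h' w' = hom (h ≫ h') (by rw [Category.assoc, w', w]) := rfl

instance isHomLift_hom {M T T' : 𝒮} {f : T ⟶ M} {f' : T' ⟶ M} (h : T ⟶ T') (w : h ≫ f' = f) :
    (underline M).p.IsHomLift h (hom h w) :=
  IsHomLift.map (underline M).p (hom h w)

end underline

/-- An isomorphism between the restrictions to `Z` of `p : V̲ ⟶ 𝒳` and `q : W̲ ⟶ 𝒳` that is universal
among such isomorphisms. -/
def HasUniversalIso (p : BasedFunctor (underline V) 𝒳) (q : BasedFunctor (underline W) 𝒳)
    (a : Z ⟶ V) (b : Z ⟶ W) : Prop :=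
  ∃ ι : p.obj (underline.mk a) ≅ q.obj (underline.mk b), 𝒳.p.IsHomLift (𝟙 Z) ι.hom ∧
    ∀ (T : 𝒮) (f : T ⟶ V) (g : T ⟶ W) (j : p.obj (underline.mk f) ≅ q.obj (underline.mk g)),
      𝒳.p.IsHomLift (𝟙 T) j.hom → ∃! h : T ⟶ Z, ∃ (ha : h ≫ a = f) (hb : h ≫ b = g),
        p.map (underline.hom h ha) ≫ ι.hom = j.hom ≫ q.map (underline.hom h hb)

theorem isStronglyCartesian_of_isHomLift
    (hcart : ∀ {x y : 𝒳.obj} (φ : x ⟶ y), 𝒳.p.IsStronglyCartesian (𝒳.p.map φ) φ) {R S : 𝒮}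
    (f : R ⟶ S) {x y : 𝒳.obj} (φ : x ⟶ y) [𝒳.p.IsHomLift f φ] : 𝒳.p.IsStronglyCartesian f φ := by
  subst_hom_lift 𝒳.p f φ
  exact hcart φ

variable {p : BasedFunctor (underline V) 𝒳} {q : BasedFunctor (underline W) 𝒳}
  {a : Z ⟶ V} {b : Z ⟶ W}

/-- The restriction of an isomorphism over `Z` along a map to `Z`. -/
theorem exists_restriction
    (hcart : ∀ {x y : 𝒳.obj} (φ : x ⟶ y), 𝒳.p.IsStronglyCartesian (𝒳.p.map φ) φ)
    (ι : p.obj (underline.mk a) ≅ q.obj (underline.mk b)) (hι : 𝒳.p.IsHomLift (𝟙 Z) ι.hom)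
    {T : 𝒮} (h : T ⟶ Z) :
    ∃ j : p.obj (underline.mk (h ≫ a)) ≅ q.obj (underline.mk (h ≫ b)),
      𝒳.p.IsHomLift (𝟙 T) j.hom ∧
        p.map (underline.hom h rfl) ≫ ι.hom = j.hom ≫ q.map (underline.hom h rfl) := by
  let ψ := q.map (underline.hom (f' := b) h rfl)
  have hψ : 𝒳.p.IsHomLift h ψ := BasedFunctor.preserves_isHomLift q h _
  have hψc := isStronglyCartesian_of_isHomLift hcart h ψ
  have hφι : 𝒳.p.IsHomLift h (p.map (underline.hom (f' := a) h rfl) ≫ ι.hom) := inferInstance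
  let j := Functor.IsStronglyCartesian.map 𝒳.p h ψ (Category.id_comp h).symm
    (p.map (underline.hom (f' := a) h rfl) ≫ ι.hom)
  have hj : 𝒳.p.IsHomLift (𝟙 T) j := Functor.IsStronglyCartesian.map_isHomLift 𝒳.p h ψ _ _
  -- The induced map `j` is Cartesian like every morphism of `𝒳` and lies over an identity, so it is
  -- an isomorphism.
  have hjc := isStronglyCartesian_of_isHomLift hcart (𝟙 T) j
  have : IsIso j := Functor.IsStronglyCartesian.isIso_of_base_isIso 𝒳.p (𝟙 T) j
  exact ⟨asIso j, hj, (Functor.IsStronglyCartesian.fac 𝒳.p h ψ (Category.id_comp h).symm _).symm⟩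

/-- A universal isomorphism exhibits its base as the fibre product. -/
theorem HasUniversalIso.represents
    (hcart : ∀ {x y : 𝒳.obj} (φ : x ⟶ y), 𝒳.p.IsStronglyCartesian (𝒳.p.map φ) φ)
    (hu : HasUniversalIso p q a b) : Represents p q a b := by
  obtain ⟨ι, hι, huniv⟩ := hu
  choose j hj hjι using fun h : Over Z => exists_restriction hcart ι hι h.hom
  have hext : ∀ {x : 𝒳.obj} {R T : 𝒮} (h : T ⟶ Z) {g : T ⟶ W} (hg : h ≫ b = g) (k : R ⟶ T)
      (u v : x ⟶ q.obj (underline.mk g)) [𝒳.p.IsHomLift k u] [𝒳.p.IsHomLift k v],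
      u ≫ q.map (underline.hom h hg) = v ≫ q.map (underline.hom h hg) → u = v := by
    intro x R T h g hg k u v _ _ huv
    have := isStronglyCartesian_of_isHomLift hcart h (q.map (underline.hom h hg))
    exact Functor.IsStronglyCartesian.ext 𝒳.p h _ k huv
  have hcomm : ∀ {h h' : Over Z} (k : h ⟶ h') (w : k.left ≫ h'.hom ≫ a = h.hom ≫ a)
      (w' : k.left ≫ h'.hom ≫ b = h.hom ≫ b),
      p.map (underline.hom k.left w) ≫ (j h').hom =
        (j h).hom ≫ q.map (underline.hom k.left w') := by
    intro h h' k w w'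
    have := hj h
    have := hj h'
    refine hext h'.hom rfl k.left _ _ ?_
    rw [Category.assoc, ← hjι, Category.assoc, ← Category.assoc, ← p.map_comp, ← q.map_comp,
      underline.hom_comp, underline.hom_comp]
    have hw : k.left ≫ h'.hom = h.hom := Over.w k
    simp only [hw]
    exact hjι h
  let Φ : Over Z ⥤ FibObj p q :=
    { obj := fun h =>
        { left := underline.mk (h.hom ≫ a)
          right := underline.mk (h.hom ≫ b)
          iso := j h
          isHomLift := hj h }
      map := fun {h h'} k =>
        { left := underline.hom k.left (by rw [← Category.assoc, Over.w k])
          right := underline.hom k.left (by rw [← Category.assoc, Over.w k])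
          isHomLift := underline.isHomLift_hom k.left _
          comm := hcomm k _ _ }
      map_id := fun h => rfl
      map_comp := fun k k' => rfl }
  have hfaithful : Φ.Faithful := ⟨fun {h h' k k'} e => by
    ext
    exact congrArg (fun z : Φ.obj h ⟶ Φ.obj h' => CommaMorphism.left (FibHom.left z)) e⟩
  have hfull : Φ.Full := ⟨fun {h h'} φ => by
    let l : Over.mk (h.hom ≫ a) ⟶ Over.mk (h'.hom ≫ a) := FibHom.left φ
    let r : Over.mk (h.hom ≫ b) ⟶ Over.mk (h'.hom ≫ b) := FibHom.right φ
    let k : h.left ⟶ h'.left := l.left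
    have hk : k ≫ h'.hom ≫ a = h.hom ≫ a := Over.w l
    have hφl : FibHom.left φ = underline.hom k hk := rfl
    have hr : r.left = k := by
      have h1 := FibHom.isHomLift φ
      have h2 := IsHomLift.fac' (underline W).p ((underline V).p.map (FibHom.left φ))
        (FibHom.right φ)
      exact h2.trans ((Category.id_comp _).trans (Category.comp_id _))
    have hk' : k ≫ h'.hom ≫ b = h.hom ≫ b := by
      rw [← hr]; exact Over.w r
    have hφr : FibHom.right φ = underline.hom k hk' :=
      (Over.OverMorphism.ext hr : r =
        (Over.homMk k hk' : Over.mk (h.hom ≫ b) ⟶ Over.mk (h'.hom ≫ b)))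
    have hc : p.map (underline.hom k hk) ≫ (j h').hom = (j h).hom ≫ q.map (underline.hom k hk') := by
      rw [← hφr]; exact FibHom.comm φ
    -- The maps `k ≫ h'.hom` and `h.hom` both induce the isomorphism `j h`, so the uniqueness clause
    -- makes them equal and `k` a morphism over `Z`.
    have hw : k ≫ h'.hom = h.hom := by
      refine (huniv h.left (h.hom ≫ a) (h.hom ≫ b) (j h) (hj h)).unique
        ⟨by rw [Category.assoc, hk], by rw [Category.assoc, hk'], ?_⟩ ⟨rfl, rfl, hjι h⟩
      rw [← underline.hom_comp k hk h'.hom rfl, ← underline.hom_comp k hk' h'.hom rfl,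
        p.map_comp, q.map_comp, Category.assoc, hjι h', ← Category.assoc, hc, Category.assoc]
    exact ⟨Over.homMk k hw, FibHom.ext hφl.symm hφr.symm⟩⟩
  have hess : Φ.EssSurj := ⟨fun P => by
    obtain ⟨⟨T, ⟨⟨⟩⟩, f⟩, r, i, hi⟩ := P
    have hb : r.left = T := FibObj.base_eq (F := p) (K := q) ⟨_, r, i, hi⟩
    obtain ⟨T', ⟨⟨⟩⟩, g⟩ := r
    obtain rfl : T' = T := hb
    let i' : p.obj (underline.mk f) ≅ q.obj (underline.mk g) := i
    have hi' : 𝒳.p.IsHomLift (𝟙 T') i'.hom := hi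
    obtain ⟨h, ⟨rfl, rfl, hh⟩, -⟩ := huniv T' f g i' hi'
    -- Both isomorphisms become equal after composition with the same Cartesian morphism. The given
    -- object is therefore literally the image of `h`.
    have hji : j (Over.mk h) = i' := by
      ext
      have := hj (Over.mk h)
      have h1 : 𝒳.p.IsHomLift (𝟙 T') (j (Over.mk h)).hom := this
      exact hext h rfl (𝟙 T') _ _ ((hjι (Over.mk h)).symm.trans hh)
    refine ⟨Over.mk h, ⟨eqToIso ?_⟩⟩
    change FibObj.mk (underline.mk (h ≫ a)) (underline.mk (h ≫ b)) (j (Over.mk h)) _ = _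
    congr 1⟩
  refine ⟨{ toFunctor := Φ, w := rfl }, ⟨hfaithful, hfull, hess⟩, ⟨?_⟩, ⟨?_⟩⟩
  · refine BasedNatIso.mkNatIso (NatIso.ofComponents (fun h => Iso.refl _) fun {h h'} k => ?_)
      fun h => ?_
    · exact (Category.comp_id (underline.hom k.left (by
        rw [← Category.assoc, Over.w k]) : underline.mk (h.hom ≫ a) ⟶ underline.mk (h'.hom ≫ a))).trans
        (Category.id_comp _).symm
    · exact IsHomLift.id rfl
  · refine BasedNatIso.mkNatIso (NatIso.ofComponents (fun h => Iso.refl _) fun {h h'} k => ?_)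
      fun h => ?_
    · exact (Category.comp_id (underline.hom k.left (by
        rw [← Category.assoc, Over.w k]) : underline.mk (h.hom ≫ b) ⟶ underline.mk (h'.hom ≫ b))).trans
        (Category.id_comp _).symm
    · exact IsHomLift.id rfl

/-- A universal isomorphism from a universal morphism to the value of `q` at the identity. -/
theorem HasUniversalIso.of_universal_hom
    (hcart : ∀ {x y : 𝒳.obj} (φ : x ⟶ y), 𝒳.p.IsStronglyCartesian (𝒳.p.map φ) φ)
    (τ : p.obj (underline.mk a) ⟶ q.obj (underline.mk (𝟙 W))) (hτ : 𝒳.p.IsHomLift b τ)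
    (huniv : ∀ (T : 𝒮) (f : T ⟶ V) (g : T ⟶ W)
      (ψ : p.obj (underline.mk f) ⟶ q.obj (underline.mk (𝟙 W))), 𝒳.p.IsHomLift g ψ →
      ∃! h : T ⟶ Z, h ≫ b = g ∧ ∃ ha : h ≫ a = f, p.map (underline.hom h ha) ≫ τ = ψ) :
    HasUniversalIso p q a b := by
  -- The object `q b` is the pullback of `q (𝟙 W)` along `b`, so `τ` factors through the Cartesian
  -- morphism `c`; the vertical factor is the required isomorphism.
  let c : q.obj (underline.mk b) ⟶ q.obj (underline.mk (𝟙 W)) :=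
    q.map (underline.hom b (Category.comp_id b))
  have hc : 𝒳.p.IsHomLift b c := BasedFunctor.preserves_isHomLift q b _
  have hcc := isStronglyCartesian_of_isHomLift hcart b c
  let i : p.obj (underline.mk a) ⟶ q.obj (underline.mk b) :=
    Functor.IsStronglyCartesian.map 𝒳.p b c (Category.id_comp b).symm τ
  have hi : 𝒳.p.IsHomLift (𝟙 Z) i :=
    Functor.IsStronglyCartesian.map_isHomLift 𝒳.p b c (Category.id_comp b).symm τ
  have hic : i ≫ c = τ := Functor.IsStronglyCartesian.fac 𝒳.p b c (Category.id_comp b).symm τ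
  have := isStronglyCartesian_of_isHomLift hcart (𝟙 Z) i
  have : IsIso i := Functor.IsStronglyCartesian.isIso_of_base_isIso 𝒳.p (𝟙 Z) i
  refine ⟨asIso i, hi, fun T f g j hj => ?_⟩
  let ψ : p.obj (underline.mk f) ⟶ q.obj (underline.mk (𝟙 W)) :=
    j.hom ≫ q.map (underline.hom g (Category.comp_id g))
  have hψ : 𝒳.p.IsHomLift g ψ := inferInstance
  have hcomp : ∀ (h : T ⟶ Z) (hb : h ≫ b = g), (j.hom ≫ q.map (underline.hom h hb)) ≫ c = ψ := by
    intro h hb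
    rw [Category.assoc, ← q.map_comp, underline.hom_comp]
    simp only [hb]
    rfl
  have hcomp' : ∀ (h : T ⟶ Z) (ha : h ≫ a = f),
      (p.map (underline.hom h ha) ≫ i) ≫ c = p.map (underline.hom h ha) ≫ τ := by
    intro h ha
    rw [Category.assoc, hic]
  obtain ⟨h, ⟨hb, ha, hh⟩, huniq⟩ := huniv T f g ψ hψ
  refine ⟨h, ⟨ha, hb, ?_⟩, ?_⟩
  · have h1 : 𝒳.p.IsHomLift h (p.map (underline.hom h ha) ≫ i) := inferInstance
    have h2 : 𝒳.p.IsHomLift h (j.hom ≫ q.map (underline.hom h hb)) := inferInstance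
    change p.map (underline.hom h ha) ≫ i = j.hom ≫ q.map (underline.hom h hb)
    refine Functor.IsStronglyCartesian.ext 𝒳.p b c h ?_
    exact (hcomp' h ha).trans (hh.trans (hcomp h hb).symm)
  · rintro h' ⟨ha', hb', hh'⟩
    refine huniq h' ⟨hb', ha', ?_⟩
    rw [← hcomp h' hb', ← hcomp' h' ha']
    exact congrArg (· ≫ c) hh'

end UniversalIso

/-! ### Strict inverses of equivalences -/

section StrictInverse

variable {𝒮 : Type w₁} [Category.{v₁} 𝒮] {𝒳 : BasedCategory.{v₂, w₂} 𝒮}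
  {𝒴 : BasedCategory.{v₃, w₃} 𝒮} (F : BasedFunctor 𝒳 𝒴) [F.toFunctor.Full] [F.toFunctor.Faithful]
  (obj : 𝒴.obj → 𝒳.obj) (i : ∀ Q, F.obj (obj Q) ≅ Q)
  (hi : ∀ Q, 𝒴.p.IsHomLift (𝟙 (𝒴.p.obj Q)) (i Q).hom)

include hi in
-- Conjugation by isomorphisms over identities does not change the base map, and a functor strictly
-- over the base reflects it.
theorem strictInverse_isHomLift {Q Q' : 𝒴.obj} (φ : Q ⟶ Q') :
    𝒳.p.IsHomLift (𝒴.p.map φ) (F.toFunctor.preimage ((i Q).hom ≫ φ ≫ (i Q').inv)) := by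
  have h1 := hi Q
  have h2 := hi Q'
  have h3 : 𝒴.p.IsHomLift (𝟙 (𝒴.p.obj Q')) (i Q').inv := IsHomLift.lift_id_inv _ _ _
  have h4 : 𝒴.p.IsHomLift (𝒴.p.map φ) ((i Q).hom ≫ φ ≫ (i Q').inv) := by
    have := IsHomLift.comp 𝒴.p (𝟙 _) (𝒴.p.map φ ≫ 𝟙 _) (i Q).hom (φ ≫ (i Q').inv)
    rwa [Category.id_comp, Category.comp_id] at this
  have : 𝒴.p.IsHomLift (𝒴.p.map φ)
      (F.map (F.toFunctor.preimage ((i Q).hom ≫ φ ≫ (i Q').inv))) := by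
    rwa [F.toFunctor.map_preimage]
  exact BasedFunctor.isHomLift_map F _ _

/-- The inverse, strictly over the base, of a fully faithful functor over the base, for a choice of
preimages up to isomorphisms over identities. -/
def strictInverse : BasedFunctor 𝒴 𝒳 where
  obj := obj
  map := fun {Q Q'} φ => F.toFunctor.preimage ((i Q).hom ≫ φ ≫ (i Q').inv)
  map_id := fun Q => F.toFunctor.map_injective (by simp)
  map_comp := fun f g => F.toFunctor.map_injective (by simp)
  w := CategoryTheory.Functor.ext
    (fun Q => by
      have := strictInverse_isHomLift F obj i hi (𝟙 Q)
      exact IsHomLift.domain_eq 𝒳.p (𝒴.p.map (𝟙 Q))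
        (F.toFunctor.preimage ((i Q).hom ≫ 𝟙 Q ≫ (i Q).inv)))
    (fun Q Q' φ => by
      have := strictInverse_isHomLift F obj i hi φ
      exact IsHomLift.fac' 𝒳.p (𝒴.p.map φ)
        (F.toFunctor.preimage ((i Q).hom ≫ φ ≫ (i Q').inv)))

theorem map_strictInverse_map {Q Q' : 𝒴.obj} (φ : Q ⟶ Q') :
    F.map ((strictInverse F obj i hi).map φ) = (i Q).hom ≫ φ ≫ (i Q').inv :=
  F.toFunctor.map_preimage _

omit obj i hi

variable {V W Z : 𝒮} {p : BasedFunctor (underline V) 𝒴} {q : BasedFunctor (underline W) 𝒳}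
  {a : Z ⟶ V} {b : Z ⟶ W}

/-- Universal isomorphisms are transported along equivalences. -/
theorem HasUniversalIso.transport (Ψ : BasedFunctor 𝒴 𝒳) (i : ∀ Q, F.obj (Ψ.obj Q) ≅ Q)
    (hi : ∀ Q, 𝒴.p.IsHomLift (𝟙 (𝒴.p.obj Q)) (i Q).hom)
    (hΨ : ∀ {Q Q' : 𝒴.obj} (φ : Q ⟶ Q'), F.map (Ψ.map φ) = (i Q).hom ≫ φ ≫ (i Q').inv)
    (h : HasUniversalIso p (q.comp F) a b) : HasUniversalIso (p.comp Ψ) q a b := by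
  obtain ⟨ι₀, hι, huniv₀⟩ := h
  let ι : p.obj (underline.mk a) ≅ F.obj (q.obj (underline.mk b)) := ι₀
  have hι : 𝒴.p.IsHomLift (𝟙 Z) ι.hom := hι
  have huniv : ∀ (T : 𝒮) (f : T ⟶ V) (g : T ⟶ W)
      (j : p.obj (underline.mk f) ≅ F.obj (q.obj (underline.mk g))),
      𝒴.p.IsHomLift (𝟙 T) j.hom → ∃! h : T ⟶ Z, ∃ (ha : h ≫ a = f) (hb : h ≫ b = g),
        p.map (underline.hom h ha) ≫ ι.hom = j.hom ≫ F.map (q.map (underline.hom h hb)) := huniv₀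
  let ι' : F.obj (Ψ.obj (p.obj (underline.mk a))) ≅ F.obj (q.obj (underline.mk b)) :=
    i (p.obj (underline.mk a)) ≪≫ ι
  have hvert : ∀ {T : 𝒮} (f : T ⟶ V), 𝒴.p.IsHomLift (𝟙 T) (i (p.obj (underline.mk f))).hom := by
    intro T f
    have h1 := hi (p.obj (underline.mk f))
    rwa [show 𝒴.p.obj (p.obj (underline.mk f)) = T from p.w_obj (underline.mk f)] at h1
  refine (?_ : ∃ κ : Ψ.obj (p.obj (underline.mk a)) ≅ q.obj (underline.mk b),
    𝒳.p.IsHomLift (𝟙 Z) κ.hom ∧ ∀ (T : 𝒮) (f : T ⟶ V) (g : T ⟶ W)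
      (j : Ψ.obj (p.obj (underline.mk f)) ≅ q.obj (underline.mk g)), 𝒳.p.IsHomLift (𝟙 T) j.hom →
      ∃! h : T ⟶ Z, ∃ (ha : h ≫ a = f) (hb : h ≫ b = g),
        Ψ.map (p.map (underline.hom h ha)) ≫ κ.hom = j.hom ≫ q.map (underline.hom h hb))
  refine ⟨F.toFunctor.preimageIso ι', ?_, ?_⟩
  · have h1 := hvert a
    have h2 : 𝒴.p.IsHomLift (𝟙 Z) ((i (p.obj (underline.mk a))).hom ≫ ι.hom) :=
      IsHomLift.comp_lift_id_left 𝒴.p (𝟙 Z) _ _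
    have : 𝒴.p.IsHomLift (𝟙 Z) (F.map (F.toFunctor.preimageIso ι').hom) := by
      rw [F.toFunctor.preimageIso_hom, F.toFunctor.map_preimage]
      exact h2
    exact BasedFunctor.isHomLift_map F _ _
  · intro T f g j hj
    let j' : p.obj (underline.mk f) ≅ F.obj (q.obj (underline.mk g)) :=
      (i (p.obj (underline.mk f))).symm ≪≫ F.toFunctor.mapIso j
    have hj' : 𝒴.p.IsHomLift (𝟙 T) j'.hom := by
      have h1 := hvert f
      have h2 : 𝒴.p.IsHomLift (𝟙 T) (i (p.obj (underline.mk f))).inv := IsHomLift.lift_id_inv _ _ _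
      have h3 : 𝒴.p.IsHomLift (𝟙 T) (F.map j.hom) := BasedFunctor.preserves_isHomLift F _ _
      have h4 : 𝒴.p.IsHomLift (𝟙 T) ((i (p.obj (underline.mk f))).inv ≫ F.map j.hom) :=
        IsHomLift.comp_lift_id_left 𝒴.p (𝟙 T) _ _
      exact h4
    -- Applying the faithful functor `F` and cancelling the comparison isomorphism turns one
    -- compatibility equation into the other, so the universal property carries over.
    have hiff : ∀ (h : T ⟶ Z) (ha : h ≫ a = f) (hb : h ≫ b = g),
        p.map (underline.hom h ha) ≫ ι.hom = j'.hom ≫ F.map (q.map (underline.hom h hb)) ↔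
        Ψ.map (p.map (underline.hom h ha)) ≫ (F.toFunctor.preimageIso ι').hom =
          j.hom ≫ q.map (underline.hom h hb) := by
      intro h ha hb
      refine Iff.trans ?_ F.toFunctor.map_injective.eq_iff
      rw [F.toFunctor.map_comp, F.toFunctor.map_comp, hΨ, F.toFunctor.preimageIso_hom,
        F.toFunctor.map_preimage]
      simp only [ι', j', Iso.trans_hom, Iso.symm_hom, Functor.mapIso_hom, Category.assoc,
        Iso.inv_hom_id_assoc]
      rw [Iso.eq_inv_comp]
    obtain ⟨h, ⟨ha, hb, hh⟩, huniq⟩ := huniv T f g j' hj'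
    refine ⟨h, ⟨ha, hb, (hiff h ha hb).1 hh⟩, ?_⟩
    rintro h' ⟨ha', hb', hh'⟩
    exact huniq h' ⟨ha', hb', (hiff h' ha' hb').2 hh'⟩

end StrictInverse

/-! ### Smooth quotient stacks are fibred in groupoids -/

section Cartesian

variable {k n : ℕ} {G : Type u} [Group G] [TopologicalSpace G]
  [ChartedSpace (EuclideanSpace ℝ (Fin k)) G] [LieGroup (𝓡 k) ∞ G] {X : Type u} [TopologicalSpace X]
  [ChartedSpace (EuclideanSpace ℝ (Fin n)) X] [MulAction G X]

/-- The Cartesian square of `φ` supplies the map of total spaces. Its equivariance follows from the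
uniqueness of lifts, and compatibility with the anchors from that of `φ` and `φ'`. -/
theorem SmoothQuotHom.existsUnique_lift {A P R : SmoothQuotObj k n G X} (φ : P ⟶ R) (φ' : A ⟶ R)
    (g : A.base ⟶ P.base) (hg : g ≫ φ.base = φ'.base) :
    ∃! χ : A ⟶ P, χ.base = g ∧ χ ≫ φ = φ' := by
  have hw : φ'.total ≫ R.proj = (A.proj ≫ g) ≫ φ.base := by
    rw [φ'.isPullback.w, Category.assoc, hg]
  let t := φ.isPullback.lift φ'.total (A.proj ≫ g) hw
  have h1 : ∀ e, fn φ.total (fn t e) = fn φ'.total e := fun e =>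
    congrFun (congrArg SmoothMap.toFun (φ.isPullback.lift_fst _ _ hw)) e
  have h2 : ∀ e, fn P.proj (fn t e) = fn g (fn A.proj e) := fun e =>
    congrFun (congrArg SmoothMap.toFun (φ.isPullback.lift_snd _ _ hw)) e
  refine ⟨SmoothQuotHom.ofEquivariant g t (fun a e => ?_) h2 fun e => ?_, ⟨rfl, ?_⟩, ?_⟩
  · refine P.principal.lift_unique R.principal φ.map_smul ?_ ?_
    · rw [h1, φ.map_smul, h1, φ'.map_smul]
    · rw [h2, A.isPrincipal.proj_smul, P.isPrincipal.proj_smul, h2]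
  · rw [← φ.anchor_map, h1, φ'.anchor_map]
  · exact SmoothQuotHom.hom_ext h1
  · rintro χ ⟨rfl, rfl⟩
    refine SmoothQuotHom.hom_ext fun e => ?_
    exact P.principal.lift_unique R.principal φ.map_smul (h1 e).symm
      ((SmoothQuotHom.proj_total χ e).trans (h2 e).symm)

/-- This is half of being fibred in groupoids, and the only property of the stack that the general
argument on universal isomorphisms uses. -/
theorem smoothQuotientStack_isStronglyCartesian {P R : (smoothQuotientStack k n G X).obj}
    (φ : P ⟶ R) :
    (smoothQuotientStack k n G X).p.IsStronglyCartesian ((smoothQuotientStack k n G X).p.map φ) φ where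
  universal_property' {A} g φ' h := by
    have hg := IsHomLift.eq_of_isHomLift (smoothQuotientStack k n G X).p
      (g ≫ (smoothQuotientStack k n G X).p.map φ) φ'
    obtain ⟨χ, ⟨h1, h2⟩, h3⟩ := SmoothQuotHom.existsUnique_lift (show SmoothQuotHom P R from φ)
      (show SmoothQuotHom A R from φ') g hg
    refine ⟨χ, ⟨?_, h2⟩, ?_⟩
    · subst h1
      exact IsHomLift.map (smoothQuotientStack k n G X).p χ
    · rintro ψ ⟨h4, h5⟩
      exact h3 ψ ⟨(IsHomLift.eq_of_isHomLift (smoothQuotientStack k n G X).p g ψ).symm, h5⟩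

end Cartesian

/-! ### The presentation of a quotient stack by trivial bundles -/

section Trivial

variable {r : ℕ} {Γ : Type u} [Group Γ] [TopologicalSpace Γ]
  [ChartedSpace (EuclideanSpace ℝ (Fin r)) Γ] [LieGroup (𝓡 r) ∞ Γ]

/-- The one-point manifold. -/
instance : ChartedSpace (EuclideanSpace ℝ (Fin 0)) PUnit.{u + 1} :=
  have : Unique (EuclideanSpace ℝ (Fin 0)) := Unique.mk' _
  ChartedSpace.ofDiscreteTopology

variable (r Γ) in
/-- A group as a principal bundle over a point. -/
theorem isPrincipal_punit :
    IsPrincipal r r 0 (fun g x : Γ => g * x) (fun _ : Γ => PUnit.unit.{u + 1}) where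
  contMDiff_act := contMDiff_mul (𝓡 r) ∞
  contMDiff_proj := contMDiff_const
  act_mul := mul_assoc
  proj_act := fun _ _ => rfl
  exists_localTriv _ := ⟨{
    base := Set.univ
    isOpen_base := isOpen_univ
    sec := fun _ => 1
    trans := id
    contMDiffOn_sec := contMDiffOn_const
    contMDiffOn_trans := contMDiffOn_id
    proj_sec := fun _ _ => rfl
    trans_act_sec := fun e _ => mul_one e
    trans_smul_sec := fun g _ _ => mul_one g }, trivial⟩

variable [T2Space Γ] [SecondCountableTopology Γ] (T : SmoothManifold.{u})

variable (r Γ) in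
/-- The total space `T × Γ` of the trivial principal bundle. -/
abbrev TrivSpace : Type u :=
  -- Realizing the product as the pullback of `Γ → pt` provides charts in a single Euclidean space,
  -- as the objects of `Diff` require.
  PullbackSpace (isPrincipal_punit r Γ)
    (contMDiff_const : ContMDiff (𝓡 T.dim) (𝓡 0) ∞ fun _ : T => PUnit.unit.{u + 1})

variable {T} in
variable (r) in
/-- The points of the trivial principal bundle. -/
def TrivSpace.mk (t : T) (γ : Γ) : TrivSpace r Γ T := ⟨(t, γ), rfl⟩

instance : MulAction Γ (TrivSpace r Γ T) where
  smul g p := TrivSpace.mk r p.val.1 (g * p.val.2)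
  one_smul _ := PullbackSpace.val_injective _ _ (Prod.ext rfl (one_mul _))
  mul_smul _ _ _ := PullbackSpace.val_injective _ _ (Prod.ext rfl (mul_assoc _ _ _))

theorem TrivSpace.eq_smul_mk (p : TrivSpace r Γ T) : p = p.val.2 • TrivSpace.mk r p.val.1 1 :=
  PullbackSpace.val_injective _ _ (Prod.ext rfl (mul_one _).symm)

theorem TrivSpace.contMDiff_mk : ContMDiff (𝓡 T.dim) (𝓡 (T.dim + r)) ∞
    (fun t : T => TrivSpace.mk r t (1 : Γ)) := fun _ =>
  PullbackSpace.contMDiffAt_of_val contMDiffAt_id contMDiffAt_const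

/-- The total space `T × Γ` as a smooth manifold. -/
@[reducible]
def trivTotal (r : ℕ) (Γ : Type u) [Group Γ] [TopologicalSpace Γ]
    [ChartedSpace (EuclideanSpace ℝ (Fin r)) Γ] [LieGroup (𝓡 r) ∞ Γ] [T2Space Γ]
    [SecondCountableTopology Γ] (T : SmoothManifold.{u}) : SmoothManifold.{u} where
  carrier := TrivSpace r Γ T
  dim := T.dim + r

theorem trivSpace_isPrincipal : IsPrincipal r (T.dim + r) T.dim
    (fun (g : Γ) (p : TrivSpace r Γ T) => g • p) (fun p => p.val.1) where
  contMDiff_act := fun _ => PullbackSpace.contMDiffAt_of_val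
    (((PullbackSpace.contMDiff_fst _ _).comp contMDiff_snd).contMDiffAt)
    ((contMDiff_fst.mul ((PullbackSpace.contMDiff_snd _ _).comp contMDiff_snd)).contMDiffAt)
  contMDiff_proj := PullbackSpace.contMDiff_fst _ _
  act_mul := mul_smul
  proj_act := fun _ _ => rfl
  exists_localTriv _ := ⟨{
    base := Set.univ
    isOpen_base := isOpen_univ
    sec := fun t => TrivSpace.mk r t 1
    trans := fun p => p.val.2
    contMDiffOn_sec := (TrivSpace.contMDiff_mk T).contMDiffOn
    contMDiffOn_trans := (PullbackSpace.contMDiff_snd _ _).contMDiffOn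
    proj_sec := fun _ _ => rfl
    trans_act_sec := fun e _ => (TrivSpace.eq_smul_mk T e).symm
    trans_smul_sec := fun g _ _ => mul_one g }, trivial⟩

variable {Y : SmoothManifold.{u}} [MulAction Γ Y] [ContMDiffSMul (𝓡 r) (𝓡 Y.dim) ∞ Γ Y] {T}

variable (r Γ) in
/-- The trivial bundle `T ← T × Γ → Y` associated to a map `T → Y`. -/
def trivObj (f : T ⟶ Y) : SmoothQuotObj r Y.dim Γ Y where
  base := T
  total := trivTotal r Γ T
  action := inferInstanceAs (MulAction Γ (TrivSpace r Γ T))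
  proj := ⟨fun p : TrivSpace r Γ T => p.val.1, PullbackSpace.contMDiff_fst _ _⟩
  isPrincipal := (trivSpace_isPrincipal T).isSmoothPrincipalBundle
  anchor := fun p : TrivSpace r Γ T => p.val.2 • fn f p.val.1
  contMDiff_anchor := (PullbackSpace.contMDiff_snd _ _).smul
    (f.contMDiff.comp (PullbackSpace.contMDiff_fst _ _))
  anchor_smul := fun g _ => mul_smul g _ _

/-- Morphisms from the trivial bundle are determined on the unit section. -/
theorem trivObj_hom_ext {f : T ⟶ Y} {Q : SmoothQuotObj r Y.dim Γ Y} {φ ψ : trivObj r Γ f ⟶ Q}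
    (h : ∀ t : T, fn φ.total (TrivSpace.mk r t (1 : Γ)) = fn ψ.total (TrivSpace.mk r t (1 : Γ))) :
    φ = ψ :=
  SmoothQuotHom.hom_ext fun p₀ => by
    let p : TrivSpace r Γ T := p₀
    have h1 := φ.map_smul p.val.2 (TrivSpace.mk r p.val.1 (1 : Γ))
    have h2 := ψ.map_smul p.val.2 (TrivSpace.mk r p.val.1 (1 : Γ))
    have h3 := TrivSpace.eq_smul_mk T p
    exact (congrArg (fn φ.total) h3).trans (h1.trans ((congrArg _ (h _)).trans
      (h2.symm.trans (congrArg (fn ψ.total) h3.symm))))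

/-- The morphism from a trivial bundle with a given value on the unit section. -/
def trivHom {f : T ⟶ Y} {Q : SmoothQuotObj r Y.dim Γ Y} (h : T ⟶ Q.total)
    (hf : ∀ t, Q.anchor (fn h t) = fn f t) : trivObj r Γ f ⟶ Q :=
  have := Q.isPrincipal.contMDiffSMul
  SmoothQuotHom.ofEquivariant (P := trivObj r Γ f) (h ≫ Q.proj)
    ⟨fun p : TrivSpace r Γ T => p.val.2 • fn h p.val.1, (PullbackSpace.contMDiff_snd _ _).smul
      (h.contMDiff.comp (PullbackSpace.contMDiff_fst _ _))⟩
    (fun g _ => mul_smul g _ _) (fun _ => Q.isPrincipal.proj_smul _ _)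
    (fun p => (Q.anchor_smul _ _).trans (congrArg _ (hf _)))

theorem trivHom_mk {f : T ⟶ Y} {Q : SmoothQuotObj r Y.dim Γ Y} (h : T ⟶ Q.total)
    (hf : ∀ t, Q.anchor (fn h t) = fn f t) (t : T) :
    fn (trivHom h hf).total (TrivSpace.mk r t (1 : Γ)) = fn h t := one_smul Γ _

/-- The unit section of the trivial bundle. -/
def trivUnit (f : T ⟶ Y) : T ⟶ (trivObj r Γ f).total :=
  ⟨fun t => TrivSpace.mk r t (1 : Γ), TrivSpace.contMDiff_mk T⟩

theorem anchor_trivUnit (f : T ⟶ Y) (t : T) :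
    (trivObj r Γ f).anchor (fn (trivUnit f) t) = fn f t := one_smul Γ _

/-- Trivial bundles pull back to trivial bundles. -/
def trivMap {T' : SmoothManifold.{u}} {f : T ⟶ Y} {f' : T' ⟶ Y} (k : T ⟶ T') (w : k ≫ f' = f) :
    trivObj r Γ f ⟶ trivObj r Γ f' :=
  trivHom (Q := trivObj r Γ f') (k ≫ trivUnit f') fun t =>
    (anchor_trivUnit f' _).trans (congrFun (congrArg SmoothMap.toFun w) t)

theorem trivMap_mk {T' : SmoothManifold.{u}} {f : T ⟶ Y} {f' : T' ⟶ Y} (k : T ⟶ T')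
    (w : k ≫ f' = f) (t : T) :
    fn (trivMap (r := r) (Γ := Γ) k w).total (TrivSpace.mk r t (1 : Γ)) =
      TrivSpace.mk r (fn k t) (1 : Γ) :=
  trivHom_mk _ _ t

variable (r Γ Y) in
/-- The presentation `Y̲ ⟶ [Y/Γ]`. -/
def presentation : BasedFunctor (underline Y) (smoothQuotientStack r Y.dim Γ Y) where
  toFunctor :=
    show Over Y ⥤ SmoothQuotObj r Y.dim Γ Y from
    { obj := fun f => trivObj r Γ f.hom
      map := fun k => trivMap k.left (Over.w k)
      map_id := fun f => trivObj_hom_ext fun t => trivMap_mk (𝟙 f.left) _ t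
      map_comp := fun k l => trivObj_hom_ext fun t =>
        (trivMap_mk (k.left ≫ l.left) _ t).trans
          ((congrArg (fn (trivMap l.left (Over.w l)).total) (trivMap_mk k.left (Over.w k) t)).trans
            (trivMap_mk l.left (Over.w l) (fn k.left t))).symm }
  w := rfl

end Trivial

section Presentation

variable {r : ℕ} {Γ : Type u} [Group Γ] [TopologicalSpace Γ]
  [ChartedSpace (EuclideanSpace ℝ (Fin r)) Γ] [LieGroup (𝓡 r) ∞ Γ]
  [T2Space Γ] [SecondCountableTopology Γ]
  {Y : SmoothManifold.{u}} [MulAction Γ Y] [ContMDiffSMul (𝓡 r) (𝓡 Y.dim) ∞ Γ Y]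

/-- The base of `q (𝟙 W)` equals `W` only through a propositional equality, and this absorbs the
resulting transport. -/
theorem comp_comp_eqToHom_eq {𝒮 : Type*} [Category 𝒮] {A B C D : 𝒮} {s : A ⟶ B} {π : B ⟶ C}
    {β : A ⟶ C} {g : A ⟶ D} (h : C = D) (hs : s ≫ π = β) (hβ : β = 𝟙 A ≫ g ≫ eqToHom h.symm) :
    s ≫ π ≫ eqToHom h = g := by
  subst h
  simpa [hs] using hβ

/-- The fibre product of the presentation of `[Y/Γ]` and a morphism `q : W̲ ⟶ [Y/Γ]` is the total
space of the principal bundle on `W` defined by `q`. -/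
theorem presentation_hasUniversalIso {W : SmoothManifold.{u}}
    (q : BasedFunctor (underline W) (smoothQuotientStack r Y.dim Γ Y))
    (Q : SmoothQuotObj r Y.dim Γ Y) (hQ : Q = q.obj (underline.mk (𝟙 W))) (hW : Q.base = W) :
    HasUniversalIso (presentation r Γ Y) q (⟨Q.anchor, Q.contMDiff_anchor⟩ : Q.total ⟶ Y)
      (Q.proj ≫ eqToHom hW) := by
  subst hQ
  let 𝒴 := smoothQuotientStack r Y.dim Γ Y
  let Q : SmoothQuotObj r Y.dim Γ Y := q.obj (underline.mk (𝟙 W))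
  let a : Q.total ⟶ Y := ⟨Q.anchor, Q.contMDiff_anchor⟩
  let b : Q.total ⟶ W := Q.proj ≫ eqToHom hW
  have hcart : ∀ {x y : 𝒴.obj} (φ : x ⟶ y), 𝒴.p.IsStronglyCartesian (𝒴.p.map φ) φ :=
    fun φ => smoothQuotientStack_isStronglyCartesian φ
  -- The tautological morphism is `(e, γ) ↦ γ • e` on the trivial bundle over the total space. It is
  -- universal because a morphism from `T × Γ` to `Q` is determined by its values on the unit
  -- section, a map from `T` to the total space.
  let τ : trivObj r Γ a ⟶ Q := trivHom (𝟙 Q.total) fun _ => rfl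
  have hτ : 𝒴.p.IsHomLift b τ := by
    have h1 : 𝒴.p.IsHomLift (𝟙 Q.total ≫ Q.proj) τ := IsHomLift.map 𝒴.p τ
    rw [Category.id_comp] at h1
    exact (IsHomLift.lift_comp_eqToHom_iff 𝒴.p Q.proj τ hW).2 h1
  refine .of_universal_hom hcart τ hτ fun T f g ψ₀ hψ => ?_
  let ψ : trivObj r Γ f ⟶ Q := ψ₀
  have hval : ∀ (h : T ⟶ Q.total) (ha : h ≫ a = f) (t : T),
      fn (trivMap h ha ≫ τ : trivObj r Γ f ⟶ Q).total (TrivSpace.mk r t (1 : Γ)) = fn h t :=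
    fun h ha t => (congrArg (fn τ.total) (trivMap_mk h ha t)).trans
      (trivHom_mk (𝟙 Q.total) (fun _ => rfl) (fn h t))
  have hanchor : (trivUnit f ≫ ψ.total) ≫ a = f :=
    SmoothMap.ext (funext fun t => (ψ.anchor_map _).trans (anchor_trivUnit f t))
  refine ⟨trivUnit f ≫ ψ.total, ⟨?_, hanchor, ?_⟩, ?_⟩
  · let β : T ⟶ Q.base := ψ.base
    exact comp_comp_eqToHom_eq (β := β) hW (SmoothMap.ext (funext fun t => ψ.proj_total _))
      (IsHomLift.fac' 𝒴.p g ψ₀)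
  · exact trivObj_hom_ext fun t => hval _ hanchor t
  · rintro h ⟨-, ha, hh⟩
    refine SmoothMap.ext (funext fun t => ?_)
    exact (hval h ha t).symm.trans (congrArg (fun φ : trivObj r Γ f ⟶ Q =>
      fn φ.total (TrivSpace.mk r t (1 : Γ))) hh)

end Presentation

/-! ### Deligne-Mumford stacks -/

section DeligneMumford

/-- The projection of a principal bundle with discrete group is a local diffeomorphism. -/
theorem IsPrincipal.isLocalDiffeomorph {k d m : ℕ} {K E B : Type*} [Group K] [TopologicalSpace K]
    [ChartedSpace (EuclideanSpace ℝ (Fin k)) K] [TopologicalSpace E]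
    [ChartedSpace (EuclideanSpace ℝ (Fin d)) E] [TopologicalSpace B]
    [ChartedSpace (EuclideanSpace ℝ (Fin m)) B] {act : K → E → E} {π : E → B}
    (P : IsPrincipal k d m act π) [DiscreteTopology K] :
    IsLocalDiffeomorph (𝓡 d) (𝓡 m) ∞ π := by
  intro e
  obtain ⟨t, ht⟩ := P.exists_localTriv (π e)
  have hopen : IsOpen (π ⁻¹' t.base) := t.isOpen_base.preimage P.contMDiff_proj.continuous
  have hsec : ContMDiffOn (𝓡 m) (𝓡 d) ∞ (fun b => act (t.trans e) (t.sec b)) t.base :=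
    P.contMDiff_act.comp_contMDiffOn (contMDiffOn_const.prodMk t.contMDiffOn_sec)
  have hmem : ∀ b ∈ t.base, π (act (t.trans e) (t.sec b)) = b := fun b hb => by
    rw [P.proj_act, t.proj_sec b hb]
  exact ⟨{
    toFun := π
    invFun := fun b => act (t.trans e) (t.sec b)
    -- The sheet on which the group coordinate keeps its value at `e` is open because the group is
    -- discrete.
    source := π ⁻¹' t.base ∩ t.trans ⁻¹' {t.trans e}
    target := t.base
    map_source' := fun x hx => hx.1
    map_target' := fun b hb => ⟨by rw [Set.mem_preimage, hmem b hb]; exact hb,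
      t.trans_smul_sec _ b hb⟩
    left_inv' := fun x hx => by
      have h1 : t.trans x = t.trans e := hx.2
      rw [← h1]
      exact t.trans_act_sec x hx.1
    right_inv' := hmem
    open_source := t.contMDiffOn_trans.continuousOn.isOpen_inter_preimage hopen
      (isOpen_discrete _)
    open_target := t.isOpen_base
    contMDiffOn_toFun := P.contMDiff_proj.contMDiffOn
    contMDiffOn_invFun := hsec }, ⟨ht, rfl⟩, fun _ _ => rfl⟩

variable {Γ : Type u} [Group Γ] [TopologicalSpace Γ]
  [ChartedSpace (EuclideanSpace ℝ (Fin 0)) Γ] [LieGroup (𝓡 0) ∞ Γ] [DiscreteTopology Γ]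
  [SecondCountableTopology Γ]
  {Y : SmoothManifold.{u}} [MulAction Γ Y] [ContMDiffSMul (𝓡 0) (𝓡 Y.dim) ∞ Γ Y]

theorem etale_comp_eqToHom {M N N' : SmoothManifold.{u}} (f : M ⟶ N) (h : N = N')
    (hs : Function.Surjective (fn f)) (hf : IsLocalDiffeomorph (𝓡 M.dim) (𝓡 N.dim) ∞ (fn f)) :
    Function.Surjective (fn (f ≫ eqToHom h)) ∧
      IsLocalDiffeomorph (𝓡 M.dim) (𝓡 N'.dim) ∞ (fn (f ≫ eqToHom h)) := by
  subst h
  exact ⟨hs, hf⟩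

/-- Through the isomorphism the total space becomes `Y × Γ`, and the pair of anchor and projection
becomes `(γ • y, y)`, which is proper by assumption. -/
theorem isProperMap_of_iso_trivObj {Q : SmoothQuotObj 0 Y.dim Γ Y} (i : Q ≅ trivObj 0 Γ (𝟙 Y))
    (hW : Q.base = Y) (hi : i.hom.base = eqToHom hW)
    (hprop : IsProperMap fun q : Γ × Y => (q.1 • q.2, q.2)) :
    IsProperMap fun z : Q.total => (Q.anchor z, fn (Q.proj ≫ eqToHom hW) z) := by
  let e : Q.total ≃ₜ TrivSpace 0 Γ Y :=
    { toFun := fn i.hom.total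
      invFun := fn i.inv.total
      left_inv := fun z => congrFun (congrArg (fun φ : Q ⟶ Q => fn φ.total) i.hom_inv_id) z
      right_inv := fun z => congrFun (congrArg
        (fun φ : trivObj 0 Γ (𝟙 Y) ⟶ trivObj 0 Γ (𝟙 Y) => fn φ.total) i.inv_hom_id) z
      continuous_toFun := i.hom.total.contMDiff.continuous
      continuous_invFun := i.inv.total.contMDiff.continuous }
  have hval : IsClosedEmbedding (PullbackSpace.val : TrivSpace 0 Γ Y → Y × Γ) := by
    refine ⟨PullbackSpace.isEmbedding_val _ _, ?_⟩
    have : Set.range (PullbackSpace.val : TrivSpace 0 Γ Y → Y × Γ) = Set.univ :=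
      Set.range_eq_univ.2 fun p => ⟨TrivSpace.mk 0 p.1 p.2, rfl⟩
    rw [this]
    exact isClosed_univ
  have h1 := hprop.comp ((Homeomorph.prodComm Y Γ).isProperMap.comp
    (hval.isProperMap.comp e.isProperMap))
  have h2 : (fun z : Q.total => (Q.anchor z, fn (Q.proj ≫ eqToHom hW) z)) =
      (fun q : Γ × Y => (q.1 • q.2, q.2)) ∘ (Homeomorph.prodComm Y Γ) ∘
        PullbackSpace.val ∘ e := by
    funext z
    refine Prod.ext (i.hom.anchor_map z).symm ?_
    change fn (Q.proj ≫ eqToHom hW) z = _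
    rw [← hi]
    exact (i.hom.proj_total z).symm
  rw [h2]
  exact h1

/-- A stack equivalent to the quotient of a manifold by a discrete group acting properly is a
Deligne-Mumford stack. -/
theorem isDeligneMumford_of_functor {𝒳 : BasedCategory.{v₂, w₂} SmoothManifold.{u}}
    (hcart : ∀ {x y : 𝒳.obj} (φ : x ⟶ y), 𝒳.p.IsStronglyCartesian (𝒳.p.map φ) φ)
    (F : BasedFunctor 𝒳 (smoothQuotientStack 0 Y.dim Γ Y)) [F.toFunctor.Full]
    [F.toFunctor.Faithful]
    (hF : ∀ Q, ∃ (P : 𝒳.obj) (i : F.obj P ≅ Q), (smoothQuotientStack 0 Y.dim Γ Y).p.IsHomLift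
      (𝟙 ((smoothQuotientStack 0 Y.dim Γ Y).p.obj Q)) i.hom)
    (hprop : IsProperMap fun q : Γ × Y => (q.1 • q.2, q.2)) : IsDeligneMumford 𝒳 := by
  choose obj i hi using hF
  let Ψ := strictInverse F obj i hi
  have key : ∀ (W : SmoothManifold.{u}) (q : BasedFunctor (underline W) 𝒳)
      (Q : SmoothQuotObj 0 Y.dim Γ Y) (hQ : Q = F.obj (q.obj (underline.mk (𝟙 W))))
      (hW : Q.base = W),
      Represents ((presentation 0 Γ Y).comp Ψ) q (⟨Q.anchor, Q.contMDiff_anchor⟩ : Q.total ⟶ Y)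
        (Q.proj ≫ eqToHom hW) := fun W q Q hQ hW =>
    (HasUniversalIso.transport F Ψ i hi (map_strictInverse_map F obj i hi)
      (presentation_hasUniversalIso (q.comp F) Q hQ hW)).represents hcart
  refine ⟨Y, (presentation 0 Γ Y).comp Ψ, fun W q => ?_, ?_⟩
  · let Q : SmoothQuotObj 0 Y.dim Γ Y := F.obj (q.obj (underline.mk (𝟙 W)))
    have hW : Q.base = W := (q.comp F).w_obj (underline.mk (𝟙 W))
    exact ⟨Q.total, _, _, key W q Q rfl hW, etale_comp_eqToHom Q.proj hW Q.principal.surjective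
      Q.principal.isLocalDiffeomorph⟩
  -- For the diagonal the second morphism is the presentation itself, and the bundle it classifies
  -- over `Y` is trivial up to an isomorphism over the identity.
  · let Q : SmoothQuotObj 0 Y.dim Γ Y := F.obj (obj (trivObj 0 Γ (𝟙 Y)))
    let j : Q ≅ trivObj 0 Γ (𝟙 Y) := i (trivObj 0 Γ (𝟙 Y))
    have hj := hi (trivObj 0 Γ (𝟙 Y))
    have hW : Q.base = Y := @IsHomLift.domain_eq _ _ _ _ (smoothQuotientStack 0 Y.dim Γ Y).p
      _ _ _ _ (𝟙 ((smoothQuotientStack 0 Y.dim Γ Y).p.obj (trivObj 0 Γ (𝟙 Y))))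
      (i (trivObj 0 Γ (𝟙 Y))).hom hj
    refine ⟨Q.total, _, _, key Y _ Q rfl hW, isProperMap_of_iso_trivObj j hW ?_ hprop⟩
    have := @IsHomLift.fac' _ _ _ _ (smoothQuotientStack 0 Y.dim Γ Y).p
      _ _ _ _ (𝟙 ((smoothQuotientStack 0 Y.dim Γ Y).p.obj (trivObj 0 Γ (𝟙 Y))))
      (i (trivObj 0 Γ (𝟙 Y))).hom hj
    exact this.trans (by rw [Category.id_comp, eqToHom_trans]; rfl)

end DeligneMumford

/-! ### Quotients by the identity component -/

section OpenSubgroup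

variable {k : ℕ} {G : Type u} [Group G] [TopologicalSpace G]
  [ChartedSpace (EuclideanSpace ℝ (Fin k)) G]

/-- The charts of an open subgroup of a Lie group. -/
abbrev openSubgroupChartedSpace (N : Subgroup G) (hN : IsOpen (N : Set G)) :
    ChartedSpace (EuclideanSpace ℝ (Fin k)) N :=
  inferInstanceAs (ChartedSpace (EuclideanSpace ℝ (Fin k)) (⟨N, hN⟩ : TopologicalSpace.Opens G))

theorem contMDiff_openSubgroup_subtype (N : Subgroup G) (hN : IsOpen (N : Set G)) :
    let _ := openSubgroupChartedSpace (k := k) N hN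
    ContMDiff (𝓡 k) (𝓡 k) ∞ N.subtype :=
  contMDiff_subtype_val (U := (⟨N, hN⟩ : TopologicalSpace.Opens G))

theorem lieGroup_openSubgroup [LieGroup (𝓡 k) ∞ G] (N : Subgroup G) (hN : IsOpen (N : Set G)) :
    let _ := openSubgroupChartedSpace (k := k) N hN
    LieGroup (𝓡 k) ∞ N := by
  intro _
  have hι : ContMDiff (𝓡 k) (𝓡 k) ∞ (fun x : N => (x : G)) := contMDiff_openSubgroup_subtype N hN
  have : IsManifold (𝓡 k) ∞ N :=
    inferInstanceAs (IsManifold (𝓡 k) ∞ (⟨N, hN⟩ : TopologicalSpace.Opens G))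
  have hmul : ContMDiff ((𝓡 k).prod (𝓡 k)) (𝓡 k) ∞ fun p : N × N => p.1 * p.2 :=
    (ContMDiff.subtypeVal_comp_iff (⟨N, hN⟩ : TopologicalSpace.Opens G) _).1
      ((hι.comp contMDiff_fst).mul (hι.comp contMDiff_snd))
  have hinv : ContMDiff (𝓡 k) (𝓡 k) ∞ fun x : N => x⁻¹ :=
    (ContMDiff.subtypeVal_comp_iff (⟨N, hN⟩ : TopologicalSpace.Opens G) _).1 hι.inv
  exact { contMDiff_mul := hmul, contMDiff_inv := hinv }

end OpenSubgroup

section Discrete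

/-- The charts of a discrete space, as a manifold of dimension zero. -/
abbrev discreteChartedSpace (Γ : Type*) [TopologicalSpace Γ] [DiscreteTopology Γ] :
    ChartedSpace (EuclideanSpace ℝ (Fin 0)) Γ :=
  let _ : Unique (EuclideanSpace ℝ (Fin 0)) := Unique.mk' _
  ChartedSpace.ofDiscreteTopology

theorem lieGroup_discrete (Γ : Type*) [Group Γ] [TopologicalSpace Γ] [DiscreteTopology Γ] :
    let _ := discreteChartedSpace Γ
    LieGroup (𝓡 0) ∞ Γ := by
  intro _
  let _ : Unique (EuclideanSpace ℝ (Fin 0)) := Unique.mk' _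
  have : IsManifold (𝓡 0) ∞ Γ := IsManifold.of_discreteTopology ∞
  exact { contMDiff_mul := contMDiff_of_discreteTopology
          contMDiff_inv := contMDiff_of_discreteTopology }

end Discrete

/-! ### Properness for closed subgroups and for the residual action. -/

section Proper

variable {H G Γ X : Type u} [Group H] [Group G] [Group Γ] [TopologicalSpace G]
  [TopologicalSpace Γ] [TopologicalSpace X] [MulAction G X]
  (S : GroupExtension H G Γ)

/-- A subgroup embedded as a closed subspace acts properly if the group does. -/
theorem isProperMap_inl_smul [TopologicalSpace H] [ProperSMul G X] (hι : IsClosedEmbedding S.inl) :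
    IsProperMap fun q : H × X => (S.inl q.1 • q.2, q.2) :=
  (ProperSMul.isProperMap_smul_pair (G := G) (X := X)).comp (hι.isProperMap.prodMap isProperMap_id)

/-- If `G` acts properly on `X`, then its quotient `Γ` acts properly on the orbit space. -/
theorem isProperMap_orbitSpace [ContinuousConstSMul G X] [ProperSMul G X]
    (hφ : Continuous S.rightHom)
    (hc : Continuous fun q : Γ × OrbitSpace S X => q.1 • q.2) :
    IsProperMap fun q : Γ × OrbitSpace S X => (q.1 • q.2, q.2) := by
  have hprop : IsProperMap fun q : G × X => (q.1 • q.2, q.2) := ProperSMul.isProperMap_smul_pair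
  have hπ := isOpenQuotientMap_orbitMk (E := X) S
  rw [isProperMap_iff_ultrafilter] at hprop ⊢
  refine ⟨hc.prodMk continuous_snd, ?_⟩
  rintro 𝒰 ⟨y', y₀⟩ h𝒰
  obtain ⟨x', rfl⟩ := orbitMk_surjective S y'
  obtain ⟨x₀, rfl⟩ := orbitMk_surjective S y₀
  let q : G × X → Γ × OrbitSpace S X := Prod.map S.rightHom (orbitMk S)
  have hq : Continuous q := hφ.prodMap hπ.continuous
  -- The ultrafilter is lifted to `G × X` so that the pairs `(g • x, x)` converge to chosen lifts of
  -- the limit. Openness of the orbit map gives points near these lifts, and an element of `H`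
  -- adjusts `g` to reach them; properness upstairs then gives a limit, which projects to the one
  -- sought.
  have hne : ((𝒰 : Filter (Γ × OrbitSpace S X)).comap q ⊓
      (𝓝 (x', x₀)).comap fun p : G × X => (p.1 • p.2, p.2)).NeBot := by
    refine (((𝒰 : Filter _).basis_sets.comap q).inf
      ((𝓝 (x', x₀)).basis_sets.comap _)).neBot_iff.2 ?_
    rintro ⟨s, t⟩ ⟨hs, ht⟩
    have h1 : Prod.map (orbitMk S) (orbitMk S) '' t ∈ 𝓝 (orbitMk S x', orbitMk S x₀) :=
      (hπ.isOpenMap.prodMap hπ.isOpenMap).image_mem_nhds ht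
    obtain ⟨⟨γ, y⟩, hγs, ⟨u, v⟩, huv, h2⟩ := 𝒰.neBot.nonempty_of_mem
      (Filter.inter_mem hs (h𝒰 h1))
    obtain ⟨h2, rfl⟩ := Prod.ext_iff.1 h2
    obtain ⟨g, rfl⟩ := S.rightHom_surjective γ
    have h3 : orbitMk S u = orbitMk S (g • v) := h2.trans (rightHom_smul_orbitMk S g v)
    obtain ⟨h, rfl⟩ := orbitMk_eq_iff.1 h3
    refine ⟨(S.inl h * g, v), ?_, ?_⟩
    · change (S.rightHom (S.inl h * g), orbitMk S v) ∈ s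
      rwa [map_mul, S.rightHom_inl, one_mul]
    · change ((S.inl h * g) • v, v) ∈ t
      rwa [mul_smul]
  let 𝒱 := Ultrafilter.of ((𝒰 : Filter (Γ × OrbitSpace S X)).comap q ⊓
      (𝓝 (x', x₀)).comap fun p : G × X => (p.1 • p.2, p.2))
  have h𝒱 := Ultrafilter.of_le ((𝒰 : Filter (Γ × OrbitSpace S X)).comap q ⊓
      (𝓝 (x', x₀)).comap fun p : G × X => (p.1 • p.2, p.2))
  have h4 : 𝒱.map q = 𝒰 := Ultrafilter.coe_le_coe.1
    (Filter.map_le_iff_le_comap.2 (h𝒱.trans inf_le_left))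
  obtain ⟨⟨g, x⟩, hgx, hlim⟩ := hprop.2 (𝒰 := 𝒱)
    (Filter.tendsto_iff_comap.2 (h𝒱.trans inf_le_right))
  refine ⟨q (g, x), ?_, ?_⟩
  · obtain ⟨h5, rfl⟩ := Prod.ext_iff.1 hgx
    refine Prod.ext ?_ rfl
    exact (rightHom_smul_orbitMk S g x).trans (congrArg (orbitMk S) h5)
  · rw [← h4]
    exact (hq.tendsto _).comp (show Filter.Tendsto id (𝒱 : Filter _) (𝓝 (g, x)) from hlim)

end Proper

/-! ### The equivalence over `Diff`. -/

section Stages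

variable {l k r n m : ℕ} {H G Γ X : Type u}
  [Group H] [TopologicalSpace H] [ChartedSpace (EuclideanSpace ℝ (Fin l)) H] [LieGroup (𝓡 l) ∞ H]
  [Group G] [TopologicalSpace G] [ChartedSpace (EuclideanSpace ℝ (Fin k)) G] [LieGroup (𝓡 k) ∞ G]
  [Group Γ] [TopologicalSpace Γ] [ChartedSpace (EuclideanSpace ℝ (Fin r)) Γ] [LieGroup (𝓡 r) ∞ Γ]
  [TopologicalSpace X] [ChartedSpace (EuclideanSpace ℝ (Fin n)) X]
  [IsManifold (𝓡 n) ∞ X] [T2Space X] [SecondCountableTopology X]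
  [MulAction G X] [ContMDiffSMul (𝓡 k) (𝓡 n) ∞ G X]

theorem SmoothStages.areEquivalent {S : GroupExtension H G Γ}
    [ChartedSpace (EuclideanSpace ℝ (Fin m)) (OrbitSpace S X)] (D : SmoothStages l k r n m X S) :
    AreEquivalent (smoothQuotientStack k n G X) (smoothQuotientStack r m Γ (OrbitSpace S X)) :=
  ⟨D.functor, inferInstance, inferInstance, ⟨fun Q =>
    let ⟨P, i, _⟩ := D.exists_vertical_iso Q
    ⟨P, ⟨i⟩⟩⟩⟩

/-- A free and proper action of the kernel of an extension of Lie groups has a quotient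
manifold, for which the quotient in stages is defined. -/
theorem exists_smoothStages [T2Space G] [SecondCountableTopology G] [T2Space Γ]
    {S : GroupExtension H G Γ}
    (hι : ContMDiff (𝓡 l) (𝓡 k) ∞ S.inl) (hφ : ContMDiff (𝓡 k) (𝓡 r) ∞ S.rightHom)
    (hfree : ∀ (h : H) (x : X), S.inl h • x = x → h = 1)
    (hprop : IsProperMap fun q : H × X => (S.inl q.1 • q.2, q.2)) :
    ∃ (m : ℕ) (_ : ChartedSpace (EuclideanSpace ℝ (Fin m)) (OrbitSpace S X)),
      IsQuotientManifold n X m S ∧ ContMDiffSMul (𝓡 r) (𝓡 m) ∞ Γ (OrbitSpace S X) ∧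
      SmoothStages l k r n m X S := by
  obtain ⟨m, hm, hq, P⟩ := exists_orbit_manifold (k := k) (n := n) (E := X) hι hfree hprop
  have hsec := exists_local_section_lieHom hφ S.rightHom_surjective
  exact ⟨m, hm, hq, contMDiffSMul_orbitSpace (k := k) P hsec, hι, hφ, hfree, hprop, P, hsec⟩

end Stages

/-! ### Open normal subgroups acting freely. -/

section IdentityComponent

variable {k n : ℕ} {G X : Type u}
  [Group G] [TopologicalSpace G] [IsTopologicalGroup G] [ChartedSpace (EuclideanSpace ℝ (Fin k)) G]
  [LieGroup (𝓡 k) ∞ G] [T2Space G] [SecondCountableTopology G]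
  [TopologicalSpace X] [ChartedSpace (EuclideanSpace ℝ (Fin n)) X]
  [IsManifold (𝓡 n) ∞ X] [T2Space X] [SecondCountableTopology X]
  [MulAction G X] [ContMDiffSMul (𝓡 k) (𝓡 n) ∞ G X] [ProperSMul G X]

theorem isOpen_connectedComponentOfOne (k : ℕ) (G : Type u) [Group G] [TopologicalSpace G]
    [IsTopologicalGroup G] [ChartedSpace (EuclideanSpace ℝ (Fin k)) G] :
    IsOpen (Subgroup.connectedComponentOfOne G : Set G) :=
  have : LocallyConnectedSpace G :=
    ChartedSpace.locallyConnectedSpace (EuclideanSpace ℝ (Fin k)) G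
  isOpen_connectedComponent

/-- The quotient of a proper action by an open normal subgroup acting freely. -/
theorem exists_discrete_stages (N : Subgroup G) [N.Normal] (hN : IsOpen (N : Set G))
    (hfree : ∀ g ∈ N, ∀ x : X, g • x = x → g = 1) :
    DiscreteTopology (G ⧸ N) ∧
      ∃ (_ : ChartedSpace (EuclideanSpace ℝ (Fin 0)) (G ⧸ N)) (m : ℕ)
        (_ : ChartedSpace (EuclideanSpace ℝ (Fin m)) (OrbitSpace (extensionOfNormal N) X)),
        LieGroup (𝓡 0) ∞ (G ⧸ N) ∧ IsQuotientManifold n X m (extensionOfNormal N) ∧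
        ContMDiffSMul (𝓡 0) (𝓡 m) ∞ (G ⧸ N) (OrbitSpace (extensionOfNormal N) X) ∧
        AreEquivalent (smoothQuotientStack k n G X)
          (smoothQuotientStack 0 m (G ⧸ N) (OrbitSpace (extensionOfNormal N) X)) ∧
        IsDeligneMumford (smoothQuotientStack k n G X) := by
  have hd : DiscreteTopology (G ⧸ N) := QuotientGroup.discreteTopology hN
  let _ := openSubgroupChartedSpace (k := k) N hN
  have : LieGroup (𝓡 k) ∞ N := lieGroup_openSubgroup N hN
  let hΓ := discreteChartedSpace (G ⧸ N)
  have : LieGroup (𝓡 0) ∞ (G ⧸ N) := lieGroup_discrete (G ⧸ N)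
  -- A separable discrete space is countable. The total spaces of trivial bundles need a second
  -- countable structure group.
  have : Countable (G ⧸ N) := TopologicalSpace.separableSpace_iff_countable.1 inferInstance
  let S := extensionOfNormal N
  -- The fibres are open, so the projection is locally constant and hence smooth.
  have hφ : ContMDiff (𝓡 k) (𝓡 0) ∞ S.rightHom := by
    intro g
    refine (contMDiff_const (c := S.rightHom g)).contMDiffAt.congr_of_eventuallyEq ?_
    exact (continuous_quotient_mk'.isOpen_preimage _
      (isOpen_discrete {(g : G ⧸ N)})).mem_nhds rfl
  obtain ⟨m, hm, hq, hsm, D⟩ := exists_smoothStages (X := X) (S := S) (n := n)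
    (contMDiff_openSubgroup_subtype N hN) hφ
    (fun h x hx => Subtype.ext (hfree h h.2 x hx))
    (isProperMap_inl_smul S (N.isClosed_of_isOpen hN).isClosedEmbedding_subtypeVal)
  refine ⟨hd, hΓ, m, hm, ‹_›, hq, hsm, D.areEquivalent, ?_⟩
  have : ContinuousSMul G X := ContMDiffSMul.continuousSMul (I := 𝓡 k) (I' := 𝓡 n) ∞
  have hc : ContinuousSMul (G ⧸ N) (OrbitSpace S X) :=
    ContMDiffSMul.continuousSMul (I := 𝓡 0) (I' := 𝓡 m) ∞
  have hprop := isProperMap_orbitSpace (X := X) S hφ.continuous hc.continuous_smul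
  have := hq.isManifold
  have := hq.t2Space
  have := hq.secondCountable
  let Y : SmoothManifold.{u} := { carrier := OrbitSpace S X, dim := m }
  let _ : MulAction (G ⧸ N) Y := inferInstanceAs (MulAction (G ⧸ N) (OrbitSpace S X))
  have : ContMDiffSMul (𝓡 0) (𝓡 Y.dim) ∞ (G ⧸ N) Y := hsm
  exact isDeligneMumford_of_functor (Y := Y)
    (fun φ => smoothQuotientStack_isStronglyCartesian φ) D.functor D.exists_vertical_iso hprop

end IdentityComponent

end QuotientStacks

end

open QuotientStacks in
theorem mainTheorem10 :
    -- quotients in stages over `Top`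
    (∀ (H G Γ X : Type u) [Group H] [TopologicalSpace H] [IsTopologicalGroup H]
        [Group G] [TopologicalSpace G] [IsTopologicalGroup G]
        [Group Γ] [TopologicalSpace Γ] [IsTopologicalGroup Γ]
        [TopologicalSpace X] [MulAction G X] [ContinuousSMul G X]
        (S : GroupExtension H G Γ),
        IsEmbedding S.inl → IsQuotientMap S.rightHom →
        (∀ (h : H) (x : X), S.inl h • x = x → h = 1) →
        IsTopPrincipalBundle S.inl.range (orbitMk S : X → OrbitSpace S X) →
        AreEquivalent (topQuotientStack G X) (topQuotientStack Γ (OrbitSpace S X))) ∧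
    -- quotients in stages over `Diff`
    (∀ (l k r n : ℕ) (H G Γ X : Type u)
        [Group H] [TopologicalSpace H] [ChartedSpace (EuclideanSpace ℝ (Fin l)) H]
        [LieGroup (𝓡 l) ∞ H] [T2Space H] [SecondCountableTopology H]
        [Group G] [TopologicalSpace G] [ChartedSpace (EuclideanSpace ℝ (Fin k)) G]
        [LieGroup (𝓡 k) ∞ G] [T2Space G] [SecondCountableTopology G]
        [Group Γ] [TopologicalSpace Γ] [ChartedSpace (EuclideanSpace ℝ (Fin r)) Γ]
        [LieGroup (𝓡 r) ∞ Γ] [T2Space Γ] [SecondCountableTopology Γ]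
        [TopologicalSpace X] [ChartedSpace (EuclideanSpace ℝ (Fin n)) X]
        [IsManifold (𝓡 n) ∞ X] [T2Space X] [SecondCountableTopology X]
        [MulAction G X] [ContMDiffSMul (𝓡 k) (𝓡 n) ∞ G X]
        (S : GroupExtension H G Γ),
        ContMDiff (𝓡 l) (𝓡 k) ∞ S.inl → ContMDiff (𝓡 k) (𝓡 r) ∞ S.rightHom →
        (∀ (h : H) (x : X), S.inl h • x = x → h = 1) →
        IsProperMap (fun q : H × X => (S.inl q.1 • q.2, q.2)) →
        ∃ (m : ℕ) (_ : ChartedSpace (EuclideanSpace ℝ (Fin m)) (OrbitSpace S X)),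
          IsQuotientManifold n X m S ∧
          ContMDiffSMul (𝓡 r) (𝓡 m) ∞ Γ (OrbitSpace S X) ∧
          AreEquivalent (smoothQuotientStack k n G X)
            (smoothQuotientStack r m Γ (OrbitSpace S X))) ∧
    -- the case of the identity component `G₀`
    (∀ (k n : ℕ) (G X : Type u)
        [Group G] [TopologicalSpace G] [IsTopologicalGroup G]
        [ChartedSpace (EuclideanSpace ℝ (Fin k)) G]
        [LieGroup (𝓡 k) ∞ G] [T2Space G] [SecondCountableTopology G]
        [TopologicalSpace X] [ChartedSpace (EuclideanSpace ℝ (Fin n)) X]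
        [IsManifold (𝓡 n) ∞ X] [T2Space X] [SecondCountableTopology X] [ConnectedSpace X]
        [MulAction G X] [ContMDiffSMul (𝓡 k) (𝓡 n) ∞ G X] [ProperSMul G X],
        (∀ g ∈ Subgroup.connectedComponentOfOne G, ∀ x : X, g • x = x → g = 1) →
        DiscreteTopology (G ⧸ Subgroup.connectedComponentOfOne G) ∧
        (∃ (_ : ChartedSpace (EuclideanSpace ℝ (Fin 0))
              (G ⧸ Subgroup.connectedComponentOfOne G))
            (m : ℕ) (_ : ChartedSpace (EuclideanSpace ℝ (Fin m))
              (OrbitSpace (extensionOfNormal (Subgroup.connectedComponentOfOne G)) X)),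
          LieGroup (𝓡 0) ∞ (G ⧸ Subgroup.connectedComponentOfOne G) ∧
          IsQuotientManifold n X m (extensionOfNormal (Subgroup.connectedComponentOfOne G)) ∧
          ContMDiffSMul (𝓡 0) (𝓡 m) ∞ (G ⧸ Subgroup.connectedComponentOfOne G)
            (OrbitSpace (extensionOfNormal (Subgroup.connectedComponentOfOne G)) X) ∧
          AreEquivalent (smoothQuotientStack k n G X)
            (smoothQuotientStack 0 m (G ⧸ Subgroup.connectedComponentOfOne G)
              (OrbitSpace (extensionOfNormal (Subgroup.connectedComponentOfOne G)) X))) ∧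
        IsDiscreteQuotient (smoothQuotientStack k n G X) ∧
        (CompactSpace G → IsGlobalQuotient (smoothQuotientStack k n G X))) := by
  refine ⟨?_, ?_, ?_⟩
  · intro H G Γ X _ _ _ _ _ _ _ _ _ _ _ _ S hι hquot hfree hprin
    exact TopStages.areEquivalent ⟨hquot, hprin⟩
  · intro l k r n H G Γ X
    intros
    rename_i S hι hφ hfree hprop
    obtain ⟨m, hm, hq, hsm, D⟩ := exists_smoothStages (X := X) (n := n) hι hφ hfree hprop
    exact ⟨m, hm, hq, hsm, D.areEquivalent⟩
  · intro k n G X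
    intros
    rename_i hfree
    have hN := isOpen_connectedComponentOfOne k G
    obtain ⟨hd, hΓ, m, hm, hlie, hq, hsm, heq, hDM⟩ :=
      exists_discrete_stages (k := k) (n := n) (X := X) (Subgroup.connectedComponentOfOne G) hN
        hfree
    have := hq.isManifold
    have := hq.t2Space
    have := hq.secondCountable
    let Y : SmoothManifold.{u} :=
      { carrier := OrbitSpace (extensionOfNormal (Subgroup.connectedComponentOfOne G)) X, dim := m }
    let Γ := G ⧸ Subgroup.connectedComponentOfOne G
    let hact : MulAction Γ Y := inferInstanceAs
      (MulAction Γ (OrbitSpace (extensionOfNormal (Subgroup.connectedComponentOfOne G)) X))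
    have hcount : Countable Γ := TopologicalSpace.separableSpace_iff_countable.1 inferInstance
    refine ⟨hd, ⟨hΓ, m, hm, hlie, hq, hsm, heq⟩,
      ⟨hDM, Γ, inferInstance, inferInstance, hΓ, Y, hact, hlie, hd, hcount, hsm, heq⟩, fun _ =>
      ⟨hDM, Γ, inferInstance, inferInstance, hΓ, Y, hact, hlie, hd, ?_, hsm, heq⟩⟩
    -- The component group is a quotient of a compact group, hence compact, and it is discrete.
    exact finite_of_compact_of_discrete
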